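/- **Theorem (Explicit formula for a family of quadratic Dirichlet characters).** An integer $d$ is a fundamental discriminant if either $d$ is square-free and $d\equiv 1 \bmod 4$, or $d=4m$ with $m$ square-free and $m\equiv 2,3 \bmod 4$. For such $d$ let $\chi_d=\left(\frac{d}{\cdot}\right)$ be the associated quadratic Dirichlet character modulo $|d|$ (the Kronecker symbol), let $a(\chi_d)=0$ if $\chi_d(-1)=1$ and $a(\chi_d)=1$ otherwise, and let $$\Lambda(s,\chi_d)=\pi^{-(s+a(\chi_d))/2}\,\Gamma\!\left(\frac{s+a(\chi_d)}{2}\right)|d|^{(s+a(\chi_d))/2}L(s,\chi_d)$$ be the completed $L$-function (analytically continued). Write its zeros, counted with multiplicity, as $\frac12+i\gamma_d$ with $\gamma_d\in\mathbb{C}$ (the Riemann hypothesis is not assumed). Let $g:\mathbb{R}\to\mathbb{C}$ be an even Schwartz function whose Fourier transform $\widehat g(\xi)=\int_{-\infty}^\infty g(x)e^{-2\pi i x\xi}\,dx$ has compact support, and extend $g$ to $\mathbb{C}$ by $g(z)=\int_{-\infty}^\infty \widehat g(\xi)e^{2\pi i z\xi}\,d\xi$. Let $X$ be a real number and let $\mathcal{F}(X)$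 be a nonempty finite set of fundamental discriminants $d\neq 1$ with $|d|\le X$. Then $$\frac1{|\mathcal{F}(X)|}\sum_{d\in\mathcal{F}(X)}\sum_{\gamma_d} g\!\left(\gamma_d\frac{\log X}{2\pi}\right)$$ $$=\frac1{|\mathcal{F}(X)|\log X}\int_{-\infty}^\infty g(\tau)\sum_{d\in\mathcal{F}(X)}\left[\log\frac{|d|}{\pi}+\frac12\frac{\Gamma'}{\Gamma}\!\left(\frac14+\frac{a(\chi_d)}2+\frac{i\pi\tau}{\log X}\right)+\frac12\frac{\Gamma'}{\Gamma}\!\left(\frac14+\frac{a(\chi_d)}2-\frac{i\pi\tau}{\log X}\right)\right]d\tau$$ $$-\frac2{|\mathcal{F}(X)|}\sum_{d\in\mathcal{F}(X)}\sum_{k=1}^\infty\sum_p\frac{\chi_d(p)^k\log p}{p^{k/2}\log X}\,\widehat g\!\left(\frac{\log p^k}{\log X}\right),$$ where $p$ runs over the primes, and the sums over zeros and over prime powers and the integral converge absolutely. -/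

import Mathlib

open scoped NumberTheorySymbols FourierTransform SchwartzMap

namespace ExplicitFormula

/-- `d` is a fundamental discriminant: either `d` is square-free and `d ≡ 1 mod 4`, or `d = 4 m`
with `m` square-free and `m ≡ 2, 3 mod 4`. -/
def IsFundamentalDiscriminant (d : ℤ) : Prop :=
  (Squarefree d ∧ d % 4 = 1) ∨ ∃ m : ℤ, d = 4 * m ∧ Squarefree m ∧ (m % 4 = 2 ∨ m % 4 = 3)

/-- The type of fundamental discriminants. -/
abbrev FundamentalDiscriminant : Type := {d : ℤ // IsFundamentalDiscriminant d}

theorem IsFundamentalDiscriminant.ne_zero {d : ℤ} (hd : IsFundamentalDiscriminant d) :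
    d ≠ 0 := by
  rcases hd with ⟨_, h⟩ | ⟨m, rfl, _, h⟩ <;> omega

theorem IsFundamentalDiscriminant.mod_four {d : ℤ} (hd : IsFundamentalDiscriminant d) :
    d % 4 = 0 ∨ d % 4 = 1 := by
  rcases hd with ⟨_, h⟩ | ⟨m, rfl, _, h⟩ <;> omega

instance (d : FundamentalDiscriminant) : NeZero d.1.natAbs :=
  ⟨Int.natAbs_ne_zero.mpr d.2.ne_zero⟩

/-- The Kronecker symbol `(d / n)` for an integer `d` and a natural number `n`. For `n ≠ 0` it is
completely multiplicative in `n`, equal to the Legendre symbol at an odd prime `n`, and equal to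
`0, 1, -1` at `n = 2` according to `d` even, `d ≡ ±1 mod 8`, `d ≡ ±3 mod 8`. Further `(d / 0)` is
`1` if `d = ±1` and `0` otherwise. -/
def kroneckerSym (d : ℤ) (n : ℕ) : ℤ :=
  if n = 0 then (if d.natAbs = 1 then 1 else 0)
  else ZMod.χ₈ (d : ZMod 8) ^ n.factorization 2 * J(d | n / 2 ^ n.factorization 2)

theorem kroneckerSym_one (d : ℤ) : kroneckerSym d 1 = 1 := by
  simp [kroneckerSym]

theorem kroneckerSym_of_odd (d : ℤ) {n : ℕ} (hn : Odd n) : kroneckerSym d n = J(d | n) := by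
  have h0 : n ≠ 0 := by rintro rfl; simp at hn
  have h2 : n.factorization 2 = 0 :=
    Nat.factorization_eq_zero_of_not_dvd (by rw [← even_iff_two_dvd]; simpa using hn)
  simp [kroneckerSym, h0, h2]

theorem kroneckerSym_of_even {d : ℤ} {n : ℕ} (hd : d % 4 = 0) (hn : Even n) :
    kroneckerSym d n = 0 := by
  unfold kroneckerSym
  split_ifs with h0 h1
  · omega
  · rfl
  · have h2 : n.factorization 2 ≠ 0 :=
      (Nat.Prime.factorization_pos_of_dvd Nat.prime_two h0 (even_iff_two_dvd.mp hn)).ne'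
    have h3 : ZMod.χ₈ (d : ZMod 8) = 0 := by
      rw [ZMod.χ₈_int_eq_if_mod_eight, if_pos (by omega)]
    rw [h3, zero_pow h2, zero_mul]

theorem kroneckerSym_mul (d : ℤ) {m n : ℕ} (hm : m ≠ 0) (hn : n ≠ 0) :
    kroneckerSym d (m * n) = kroneckerSym d m * kroneckerSym d n := by
  have h1 := (Nat.ordCompl_pos 2 hm).ne'
  have h2 := (Nat.ordCompl_pos 2 hn).ne'
  simp only [kroneckerSym, hm, hn, mul_eq_zero, or_self, if_false]
  rw [Nat.ordCompl_mul m n 2, jacobiSym.mul_right' d h1 h2, Nat.factorization_mul hm hn,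
    Finsupp.add_apply, pow_add]
  ring

/-- Quadratic reciprocity for the Kronecker symbol when `d ≡ 1 mod 4`. -/
theorem kroneckerSym_eq_jacobiSym {d : ℤ} (hd : d % 4 = 1) (n : ℕ) :
    kroneckerSym d n = J(n | d.natAbs) := by
  have hodd : Odd d.natAbs := Nat.odd_iff.mpr (by omega)
  have key : ∀ m : ℕ, Odd m → J(d | m) = J(m | d.natAbs) := by
    intro m hm
    rcases Int.natAbs_eq d with h | h
    · have := jacobiSym.quadratic_reciprocity_one_mod_four (a := d.natAbs) (by omega) hm
      rwa [← h] at this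
    · have h3 : d.natAbs % 4 = 3 := by omega
      have e : J(d | m) = ZMod.χ₄ m * J(d.natAbs | m) := by
        rw [← jacobiSym.neg _ hm, ← h]
      rw [e]
      rcases Nat.odd_mod_four_iff.mp (Nat.odd_iff.mp hm) with h4 | h4
      · rw [ZMod.χ₄_nat_one_mod_four h4, one_mul,
          jacobiSym.quadratic_reciprocity_one_mod_four' hodd h4]
      · rw [ZMod.χ₄_nat_three_mod_four h4,
          jacobiSym.quadratic_reciprocity_three_mod_four h3 h4]
        ring
  rcases eq_or_ne n 0 with rfl | hn
  · by_cases h : d.natAbs = 1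
    · simp [kroneckerSym, h]
    · have : 1 < d.natAbs := by omega
      simp [kroneckerSym, h, jacobiSym.zero_left this]
  · have ho : Odd (n / 2 ^ n.factorization 2) := by
      have := Nat.not_dvd_ordCompl Nat.prime_two hn
      rw [Nat.odd_iff]; omega
    have h8 : ZMod.χ₈ (d : ZMod 8) = J(2 | d.natAbs) := by
      rw [jacobiSym.at_two hodd, ZMod.χ₈_int_eq_if_mod_eight, ZMod.χ₈_nat_eq_if_mod_eight]
      split_ifs <;> first | rfl | omega
    simp only [kroneckerSym, hn, if_false]
    rw [key _ ho, h8, ← jacobiSym.pow_left, ← jacobiSym.mul_left]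
    congr 1
    exact_mod_cast Nat.ordProj_mul_ordCompl_eq_self n 2

theorem kroneckerSym_mod {d : ℤ} (hd : d % 4 = 0 ∨ d % 4 = 1) (n : ℕ) :
    kroneckerSym d (n % d.natAbs) = kroneckerSym d n := by
  rcases hd with hd | hd
  · have hpar : n % d.natAbs % 2 = n % 2 := Nat.mod_mod_of_dvd n (by omega)
    rcases Nat.even_or_odd n with hn | hn
    · rw [kroneckerSym_of_even hd hn, kroneckerSym_of_even hd]
      rw [Nat.even_iff] at hn ⊢; omega
    · have hn' : Odd (n % d.natAbs) := by rw [Nat.odd_iff] at hn ⊢; omega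
      rw [kroneckerSym_of_odd d hn, kroneckerSym_of_odd d hn',
        ← jacobiSym.div_four_left hd (Nat.odd_iff.mp hn),
        ← jacobiSym.div_four_left hd (Nat.odd_iff.mp hn'), jacobiSym.mod_right (d / 4) hn]
      congr 2
      omega
  · rw [kroneckerSym_eq_jacobiSym hd, kroneckerSym_eq_jacobiSym hd, jacobiSym.mod_left n]
    push_cast
    rfl

theorem kroneckerSym_eq_zero {d : ℤ} (hd : d % 4 = 0 ∨ d % 4 = 1) {n : ℕ}
    (hn : ¬ n.Coprime d.natAbs) : kroneckerSym d n = 0 := by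
  rcases hd with hd | hd
  · rcases Nat.even_or_odd n with he | ho
    · exact kroneckerSym_of_even hd he
    · rw [kroneckerSym_of_odd d ho, jacobiSym.eq_zero_iff]
      refine ⟨by rintro rfl; simp at ho, fun h => hn ?_⟩
      rw [Nat.coprime_comm]
      simpa [Int.gcd] using h
  · rw [kroneckerSym_eq_jacobiSym hd, jacobiSym.eq_zero_iff]
    exact ⟨by omega, fun h => hn (by rwa [Int.gcd_natCast_natCast] at h)⟩

/-- The quadratic Dirichlet character `χ_d` modulo `|d|` attached to a fundamental discriminant
`d`, given by the Kronecker symbol: `χ_d(n) = (d / n)`. -/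
noncomputable def chi (d : FundamentalDiscriminant) : DirichletCharacter ℂ d.1.natAbs where
  toFun x := (kroneckerSym d.1 x.val : ℂ)
  map_one' := by
    rw [ZMod.val_one_eq_one_mod, kroneckerSym_mod d.2.mod_four, kroneckerSym_one, Int.cast_one]
  map_mul' x y := by
    have hpos : d.1.natAbs ≠ 0 := NeZero.ne _
    have key : ∀ z : ZMod d.1.natAbs,
        kroneckerSym d.1 z.val = kroneckerSym d.1 (z.val + d.1.natAbs) := fun z => by
      rw [← kroneckerSym_mod d.2.mod_four (z.val + d.1.natAbs), Nat.add_mod_right,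
        kroneckerSym_mod d.2.mod_four]
    rw [key x, key y, ZMod.val_mul, ← Int.cast_mul, ← kroneckerSym_mul _ (by omega) (by omega),
      ← kroneckerSym_mod d.2.mod_four ((x.val + d.1.natAbs) * (y.val + d.1.natAbs))]
    simp [Nat.mul_mod]
  map_nonunit' x hx := by
    have : ¬ x.val.Coprime d.1.natAbs := fun h => hx (by
      have := (ZMod.isUnit_iff_coprime x.val d.1.natAbs).mpr h
      rwa [ZMod.natCast_zmod_val] at this)
    rw [kroneckerSym_eq_zero d.2.mod_four this, Int.cast_zero]

theorem chi_natCast (d : FundamentalDiscriminant) (n : ℕ) :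
    chi d (n : ZMod d.1.natAbs) = (kroneckerSym d.1 n : ℂ) := by
  change ((kroneckerSym d.1 (n : ZMod d.1.natAbs).val : ℤ) : ℂ) = _
  rw [ZMod.val_natCast, kroneckerSym_mod d.2.mod_four]

open scoped Classical in
/-- `a(χ_d) = 0` if `χ_d(-1) = 1`, and `1` otherwise. -/
noncomputable def parity (d : FundamentalDiscriminant) : ℕ :=
  if chi d (-1) = 1 then 0 else 1

/-- The completed `L`-function
`Λ(s, χ_d) = π^(-(s + a)/2) Γ((s + a)/2) |d|^((s + a)/2) L(s, χ_d)`, `a = a(χ_d)`, as a function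
on the whole plane. Mathlib's `completedLFunction` is the analytic continuation of
`π^(-(s + a)/2) Γ((s + a)/2) L(s, χ_d)`; it is used here because the pointwise product with
`Complex.Gamma` has the wrong values at the poles of the Gamma factor. -/
noncomputable def completedL (d : FundamentalDiscriminant) (s : ℂ) : ℂ :=
  (d.1.natAbs : ℂ) ^ ((s + parity d) / 2) * (chi d).completedLFunction s

/-- The set of `γ_d`: complex numbers `γ` such that `1/2 + iγ` is a zero of `Λ(s, χ_d)`. -/
def zeroOrdinates (d : FundamentalDiscriminant) : Set ℂ :=
  {γ | completedL d (1 / 2 + Complex.I * γ) = 0}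

/-- The multiplicity of the zero `1/2 + iγ` of `Λ(s, χ_d)`. -/
noncomputable def zeroMultiplicity (d : FundamentalDiscriminant) (γ : ℂ) : ℕ :=
  analyticOrderNatAt (completedL d) (1 / 2 + Complex.I * γ)

/-- The extension of `g` to complex arguments (entire when `ĝ` has compact support),
`g(z) = ∫ ĝ(ξ) e^{2πizξ} dξ`, where `ĝ(ξ) = ∫ g(x) e^{-2πixξ} dx`. -/
noncomputable def complexExtension (g : 𝓢(ℝ, ℂ)) (z : ℂ) : ℂ :=
  ∫ ξ : ℝ, 𝓕 (g : ℝ → ℂ) ξ * Complex.exp (2 * Real.pi * Complex.I * z * ξ)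

/-- The term `g(γ log X / 2π)` of a zero, counted with multiplicity. -/
noncomputable def zeroTerm (g : 𝓢(ℝ, ℂ)) (X : ℝ) (d : FundamentalDiscriminant) (γ : ℂ) : ℂ :=
  zeroMultiplicity d γ * complexExtension g (γ * (Real.log X / (2 * Real.pi) : ℝ))

/-- `log(|d|/π) + ½ Γ'/Γ(1/4 + a/2 + iπτ/log X) + ½ Γ'/Γ(1/4 + a/2 - iπτ/log X)`; Mathlib's
`Complex.digamma` is `Γ'/Γ`. -/
noncomputable def conductorTerm (X : ℝ) (d : FundamentalDiscriminant) (τ : ℝ) : ℂ :=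
  (Real.log (|(d.1 : ℝ)| / Real.pi) : ℝ)
    + 1 / 2 * Complex.digamma
        (1 / 4 + parity d / 2 + Complex.I * Real.pi * τ / (Real.log X : ℝ))
    + 1 / 2 * Complex.digamma
        (1 / 4 + parity d / 2 - Complex.I * Real.pi * τ / (Real.log X : ℝ))

/-- `χ_d(p)^k log p / (p^(k/2) log X) · ĝ(log p^k / log X)`. -/
noncomputable def primeTerm (g : 𝓢(ℝ, ℂ)) (X : ℝ) (d : FundamentalDiscriminant) (k p : ℕ) : ℂ :=
  chi d (p : ZMod d.1.natAbs) ^ k * (Real.log p : ℝ)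
    / (((p : ℝ) ^ ((k : ℝ) / 2) * Real.log X : ℝ) : ℂ)
    * 𝓕 (g : ℝ → ℂ) (Real.log ((p : ℝ) ^ k) / Real.log X)

end ExplicitFormula

open ExplicitFormula

/-! Put Φ(s) = g((s − 1/2)/i · log X / 2π) (`testFunction`), so that Φ(1/2 + iγ) is the summand of
the zero 1/2 + iγ. The zeros of Λ(s, χ_d) lie in 0 < Re s < 1, and 2π times the sum of Φ over them
is the integral of Φ · Λ'/Λ along Re s = 2 minus that along Re s = −1.

The character χ_d is real and primitive, so Λ(1 − s) = wΛ(s) and Λ'/Λ is odd under s ↦ 1 − s. Since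
g is even, Φ is invariant under s ↦ 1 − s, so the two lines contribute equally and the zero sum is
1/π times the integral along Re s = 2 (`hasSum_zeroTerm`). There Λ'/Λ splits into two parts. (a) The
conductor and Γ'/Γ part is holomorphic in Re s > 0. Moved to Re s = 1/2 and symmetrised in τ, it
becomes the integral of g against `conductorTerm` (`integral_mul_conductorTerm`). (b) L'/L is −∑
χ_d(n) Λ(n) n^{-s}, with Λ(n) the von Mangoldt function. Each term, moved to Re s = 1/2, is a value
of the Fourier transform of g at log n / log X (`integral_testFunction_mul_cpow`), and only prime
powers n = p^k survive (`hasSum_primeTerm`).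

The contour formula is obtained without choosing horizontal segments that avoid the zeros.
Hadamard's partial fraction expansion of Λ'/Λ(s) − Λ'/Λ(2) (`hasSum_logDeriv_sub_logDeriv`) is
integrated against Φ term by term on each line, and each term is evaluated by Cauchy's formula in a
strip (`integral_vertical_line_div_sub`); this is `hasSum_order_mul`. The expansion needs only the
bound |Λ(s)| ≤ exp(B R^{3/2}) for |s − 2| ≤ R (`exists_norm_completedL_le`), and the interchanges
are justified by the rapid decay of Φ in vertical strips, a consequence of the smoothness and
compact support of the Fourier transform of g. -/

namespace ExplicitFormula

/-! ### Primitivity and reality of the Kronecker character. -/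

section Arithmetic

theorem kroneckerSym_mul_left (a b : ℤ) {n : ℕ} (hn : n ≠ 0) :
    kroneckerSym (a * b) n = kroneckerSym a n * kroneckerSym b n := by
  simp only [kroneckerSym, hn, if_false, Int.cast_mul, map_mul, jacobiSym.mul_left, mul_pow]
  ring

theorem kroneckerSym_of_modEq_one {d : ℤ} (hd : d % 4 = 0 ∨ d % 4 = 1) {n : ℕ}
    (hn : n ≡ 1 [MOD d.natAbs]) : kroneckerSym d n = 1 := by
  rw [← kroneckerSym_mod hd n, hn, kroneckerSym_mod hd, kroneckerSym_one]

theorem IsFundamentalDiscriminant.not_sq_dvd {d : ℤ} (hd : IsFundamentalDiscriminant d) {p : ℕ}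
    (hp : p.Prime) (hp2 : p ≠ 2) : ¬ (p : ℤ) * p ∣ d := by
  intro h
  have hu : ¬ IsUnit (p : ℤ) := by
    rw [Int.isUnit_iff_natAbs_eq]; simpa using hp.ne_one
  rcases hd with ⟨h1, _⟩ | ⟨m, rfl, h1, _⟩
  · exact hu (h1 _ h)
  · refine hu (h1 _ ?_)
    refine IsCoprime.dvd_of_dvd_mul_left ?_ h
    have h2 : IsCoprime (p : ℤ) 2 := by
      rw [← Nat.cast_ofNat, Nat.isCoprime_iff_coprime]
      exact (Nat.coprime_primes hp Nat.prime_two).mpr hp2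
    have h4 : IsCoprime (p : ℤ) 4 := by
      have := h2.mul_right h2
      norm_num at this
      exact this
    exact h4.mul_left h4

theorem exists_jacobiSym_eq_neg_one {p : ℕ} (hp : p.Prime) (hp2 : p ≠ 2) :
    ∃ a : ℕ, J(a | p) = -1 := by
  have := Fact.mk hp
  obtain ⟨a, ha⟩ := FiniteField.exists_nonsquare (F := ZMod p) (by rwa [ZMod.ringChar_zmod_n])
  refine ⟨a.val, ?_⟩
  rw [← jacobiSym.legendreSym.to_jacobiSym, legendreSym.eq_neg_one_iff]
  simpa using ha

/-- Such an n shows that χ_d does not factor through |d|/p. Write d = e·b with e = ±p ≡ 1 mod 4. As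
p² does not divide d, the Chinese remainder theorem gives n that is a non-residue mod p and 1 mod
|b|; then (b/n) = 1 and (e/n) = (n/p) = −1 by reciprocity. -/
theorem exists_kroneckerSym_eq_neg_one_of_odd {d : ℤ} (hd : IsFundamentalDiscriminant d) {p : ℕ}
    (hp : p.Prime) (hp2 : p ≠ 2) (hpd : p ∣ d.natAbs) :
    ∃ n : ℕ, n ≡ 1 [MOD d.natAbs / p] ∧ kroneckerSym d n = -1 := by
  obtain ⟨e, he4, hep⟩ : ∃ e : ℤ, e % 4 = 1 ∧ e.natAbs = p := by
    have := hp.eq_two_or_odd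
    rcases (by omega : p % 4 = 1 ∨ p % 4 = 3) with h | h
    · exact ⟨p, by omega, by simp⟩
    · exact ⟨-p, by omega, by simp⟩
  obtain ⟨b, rfl⟩ : e ∣ d := by rwa [← Int.natAbs_dvd_natAbs, hep]
  have hb4 : b % 4 = 0 ∨ b % 4 = 1 := by
    have := hd.mod_four
    rw [Int.mul_emod, he4] at this
    omega
  have hb : (e * b).natAbs / p = b.natAbs := by
    rw [Int.natAbs_mul, hep, Nat.mul_div_cancel_left _ hp.pos]
  have hcop : p.Coprime b.natAbs := by
    rw [hp.coprime_iff_not_dvd]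
    intro h
    apply hd.not_sq_dvd hp hp2
    rw [← Int.natAbs_dvd_natAbs, Int.natAbs_mul, Int.natAbs_mul, hep, Int.natAbs_natCast]
    exact Nat.mul_dvd_mul_left p h
  obtain ⟨a, ha⟩ := exists_jacobiSym_eq_neg_one hp hp2
  obtain ⟨n, hn1, hn2⟩ := Nat.chineseRemainder hcop a 1
  have hJ : J(n | p) = -1 := by
    rw [jacobiSym.mod_left n, ← ha, jacobiSym.mod_left a]
    congr 1
    exact_mod_cast hn1
  refine ⟨n, hb ▸ hn2, ?_⟩
  have hn0 : n ≠ 0 := by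
    rintro rfl
    rw [Nat.cast_zero, jacobiSym.zero_left hp.one_lt] at hJ
    norm_num at hJ
  rw [kroneckerSym_mul_left _ _ hn0, kroneckerSym_of_modEq_one hb4 hn2,
    kroneckerSym_eq_jacobiSym he4, hep, hJ, mul_one]

/-- With d = 4m, the witness is n = 2|m| + 1. If m = 2u with u odd, then n = 4|u| + 1 ≡ 5 mod 8, so
(2/n) = −1 while (u/n) = 1. If m ≡ 3 mod 4, then n ≡ 3 mod 4, so (−1/n) = −1 while (−m/n) = 1
because −m ≡ 1 mod 4. -/
theorem exists_kroneckerSym_eq_neg_one_of_even {d : ℤ} (hd : IsFundamentalDiscriminant d)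
    (hpd : 2 ∣ d.natAbs) :
    ∃ n : ℕ, n ≡ 1 [MOD d.natAbs / 2] ∧ kroneckerSym d n = -1 := by
  rcases hd with ⟨_, h⟩ | ⟨m, rfl, hm, h⟩
  · omega
  refine ⟨(4 * m).natAbs / 2 + 1, by simp [Nat.ModEq], ?_⟩
  have hodd : Odd ((4 * m).natAbs / 2 + 1) := by rw [Nat.odd_iff]; omega
  set n := (4 * m).natAbs / 2 + 1 with hn
  rw [kroneckerSym_of_odd _ hodd, ← jacobiSym.div_four_left (by omega) (Nat.odd_iff.mp hodd),
    Int.mul_ediv_cancel_left _ (by norm_num)]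
  rcases h with h | h
  · obtain ⟨u, rfl⟩ : (2 : ℤ) ∣ m := by omega
    rw [jacobiSym.mul_left, jacobiSym.at_two hodd, jacobiSym.mod_right u hodd]
    have h1 : n % (4 * u.natAbs) = 1 := by
      have : n = 1 + 4 * u.natAbs := by omega
      rw [this, Nat.add_mod_right, Nat.mod_eq_of_lt (by omega)]
    rw [h1, jacobiSym.one_right, mul_one, ZMod.χ₈_nat_eq_if_mod_eight, if_neg (by omega),
      if_neg (by omega)]
  · have e : J(m | n) = ZMod.χ₄ n * J(-m | n) := by
      rw [← jacobiSym.neg _ hodd, neg_neg]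
    have h1 : kroneckerSym (-m) n = 1 := by
      apply kroneckerSym_of_modEq_one (by omega)
      have : n = 1 + m.natAbs * 2 := by omega
      rw [this, Int.natAbs_neg]
      simp [Nat.ModEq]
    rw [e, ← kroneckerSym_of_odd _ hodd, h1, ZMod.χ₄_nat_three_mod_four (by omega), mul_one]

/-- A conductor smaller than |d| would divide |d|/p for some prime p dividing d, forcing χ_d(n) = 1
whenever n ≡ 1 mod |d|/p is coprime to d; the two preceding lemmas provide counterexamples.
Primitivity is what the functional equation requires. -/
theorem isPrimitive_chi (d : FundamentalDiscriminant) : (chi d).IsPrimitive := by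
  rw [DirichletCharacter.isPrimitive_def]
  by_contra hne
  obtain ⟨k, hk⟩ := (chi d).conductor_dvd_level
  have hk1 : k ≠ 1 := by rintro rfl; exact hne (by rw [mul_one] at hk; exact hk.symm)
  obtain ⟨p, hp, l, rfl⟩ := Nat.exists_prime_and_dvd hk1
  have hpd : p ∣ d.1.natAbs := ⟨(chi d).conductor * l, hk.trans (by ring)⟩
  have hcd : (chi d).conductor ∣ d.1.natAbs / p := by
    exact ⟨l, Nat.div_eq_of_eq_mul_right hp.pos (hk.trans (by ring))⟩
  obtain ⟨n, hn1, hn2⟩ : ∃ n : ℕ, n ≡ 1 [MOD d.1.natAbs / p] ∧ kroneckerSym d.1 n = -1 := by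
    by_cases hp2 : p = 2
    · subst hp2; exact exists_kroneckerSym_eq_neg_one_of_even d.2 hpd
    · exact exists_kroneckerSym_eq_neg_one_of_odd d.2 hp hp2 hpd
  have hcop : n.Coprime d.1.natAbs := by
    by_contra h
    rw [kroneckerSym_eq_zero d.2.mod_four h] at hn2
    norm_num at hn2
  have hval : chi d n = 1 := by
    have h := DirichletCharacter.changeLevel_eq_cast_of_dvd
      ((chi d).factorsThrough_conductor.χ₀) ((chi d).factorsThrough_conductor.dvd)
      (ZMod.unitOfCoprime n hcop)
    rw [← (chi d).factorsThrough_conductor.eq_changeLevel] at h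
    simp only [ZMod.coe_unitOfCoprime] at h
    rw [h, ZMod.cast_natCast (chi d).factorsThrough_conductor.dvd]
    have : ((n : ℕ) : ZMod (chi d).conductor) = ((1 : ℕ) : ZMod (chi d).conductor) :=
      (ZMod.natCast_eq_natCast_iff _ _ _).mpr (hn1.of_dvd hcd)
    rw [this, Nat.cast_one, map_one]
  rw [chi_natCast, hn2] at hval
  norm_num at hval

/-- The trivial character is primitive only for modulus 1, and d = −1 is not a discriminant since −1
≡ 3 mod 4. Nontriviality makes the completed L-function entire. -/
theorem chi_ne_one (d : FundamentalDiscriminant) (hd : d.1 ≠ 1) : chi d ≠ 1 := by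
  intro h
  have h1 := isPrimitive_chi d
  rw [DirichletCharacter.isPrimitive_def, h, DirichletCharacter.conductor_one] at h1
  have := d.2.mod_four
  omega

theorem kroneckerSym_trichotomy (d : ℤ) (n : ℕ) :
    kroneckerSym d n = 0 ∨ kroneckerSym d n = 1 ∨ kroneckerSym d n = -1 := by
  unfold kroneckerSym
  split_ifs
  · simp
  · simp
  · have h8 : ∀ a : ZMod 8, ZMod.χ₈ a = 0 ∨ ZMod.χ₈ a = 1 ∨ ZMod.χ₈ a = -1 := by decide
    have hpow : ∀ (a : ℤ) (k : ℕ), (a = 0 ∨ a = 1 ∨ a = -1) →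
        (a ^ k = 0 ∨ a ^ k = 1 ∨ a ^ k = -1) := by
      rintro a k (rfl | rfl | rfl)
      · rcases eq_or_ne k 0 with rfl | hk <;> simp [*]
      · simp
      · exact Or.inr (neg_one_pow_eq_or ℤ k)
    rcases hpow _ (n.factorization 2) (h8 d) with h | h | h <;>
      rcases jacobiSym.trichotomy d (n / 2 ^ n.factorization 2) with h' | h' | h' <;>
      rw [h, h'] <;> norm_num

/-- The values are 0 and ±1; this makes the functional equation relate Λ(s, χ_d) to itself. -/
theorem chi_inv (d : FundamentalDiscriminant) : (chi d)⁻¹ = chi d := by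
  rw [inv_eq_iff_mul_eq_one]
  ext u
  rw [MulChar.mul_apply, MulChar.one_apply_coe]
  have hu : chi d (u : ZMod _) ≠ 0 := (u.isUnit.map (chi d)).ne_zero
  have h : chi d (u : ZMod _) = (kroneckerSym d.1 (u : ZMod d.1.natAbs).val : ℂ) := rfl
  rcases kroneckerSym_trichotomy d.1 (u : ZMod d.1.natAbs).val with h' | h' | h' <;>
    rw [h'] at h <;> simp_all

theorem parity_of_even {d : FundamentalDiscriminant} (h : (chi d).Even) : parity d = 0 :=
  if_pos h

theorem parity_of_odd {d : FundamentalDiscriminant} (h : (chi d).Odd) : parity d = 1 :=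
  if_neg (by rw [show chi d (-1) = -1 from h]; norm_num)

end Arithmetic

open Complex Metric Filter Topology

/-! ### Zeros and Hadamard's expansion for entire functions of order at most 3/2. -/

section PartialFractions

/-- An entire function can be divided by the power of `z - a` given by its order of vanishing. -/
theorem exists_eq_pow_mul_of_entire {f : ℂ → ℂ} (hf : Differentiable ℂ f) (a : ℂ)
    (ha : analyticOrderAt f a ≠ ⊤) :
    ∃ h : ℂ → ℂ, Differentiable ℂ h ∧ h a ≠ 0 ∧
      ∀ z, f z = (z - a) ^ analyticOrderNatAt f a * h z := by
  set n := analyticOrderNatAt f a with hn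
  obtain ⟨g, hg, hga, hfg⟩ := ((hf.analyticAt a).analyticOrderNatAt_eq_iff ha).mp hn.symm
  refine ⟨Function.update (fun z => f z / (z - a) ^ n) a (g a), ?_, by simpa using hga, ?_⟩
  · intro z
    rcases eq_or_ne z a with rfl | hz
    · refine hg.differentiableAt.congr_of_eventuallyEq ?_
      filter_upwards [hfg] with w hw
      rcases eq_or_ne w z with rfl | hwz
      · simp
      · have : (w - z) ^ n ≠ 0 := pow_ne_zero _ (sub_ne_zero.mpr hwz)
        rw [Function.update_of_ne hwz, hw, smul_eq_mul, mul_div_cancel_left₀ _ this]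
    · have h1 : DifferentiableAt ℂ (fun z => f z / (z - a) ^ n) z :=
        (hf z).div (by fun_prop) (pow_ne_zero _ (sub_ne_zero.mpr hz))
      refine h1.congr_of_eventuallyEq ?_
      filter_upwards [isOpen_ne.mem_nhds hz] with w hw
      rw [Function.update_of_ne hw]
  · intro z
    rcases eq_or_ne z a with rfl | hz
    · simpa using hfg.self_of_nhds
    · rw [Function.update_of_ne hz, mul_div_cancel₀]
      exact pow_ne_zero _ (sub_ne_zero.mpr hz)

theorem analyticOrderAt_ne_top_of_entire {f : ℂ → ℂ} (hf : Differentiable ℂ f) {z₀ : ℂ}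
    (hz₀ : f z₀ ≠ 0) (z : ℂ) : analyticOrderAt f z ≠ ⊤ := by
  have hA : AnalyticOnNhd ℂ f Set.univ := fun z _ => hf.analyticAt z
  refine hA.analyticOrderAt_ne_top_of_isPreconnected isPreconnected_univ
    (Set.mem_univ z₀) (Set.mem_univ z) ?_
  rw [(hf.analyticAt z₀).analyticOrderAt_eq_zero.mpr hz₀]
  simp

/-- Finitely many zeros of an entire function can be divided out. -/
theorem exists_eq_prod_mul_of_entire {f : ℂ → ℂ} (hf : Differentiable ℂ f) {z₀ : ℂ}
    (hz₀ : f z₀ ≠ 0) (S : Finset {z // f z = 0}) :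
    ∃ h : ℂ → ℂ, Differentiable ℂ h ∧ (∀ ρ ∈ S, h ρ ≠ 0) ∧
      ∀ z, f z = (∏ ρ ∈ S, (z - ρ) ^ analyticOrderNatAt f ρ) * h z := by
  classical
  induction S using Finset.induction_on with
  | empty => exact ⟨f, hf, by simp, by simp⟩
  | insert a S ha ih =>
    obtain ⟨h, hh, hS, hprod⟩ := ih
    have hz : h z₀ ≠ 0 := fun h0 => hz₀ (by rw [hprod, h0, mul_zero])
    have hP : Differentiable ℂ fun z : ℂ => ∏ ρ ∈ S, (z - ρ) ^ analyticOrderNatAt f ρ := by fun_prop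
    have hPa : ∏ ρ ∈ S, ((a : ℂ) - ρ) ^ analyticOrderNatAt f ρ ≠ 0 := by
      refine Finset.prod_ne_zero_iff.mpr fun ρ hρ => pow_ne_zero _ (sub_ne_zero.mpr ?_)
      rintro h
      exact ha (Subtype.ext h ▸ hρ)
    have hord : analyticOrderNatAt h a = analyticOrderNatAt f a := by
      have e : f = (fun z : ℂ => ∏ ρ ∈ S, (z - ρ) ^ analyticOrderNatAt f ρ) * h := funext hprod
      have h1 := analyticOrderAt_mul (hP.analyticAt (a : ℂ)) (hh.analyticAt (a : ℂ))
      rw [← e, (hP.analyticAt (a : ℂ)).analyticOrderAt_eq_zero.mpr hPa, zero_add] at h1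
      rw [analyticOrderNatAt, analyticOrderNatAt, h1]
    obtain ⟨k, hk, hka, hkh⟩ := exists_eq_pow_mul_of_entire hh a
      (analyticOrderAt_ne_top_of_entire hh hz a)
    rw [hord] at hkh
    refine ⟨k, hk, ?_, ?_⟩
    · intro ρ hρ
      rcases Finset.mem_insert.mp hρ with rfl | hρ
      · exact hka
      · intro h0
        exact hS ρ hρ (by rw [hkh, h0, mul_zero])
    · intro z
      rw [Finset.prod_insert ha, hprod, hkh]
      ring

/-- On a disc the holomorphic function H'/H has a primitive φ, and H·e^{−φ} has zero derivative. -/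
theorem exists_log_of_ne_zero {H : ℂ → ℂ} {R : ℝ} (hR : 0 < R)
    (hH : DifferentiableOn ℂ H (ball 0 R)) (h0 : ∀ z ∈ ball (0 : ℂ) R, H z ≠ 0) :
    ∃ φ : ℂ → ℂ, φ 0 = 0 ∧ (∀ z ∈ ball (0 : ℂ) R, HasDerivAt φ (logDeriv H z) z) ∧
      ∀ z ∈ ball (0 : ℂ) R, H z = H 0 * exp (φ z) := by
  have hd : DifferentiableOn ℂ (logDeriv H) (ball 0 R) :=
    (hH.deriv isOpen_ball).div hH h0
  obtain ⟨φ, hφ0, hφ⟩ := hd.isExactOn_ball.with_val_at 0 0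
  refine ⟨φ, hφ0, hφ, ?_⟩
  have hc : ∀ z ∈ ball (0 : ℂ) R, HasDerivAt (fun z => H z * exp (-φ z)) 0 z := by
    intro z hz
    have h1 := (hH.differentiableAt (isOpen_ball.mem_nhds hz)).hasDerivAt
    convert! h1.mul (hφ z hz).neg.cexp using 1
    rw [logDeriv_apply]
    field_simp [h0 z hz]
    ring
  intro z hz
  have := (convex_ball (0 : ℂ) R).is_const_of_fderivWithin_eq_zero (𝕜 := ℂ)
    (f := fun z => H z * exp (-φ z))
    (fun w hw => (hc w hw).differentiableAt.differentiableWithinAt)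
    (fun w hw => by
      rw [fderivWithin_of_isOpen isOpen_ball hw]
      ext
      simp [(hc w hw).deriv]) hz (mem_ball_self hR)
  simp only [hφ0, neg_zero, exp_zero, mul_one] at this
  rw [← this, mul_assoc, ← exp_add]
  simp

/-- Borel–Carathéodory applied to φ = log(H/H(0)), whose real part is at most A, gives |φ| ≤ 2A on
radius R/2. Cauchy's estimate on circles of radius R/4 then yields 2A/(R/4) = 8A/R. -/
theorem norm_logDeriv_le_of_norm_le {H : ℂ → ℂ} {R A : ℝ} (hR : 0 < R) (hA : 0 < A)
    (hH : DifferentiableOn ℂ H (ball 0 R)) (h0 : ∀ z ∈ ball (0 : ℂ) R, H z ≠ 0)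
    (hb : ∀ z ∈ ball (0 : ℂ) R, ‖H z‖ ≤ ‖H 0‖ * Real.exp A) {z : ℂ} (hz : ‖z‖ ≤ R / 4) :
    ‖logDeriv H z‖ ≤ 8 * A / R := by
  obtain ⟨φ, hφ0, hφ, hexp⟩ := exists_log_of_ne_zero hR hH h0
  have hd : DifferentiableOn ℂ φ (ball 0 R) :=
    fun w hw => (hφ w hw).differentiableAt.differentiableWithinAt
  have hre : Set.MapsTo φ (ball 0 R) {z | z.re ≤ A} := by
    intro w hw
    have h1 := hb w hw
    rw [hexp w hw, norm_mul, norm_exp] at h1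
    exact Real.exp_le_exp.mp
      (le_of_mul_le_mul_left h1 (norm_pos_iff.mpr (h0 0 (mem_ball_self hR))))
  have hbound : ∀ w, ‖w‖ ≤ R / 2 → ‖φ w‖ ≤ 2 * A := by
    intro w hw
    refine (borelCaratheodory_zero hA hd hre hR (by simp; linarith) hφ0).trans ?_
    rw [div_le_iff₀ (by linarith)]
    nlinarith [norm_nonneg w]
  have hsub : closedBall z (R / 4) ⊆ ball 0 R := by
    intro w hw
    rw [mem_closedBall, dist_eq_norm] at hw
    have : ‖w‖ ≤ ‖w - z‖ + ‖z‖ := by simpa using norm_add_le (w - z) z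
    simp; linarith
  have := norm_deriv_le_of_forall_mem_sphere_norm_le (c := z) (f := φ) (R := R / 4) (C := 2 * A)
    (by positivity) ((hd.mono hsub).diffContOnCl_ball subset_rfl) (by
      intro w hw
      apply hbound
      rw [mem_sphere, dist_eq_norm] at hw
      have : ‖w‖ ≤ ‖w - z‖ + ‖z‖ := by simpa using norm_add_le (w - z) z
      linarith)
  rw [(hφ z (hsub (mem_closedBall_self (by positivity)))).deriv] at this
  refine this.trans (le_of_eq ?_)
  field_simp
  norm_num

/-- One more Cauchy estimate, on radius R/8, bounds (H'/H)' by (8A/R)/(R/8). The factor R^{-2} beats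
A of size R^{3/2}, so the zero-free remainder in Hadamard's expansion tends to 0. -/
theorem norm_logDeriv_sub_le_of_norm_le {H : ℂ → ℂ} {R A : ℝ} (hR : 0 < R) (hA : 0 < A)
    (hH : DifferentiableOn ℂ H (ball 0 R)) (h0 : ∀ z ∈ ball (0 : ℂ) R, H z ≠ 0)
    (hb : ∀ z ∈ ball (0 : ℂ) R, ‖H z‖ ≤ ‖H 0‖ * Real.exp A) {z : ℂ} (hz : ‖z‖ ≤ R / 8) :
    ‖logDeriv H z - logDeriv H 0‖ ≤ 64 * A / R ^ 2 * ‖z‖ := by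
  have hd : DifferentiableOn ℂ (logDeriv H) (ball 0 R) :=
    (hH.deriv isOpen_ball).div hH h0
  have key : ∀ w ∈ closedBall (0 : ℂ) (R / 8), ‖deriv (logDeriv H) w‖ ≤ 64 * A / R ^ 2 := by
    intro w hw
    rw [mem_closedBall_zero_iff] at hw
    have hw4 : ∀ v ∈ closedBall w (R / 8), ‖v‖ ≤ R / 4 := by
      intro v hv
      rw [mem_closedBall, dist_eq_norm] at hv
      have : ‖v‖ ≤ ‖v - w‖ + ‖w‖ := by simpa using norm_add_le (v - w) w
      linarith
    have hsub : closedBall w (R / 8) ⊆ ball 0 R := by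
      intro v hv
      have := hw4 v hv
      simp; linarith
    refine (norm_deriv_le_of_forall_mem_sphere_norm_le (c := w) (R := R / 8) (C := 8 * A / R)
      (by positivity) ((hd.mono hsub).diffContOnCl_ball subset_rfl) (fun v hv =>
        norm_logDeriv_le_of_norm_le hR hA hH h0 hb (hw4 v (sphere_subset_closedBall hv)))).trans
      (le_of_eq ?_)
    field_simp
    norm_num
  have := (convex_closedBall (0 : ℂ) (R / 8)).norm_image_sub_le_of_norm_deriv_le
    (f := logDeriv H) (C := 64 * A / R ^ 2) (x := 0) (y := z)
    (fun w hw => hd.differentiableAt (isOpen_ball.mem_nhds (by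
      simp at hw ⊢; linarith))) key (by simp; positivity) (by simpa using hz)
  simpa using this

theorem norm_le_of_forall_norm_sub_eq {h : ℂ → ℂ} (hh : Differentiable ℂ h) {z₀ : ℂ} {r C : ℝ}
    (hr : 0 < r) (hC : ∀ z, ‖z - z₀‖ = r → ‖h z‖ ≤ C) {z : ℂ} (hz : ‖z - z₀‖ ≤ r) : ‖h z‖ ≤ C := by
  refine norm_le_of_forall_mem_frontier_norm_le (U := ball z₀ r) isBounded_ball
    hh.diffContOnCl (fun w hw => hC w ?_) ?_
  · rw [frontier_ball _ hr.ne'] at hw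
    simpa [dist_eq_norm] using hw
  · rw [closure_ball _ hr.ne']
    simpa [dist_eq_norm] using hz

/-- The number of zeros in a disc is bounded in terms of the growth of the function. -/
theorem sum_order_mul_log_two_le {f : ℂ → ℂ} (hf : Differentiable ℂ f) {z₀ : ℂ} (hz₀ : f z₀ ≠ 0)
    {R K : ℝ} (hR : 0 < R) (hK : ∀ z, ‖z - z₀‖ = 3 * R → ‖f z‖ ≤ Real.exp K)
    (S : Finset {z // f z = 0}) (hS : ∀ ρ ∈ S, ‖(ρ : ℂ) - z₀‖ ≤ R) :
    (∑ ρ ∈ S, (analyticOrderNatAt f ρ : ℝ)) * Real.log 2 ≤ K - Real.log ‖f z₀‖ := by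
  obtain ⟨h, hh, -, hprod⟩ := exists_eq_prod_mul_of_entire hf hz₀ S
  set n := ∑ ρ ∈ S, analyticOrderNatAt f ρ with hn
  -- On the circle of radius 3R every removed zero is at distance at least 2R, while at the centre
  -- it is at distance at most R. The maximum principle for the quotient h thus gains a factor 2 per
  -- zero, which gives Jensen's bound.
  have hbd : ∀ z, ‖z - z₀‖ = 3 * R → ‖h z‖ ≤ Real.exp K / (2 * R) ^ n := by
    intro z hz
    rw [le_div_iff₀ (by positivity), mul_comm]
    refine le_trans ?_ (hK z hz)
    rw [hprod z, norm_mul, norm_prod, hn, ← Finset.prod_pow_eq_pow_sum]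
    gcongr with ρ hρ
    rw [norm_pow]
    gcongr
    have h1 : ‖z - z₀‖ ≤ ‖z - ρ‖ + ‖(ρ : ℂ) - z₀‖ := norm_sub_le_norm_sub_add_norm_sub _ _ _
    linarith [hS ρ hρ]
  have h0 : ‖h z₀‖ ≤ Real.exp K / (2 * R) ^ n :=
    norm_le_of_forall_norm_sub_eq hh (by positivity) hbd (by simp; positivity)
  have h1 : ‖f z₀‖ ≤ Real.exp K / 2 ^ n := by
    calc ‖f z₀‖ = (∏ ρ ∈ S, ‖z₀ - ρ‖ ^ analyticOrderNatAt f ρ) * ‖h z₀‖ := by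
          rw [hprod z₀, norm_mul, norm_prod]; simp only [norm_pow]
      _ ≤ (∏ ρ ∈ S, R ^ analyticOrderNatAt f ρ) * (Real.exp K / (2 * R) ^ n) := by
          gcongr with ρ hρ
          rw [norm_sub_rev]; exact hS ρ hρ
      _ = Real.exp K / 2 ^ n := by
          rw [Finset.prod_pow_eq_pow_sum, ← hn, mul_pow]
          field_simp
  have h2 := Real.log_le_log (norm_pos_iff.mpr hz₀) h1
  rw [Real.log_div (Real.exp_ne_zero _) (by positivity), Real.log_exp, Real.log_pow] at h2
  have h3 : (n : ℝ) = ∑ ρ ∈ S, (analyticOrderNatAt f ρ : ℝ) := by rw [hn]; push_cast; rfl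
  rw [← h3]
  linarith

theorem sum_order_le_rpow {f : ℂ → ℂ} (hf : Differentiable ℂ f) {z₀ : ℂ} (hz₀ : f z₀ ≠ 0) {B : ℝ}
    (hB : 0 < B)
    (hgrow : ∀ R : ℝ, 1 ≤ R → ∀ z, ‖z - z₀‖ ≤ R → ‖f z‖ ≤ Real.exp (B * R ^ (3 / 2 : ℝ))) :
    ∃ B' : ℝ, 0 < B' ∧ ∀ R : ℝ, 1 ≤ R → ∀ S : Finset {z // f z = 0},
      (∀ ρ ∈ S, ‖(ρ : ℂ) - z₀‖ ≤ R) →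
      ∑ ρ ∈ S, (analyticOrderNatAt f ρ : ℝ) ≤ B' * R ^ (3 / 2 : ℝ) := by
  have hl : 0 < Real.log 2 := Real.log_pos (by norm_num)
  refine ⟨(B * 3 ^ (3 / 2 : ℝ) + |Real.log ‖f z₀‖|) / Real.log 2, by positivity,
    fun R hR S hS => ?_⟩
  have h1 := sum_order_mul_log_two_le hf hz₀ (R := R) (K := B * (3 * R) ^ (3 / 2 : ℝ))
    (by linarith) (fun z hz => hgrow (3 * R) (by linarith) z hz.le) S hS
  have h2 : 1 ≤ R ^ (3 / 2 : ℝ) := Real.one_le_rpow hR (by norm_num)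
  rw [div_mul_eq_mul_div, le_div_iff₀ hl]
  rw [Real.mul_rpow (by norm_num) (by linarith)] at h1
  have h3 : |Real.log ‖f z₀‖| * 1 ≤ |Real.log ‖f z₀‖| * R ^ (3 / 2 : ℝ) := by gcongr
  nlinarith [neg_abs_le (Real.log ‖f z₀‖)]

/-- The zeros are sorted into shells 4^k ≤ 1 + |ρ − z₀| ≤ 4^{k+1}. Since 4^{3/2} = 8, the k-th shell
holds at most B'·8^{k+1} zeros, each weighted by at most 16^{-k}, so the shells are dominated by a
geometric series of ratio 1/2. -/
theorem summable_order_div_sq {f : ℂ → ℂ} (hf : Differentiable ℂ f) {z₀ : ℂ} (hz₀ : f z₀ ≠ 0)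
    {B : ℝ} (hB : 0 < B)
    (hgrow : ∀ R : ℝ, 1 ≤ R → ∀ z, ‖z - z₀‖ ≤ R → ‖f z‖ ≤ Real.exp (B * R ^ (3 / 2 : ℝ))) :
    Summable fun ρ : {z // f z = 0} =>
      (analyticOrderNatAt f ρ : ℝ) / (1 + ‖(ρ : ℂ) - z₀‖) ^ 2 := by
  classical
  obtain ⟨B', hB', hcount⟩ := sum_order_le_rpow hf hz₀ hB hgrow
  refine summable_of_sum_le (c := 16 * B') (fun ρ => by positivity) fun S => ?_
  set κ : {z // f z = 0} → ℕ := fun ρ => Nat.log 4 ⌊1 + ‖(ρ : ℂ) - z₀‖⌋₊ with hκ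
  have hlow : ∀ ρ : {z // f z = 0}, (4 : ℝ) ^ κ ρ ≤ 1 + ‖(ρ : ℂ) - z₀‖ := by
    intro ρ
    have h1 : 1 ≤ ⌊1 + ‖(ρ : ℂ) - z₀‖⌋₊ := Nat.le_floor (by simp)
    have h2 := Nat.pow_log_le_self 4 (x := ⌊1 + ‖(ρ : ℂ) - z₀‖⌋₊) (by omega)
    calc (4 : ℝ) ^ κ ρ = ((4 ^ κ ρ : ℕ) : ℝ) := by push_cast; rfl
      _ ≤ (⌊1 + ‖(ρ : ℂ) - z₀‖⌋₊ : ℝ) := by exact_mod_cast h2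
      _ ≤ _ := Nat.floor_le (by positivity)
  have hup : ∀ ρ : {z // f z = 0}, 1 + ‖(ρ : ℂ) - z₀‖ ≤ (4 : ℝ) ^ (κ ρ + 1) := by
    intro ρ
    have h2 := Nat.lt_pow_succ_log_self (b := 4) (by norm_num) ⌊1 + ‖(ρ : ℂ) - z₀‖⌋₊
    have h3 := (Nat.floor_lt (by positivity)).mp h2
    push_cast at h3
    exact h3.le
  rw [← Finset.sum_fiberwise_of_maps_to (t := S.image κ)
    (fun ρ hρ => Finset.mem_image_of_mem κ hρ)]
  have hfib : ∀ k ∈ S.image κ, ∑ ρ ∈ S with κ ρ = k,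
      (analyticOrderNatAt f ρ : ℝ) / (1 + ‖(ρ : ℂ) - z₀‖) ^ 2 ≤ 8 * B' * (1 / 2) ^ k := by
    intro k _
    have h1 := hcount (4 ^ (k + 1)) (one_le_pow₀ (by norm_num)) (S.filter (κ · = k))
      (fun ρ hρ => by
        have := hup ρ
        rw [(Finset.mem_filter.mp hρ).2] at this
        linarith)
    have h8 : ((4 : ℝ) ^ (k + 1)) ^ (3 / 2 : ℝ) = 8 ^ (k + 1) := by
      rw [← Real.rpow_natCast, ← Real.rpow_mul (by norm_num), mul_comm,
        Real.rpow_mul (by norm_num), Real.rpow_natCast]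
      congr 1
      rw [show (4 : ℝ) = 2 ^ (2 : ℝ) by norm_num, ← Real.rpow_mul (by norm_num)]
      norm_num
    rw [h8] at h1
    calc ∑ ρ ∈ S with κ ρ = k, (analyticOrderNatAt f ρ : ℝ) / (1 + ‖(ρ : ℂ) - z₀‖) ^ 2
        ≤ ∑ ρ ∈ S with κ ρ = k, (analyticOrderNatAt f ρ : ℝ) / (4 ^ k) ^ 2 := by
          gcongr with ρ hρ
          have := hlow ρ
          rwa [(Finset.mem_filter.mp hρ).2] at this
      _ = (∑ ρ ∈ S with κ ρ = k, (analyticOrderNatAt f ρ : ℝ)) / (4 ^ k) ^ 2 := by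
          rw [Finset.sum_div]
      _ ≤ B' * 8 ^ (k + 1) / (4 ^ k) ^ 2 := by gcongr
      _ = 8 * B' * (1 / 2) ^ k := by
          rw [← pow_mul, mul_comm k 2, pow_mul, one_div, inv_pow, pow_succ]
          have : (8 : ℝ) ^ k * 2 ^ k = (4 ^ 2) ^ k := by rw [← mul_pow]; norm_num
          rw [← this]
          field_simp
  refine (Finset.sum_le_sum hfib).trans ?_
  rw [← Finset.mul_sum]
  have : ∑ k ∈ S.image κ, (1 / 2 : ℝ) ^ k ≤ 2 := by
    have := summable_geometric_two.sum_le_tsum (S.image κ) (fun _ _ => by positivity)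
    rwa [tsum_geometric_two] at this
  nlinarith

/-- Some disc of radius δ about z is free of zeros, so |z − ρ| ≥ δ. This lets |z − ρ| be replaced by
1 + |ρ − z₀|, up to a constant, uniformly in ρ. -/
theorem exists_one_add_norm_sub_le_mul {f : ℂ → ℂ} (hf : Continuous f) (z₀ : ℂ) {z : ℂ}
    (hz : f z ≠ 0) :
    ∃ K : ℝ, 0 < K ∧ ∀ ρ : {z // f z = 0}, 1 + ‖(ρ : ℂ) - z₀‖ ≤ K * ‖z - ρ‖ := by
  obtain ⟨δ, hδ, hball⟩ := Metric.eventually_nhds_iff_ball.mp (hf.continuousAt.eventually_ne hz)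
  refine ⟨1 + (1 + ‖z - z₀‖) / δ, by positivity, fun ρ => ?_⟩
  have h1 : δ ≤ ‖z - ρ‖ := by
    by_contra h
    refine hball ρ ?_ ρ.2
    rw [mem_ball, dist_eq_norm, norm_sub_rev]
    linarith
  have h2 : ‖(ρ : ℂ) - z₀‖ ≤ ‖z - ρ‖ + ‖z - z₀‖ := by
    rw [norm_sub_rev z]
    exact norm_sub_le_norm_sub_add_norm_sub _ _ _
  have h3 : 1 + ‖z - z₀‖ ≤ (1 + ‖z - z₀‖) / δ * ‖z - ρ‖ := by
    rw [div_mul_eq_mul_div, le_div_iff₀ hδ]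
    gcongr
  linarith

theorem finite_zeros_norm_sub_le {f : ℂ → ℂ} (hf : Differentiable ℂ f) {z₀ : ℂ} (hz₀ : f z₀ ≠ 0)
    (R : ℝ) : {ρ : {z // f z = 0} | ‖(ρ : ℂ) - z₀‖ ≤ R}.Finite := by
  have hA : AnalyticOnNhd ℂ f Set.univ := fun z _ => hf.analyticAt z
  have h1 := hA.preimage_zero_mem_codiscrete hz₀
  have h2 := mem_codiscrete'.mp h1
  simp only [Set.preimage_compl, compl_compl] at h2
  have h3 : (closedBall z₀ R ∩ f ⁻¹' {0}).Finite := by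
    have hcl : IsClosed (f ⁻¹' {0}) := isClosed_singleton.preimage hf.continuous
    exact ((isCompact_closedBall z₀ R).inter_right hcl).finite (h2.2.mono Set.inter_subset_right)
  refine Set.Finite.of_finite_image (f := Subtype.val) (h3.subset ?_) Subtype.val_injective.injOn
  rintro _ ⟨ρ, hρ, rfl⟩
  exact ⟨by simpa [dist_eq_norm] using hρ, ρ.2⟩

/-- Subtracting 1/(z₀ − ρ) improves the decay in ρ from first to second order, which is summable
over the zeros. -/
theorem norm_one_div_sub_one_div_le {z z₀ ρ : ℂ} {K K₀ : ℝ} (hK : 1 + ‖ρ - z₀‖ ≤ K * ‖z - ρ‖)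
    (hK₀ : 1 + ‖ρ - z₀‖ ≤ K₀ * ‖z₀ - ρ‖) :
    ‖1 / (z - ρ) - 1 / (z₀ - ρ)‖ ≤ ‖z - z₀‖ * (K * K₀) / (1 + ‖ρ - z₀‖) ^ 2 := by
  have hp : 0 < 1 + ‖ρ - z₀‖ := by positivity
  have h1 : z - ρ ≠ 0 := by rintro h; rw [h, norm_zero] at hK; linarith
  have h2 : z₀ - ρ ≠ 0 := by rintro h; rw [h, norm_zero] at hK₀; linarith
  rw [div_sub_div _ _ h1 h2, norm_div, norm_mul]
  have e : 1 * (z₀ - ρ) - (z - ρ) * 1 = -(z - z₀) := by ring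
  rw [e, norm_neg, div_le_div_iff₀ (by positivity) (by positivity), mul_assoc]
  gcongr
  calc (1 + ‖ρ - z₀‖) ^ 2 = (1 + ‖ρ - z₀‖) * (1 + ‖ρ - z₀‖) := by ring
    _ ≤ (K * ‖z - ρ‖) * (K₀ * ‖z₀ - ρ‖) := mul_le_mul hK hK₀ hp.le (hp.le.trans hK)
    _ = _ := by ring

theorem logDeriv_prod_mul {f h : ℂ → ℂ} (hh : Differentiable ℂ h) (S : Finset {z // f z = 0})
    (hprod : ∀ z, f z = (∏ ρ ∈ S, (z - ρ) ^ analyticOrderNatAt f ρ) * h z) {z : ℂ} (hz : f z ≠ 0) :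
    logDeriv f z = ∑ ρ ∈ S, (analyticOrderNatAt f ρ : ℂ) * (1 / (z - ρ)) + logDeriv h z := by
  have hzρ : ∀ ρ : {z // f z = 0}, z - ρ ≠ 0 := fun ρ =>
    sub_ne_zero.mpr fun h => hz (h ▸ ρ.2)
  have e : f = fun z : ℂ => (∏ ρ ∈ S, (z - ρ) ^ analyticOrderNatAt f ρ) * h z := funext hprod
  have hhz : h z ≠ 0 := fun h0 => hz (by rw [hprod, h0, mul_zero])
  have hP : ∏ ρ ∈ S, (z - ρ) ^ analyticOrderNatAt f ρ ≠ 0 :=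
    Finset.prod_ne_zero_iff.mpr fun ρ _ => pow_ne_zero _ (hzρ ρ)
  have e1 : logDeriv f z = logDeriv
      (fun z : ℂ => (∏ ρ ∈ S, (z - ρ) ^ analyticOrderNatAt f ρ) * h z) z := congrArg (logDeriv · z) e
  rw [e1, logDeriv_mul z hP hhz (by fun_prop) (hh z),
    logDeriv_prod (f := fun (ρ : {z // f z = 0}) (w : ℂ) => (w - ρ) ^ analyticOrderNatAt f ρ)
      (fun ρ _ => pow_ne_zero _ (hzρ ρ)) (fun ρ _ => by fun_prop)]
  congr 1
  refine Finset.sum_congr rfl fun ρ _ => ?_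
  rw [logDeriv_fun_pow (by fun_prop)]
  congr 1
  simp [logDeriv_apply]

/-- **Hadamard's theorem** for the logarithmic derivative of an entire function of order
at most `3 / 2`. -/
theorem hasSum_logDeriv_sub_logDeriv {f : ℂ → ℂ} (hf : Differentiable ℂ f) {z₀ : ℂ}
    (hz₀ : f z₀ ≠ 0) {B : ℝ} (hB : 0 < B)
    (hgrow : ∀ R : ℝ, 1 ≤ R → ∀ z, ‖z - z₀‖ ≤ R → ‖f z‖ ≤ Real.exp (B * R ^ (3 / 2 : ℝ)))
    {z : ℂ} (hz : f z ≠ 0) :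
    HasSum (fun ρ : {z // f z = 0} =>
      (analyticOrderNatAt f ρ : ℂ) * (1 / (z - ρ) - 1 / (z₀ - ρ)))
      (logDeriv f z - logDeriv f z₀) := by
  obtain ⟨K, hK0, hK⟩ := exists_one_add_norm_sub_le_mul hf.continuous z₀ hz
  obtain ⟨K', hK0', hK'⟩ := exists_one_add_norm_sub_le_mul hf.continuous z₀ hz₀
  have hsum : Summable (fun ρ : {z // f z = 0} =>
      (analyticOrderNatAt f ρ : ℂ) * (1 / (z - ρ) - 1 / (z₀ - ρ))) := by
    refine Summable.of_norm_bounded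
      ((summable_order_div_sq hf hz₀ hB hgrow).mul_left (‖z - z₀‖ * (K * K'))) fun ρ => ?_
    rw [norm_mul, Complex.norm_natCast]
    refine (mul_le_mul_of_nonneg_left (norm_one_div_sub_one_div_le (hK ρ) (hK' ρ))
      (by positivity)).trans (le_of_eq (by ring))
  -- The series converges absolutely, so its sum may be computed along the exhaustion by the zeros
  -- in the discs of radius n about z₀.
  set S : ℕ → Finset {z // f z = 0} := fun n => (finite_zeros_norm_sub_le hf hz₀ n).toFinset with hS
  have hStop : Tendsto S atTop atTop := by
    refine tendsto_atTop_finset_of_monotone ?_ ?_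
    · intro a b hab ρ hρ
      simp only [hS, Set.Finite.mem_toFinset, Set.mem_ofPred_eq] at hρ ⊢
      exact hρ.trans (by exact_mod_cast hab)
    · intro ρ
      obtain ⟨n, hn⟩ := exists_nat_ge ‖(ρ : ℂ) - z₀‖
      exact ⟨n, by simpa [hS] using hn⟩
  have hlim := hsum.hasSum.comp hStop
  suffices hlim' : Tendsto ((fun T : Finset {z // f z = 0} => ∑ ρ ∈ T,
      (analyticOrderNatAt f ρ : ℂ) * (1 / (z - ρ) - 1 / (z₀ - ρ))) ∘ S) atTop
      (𝓝 (logDeriv f z - logDeriv f z₀)) by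
    rw [← tendsto_nhds_unique hlim hlim']
    exact hsum.hasSum
  -- The factor 2^{3/2} comes from using the growth bound on the circle of radius 2n, and |log
  -- |f(z₀)|| from normalising by the value at the centre.
  set B₁ : ℝ := B * 2 ^ (3 / 2 : ℝ) + |Real.log ‖f z₀‖| + 1 with hB₁
  have hB₁0 : 0 < B₁ := by positivity
  rw [tendsto_iff_norm_sub_tendsto_zero]
  have hz0lim : Tendsto (fun n : ℕ => 64 * B₁ * ‖z - z₀‖ * (n : ℝ) ^ (-(1 / 2 : ℝ))) atTop (𝓝 0) := by
    have := ((tendsto_rpow_neg_atTop (y := 1 / 2) (by norm_num)).comp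
      tendsto_natCast_atTop_atTop).const_mul (64 * B₁ * ‖z - z₀‖)
    simpa using this
  refine squeeze_zero' (Eventually.of_forall fun n => norm_nonneg _) ?_ hz0lim
  obtain ⟨n₀, hn₀⟩ := exists_nat_ge (8 * ‖z - z₀‖)
  filter_upwards [eventually_ge_atTop (max 1 n₀)] with n hn
  have hn1 : (1 : ℝ) ≤ n := by exact_mod_cast (le_max_left _ _).trans hn
  have hn8 : 8 * ‖z - z₀‖ ≤ n := hn₀.trans (by exact_mod_cast (le_max_right _ _).trans hn)
  have hSmem : ∀ ρ, ρ ∈ S n ↔ ‖(ρ : ℂ) - z₀‖ ≤ n := by simp [hS]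
  obtain ⟨h, hh, hhS, hprod⟩ := exists_eq_prod_mul_of_entire hf hz₀ (S n)
  have hhz₀ : h z₀ ≠ 0 := fun h0 => hz₀ (by rw [hprod, h0, mul_zero])
  set H : ℂ → ℂ := fun w => h (z₀ + w) with hH
  have hHd : DifferentiableOn ℂ H (ball 0 n) := by
    have : Differentiable ℂ H := hh.comp (by fun_prop)
    exact this.differentiableOn
  have hH0 : ∀ w ∈ ball (0 : ℂ) n, H w ≠ 0 := by
    intro w hw h0
    have hfz : f (z₀ + w) = 0 := by rw [hprod]; simp only [hH] at h0; rw [h0, mul_zero]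
    refine hhS ⟨z₀ + w, hfz⟩ ((hSmem _).mpr ?_) h0
    simp at hw ⊢
    exact hw.le
  set A : ℝ := B₁ * (n : ℝ) ^ (3 / 2 : ℝ) with hA
  have hA0 : 0 < A := by positivity
  -- On |v − z₀| = 2n each removed factor satisfies |v − ρ| ≥ n ≥ |z₀ − ρ|, so dividing by the
  -- product costs no more there than at z₀.
  have hbd : ∀ w ∈ ball (0 : ℂ) n, ‖H w‖ ≤ ‖H 0‖ * Real.exp A := by
    intro w hw
    have hP0 : 0 < ∏ ρ ∈ S n, ‖z₀ - ρ‖ ^ analyticOrderNatAt f ρ := by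
      refine Finset.prod_pos fun ρ _ => pow_pos (norm_pos_iff.mpr (sub_ne_zero.mpr ?_)) _
      rintro rfl
      exact hz₀ ρ.2
    have hsph : ∀ v, ‖v - z₀‖ = 2 * n → ‖h v‖ ≤
        Real.exp (B * (2 * n) ^ (3 / 2 : ℝ)) / ∏ ρ ∈ S n, ‖z₀ - ρ‖ ^ analyticOrderNatAt f ρ := by
      intro v hv
      rw [le_div_iff₀ hP0, mul_comm]
      refine le_trans ?_ (hgrow (2 * n) (by linarith) v hv.le)
      rw [hprod v, norm_mul, norm_prod]
      gcongr with ρ hρ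
      rw [norm_pow]
      gcongr
      have h1 : ‖v - z₀‖ ≤ ‖v - ρ‖ + ‖(ρ : ℂ) - z₀‖ := norm_sub_le_norm_sub_add_norm_sub _ _ _
      have h2 := (hSmem ρ).mp hρ
      rw [norm_sub_rev]
      linarith
    have h1 := norm_le_of_forall_norm_sub_eq hh (by linarith) hsph (z := z₀ + w) (by
      simp at hw ⊢; linarith)
    refine h1.trans ?_
    have hf0 : ‖f z₀‖ = (∏ ρ ∈ S n, ‖z₀ - ρ‖ ^ analyticOrderNatAt f ρ) * ‖h z₀‖ := by
      rw [hprod z₀, norm_mul, norm_prod]; simp only [norm_pow]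
    have hH00 : ‖H 0‖ = ‖f z₀‖ / ∏ ρ ∈ S n, ‖z₀ - ρ‖ ^ analyticOrderNatAt f ρ := by
      rw [hf0, mul_div_cancel_left₀ _ hP0.ne']; simp [hH]
    rw [hH00, div_mul_eq_mul_div]
    gcongr
    rw [← Real.exp_log (norm_pos_iff.mpr hz₀), ← Real.exp_add, Real.exp_le_exp, hA, hB₁, Real.mul_rpow (by norm_num) (by linarith)]
    have h2 : 1 ≤ (n : ℝ) ^ (3 / 2 : ℝ) := Real.one_le_rpow hn1 (by norm_num)
    have h3 : |Real.log ‖f z₀‖| * 1 ≤ |Real.log ‖f z₀‖| * (n : ℝ) ^ (3 / 2 : ℝ) := by gcongr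
    nlinarith [neg_abs_le (Real.log ‖f z₀‖)]
  have hmain := norm_logDeriv_sub_le_of_norm_le (by linarith) hA0 hHd hH0 hbd (z := z - z₀)
    (by linarith)
  have hlogH : ∀ w, logDeriv H w = logDeriv h (z₀ + w) := by
    intro w
    simp only [logDeriv_apply, hH, deriv_comp_const_add]
  rw [hlogH, hlogH, add_sub_cancel, add_zero] at hmain
  rw [Function.comp_apply, logDeriv_prod_mul hh (S n) hprod hz,
    logDeriv_prod_mul hh (S n) hprod hz₀]
  have e : (∑ ρ ∈ S n, (analyticOrderNatAt f ρ : ℂ) * (1 / (z - ρ) - 1 / (z₀ - ρ))) -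
      ((∑ ρ ∈ S n, (analyticOrderNatAt f ρ : ℂ) * (1 / (z - ρ)) + logDeriv h z) -
      (∑ ρ ∈ S n, (analyticOrderNatAt f ρ : ℂ) * (1 / (z₀ - ρ)) + logDeriv h z₀)) =
      -(logDeriv h z - logDeriv h z₀) := by
    simp only [mul_sub, Finset.sum_sub_distrib]
    ring
  rw [e, norm_neg]
  refine hmain.trans (le_of_eq ?_)
  have hn0 : (0 : ℝ) < n := by linarith
  have e2 : (n : ℝ) ^ (3 / 2 : ℝ) = n ^ 2 * (n : ℝ) ^ (-(1 / 2 : ℝ)) := by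
    rw [← Real.rpow_natCast, ← Real.rpow_add hn0]
    norm_num
  rw [hA, e2]
  field_simp

end PartialFractions

open MeasureTheory

/-! ### Shifting vertical lines and Cauchy's formula in a strip. -/

section VerticalLines

theorem integrable_vertical_line {F : ℂ → ℂ} {a b C x : ℝ} (hx : x ∈ Set.Icc a b)
    (hd : ∀ s : ℂ, s.re ∈ Set.Icc a b → ContinuousAt F s)
    (hb : ∀ s : ℂ, s.re ∈ Set.Icc a b → ‖F s‖ ≤ C * (1 + s.im ^ 2)⁻¹) :
    Integrable fun t : ℝ => F (x + t * I) := by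
  refine (integrable_inv_one_add_sq.const_mul C).mono' ?_ (Eventually.of_forall fun t => ?_)
  · have hc : Continuous fun t : ℝ => F (x + t * I) :=
      continuous_iff_continuousAt.mpr fun t =>
        ContinuousAt.comp (g := F) (hd _ (by simpa using hx)) (by fun_prop)
    exact hc.aestronglyMeasurable
  · simpa using hb (x + t * I) (by simpa using hx)

/-- The integral of a holomorphic function along a vertical line may be shifted within a strip in
which the function decays. -/
theorem integral_vertical_line_eq {F : ℂ → ℂ} {a b C : ℝ} (hab : a ≤ b)
    (hd : ∀ s : ℂ, s.re ∈ Set.Icc a b → DifferentiableAt ℂ F s)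
    (hb : ∀ s : ℂ, s.re ∈ Set.Icc a b → ‖F s‖ ≤ C * (1 + s.im ^ 2)⁻¹) :
    ∫ t : ℝ, F (a + t * I) = ∫ t : ℝ, F (b + t * I) := by
  have hia := integrable_vertical_line (Set.left_mem_Icc.mpr hab)
    (fun s hs => (hd s hs).continuousAt) hb
  have hib := integrable_vertical_line (Set.right_mem_Icc.mpr hab)
    (fun s hs => (hd s hs).continuousAt) hb
  have hla := intervalIntegral_tendsto_integral hia tendsto_neg_atTop_atBot tendsto_id
  have hlb := intervalIntegral_tendsto_integral hib tendsto_neg_atTop_atBot tendsto_id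
  simp only [id] at hla hlb
  have hhor : ∀ ε : ℝ, ε ^ 2 = 1 →
      Tendsto (fun T : ℝ => ∫ x in a..b, F (x + (ε * T : ℝ) * I)) atTop (𝓝 0) := by
    intro ε hε
    have hlim : Tendsto (fun T : ℝ => C * (1 + T ^ 2)⁻¹ * |b - a|) atTop (𝓝 0) := by
      have h1 : Tendsto (fun T : ℝ => (1 + T ^ 2)⁻¹) atTop (𝓝 0) :=
        (tendsto_atTop_add_const_left _ _ (tendsto_pow_atTop two_ne_zero)).inv_tendsto_atTop
      simpa using (h1.const_mul C).mul_const |b - a|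
    refine squeeze_zero_norm (fun T => ?_) hlim
    refine intervalIntegral.norm_integral_le_of_norm_le_const fun x hx => ?_
    rw [Set.uIoc_of_le hab] at hx
    have := hb (x + (ε * T : ℝ) * I) (by simpa using ⟨hx.1.le, hx.2⟩)
    simpa [mul_pow, hε] using this
  have h1 := hhor 1 (by norm_num)
  have h2 := hhor (-1) (by norm_num)
  have hrect : ∀ T : ℝ, (∫ x in a..b, F (x + (-1 * T : ℝ) * I))
      - (∫ x in a..b, F (x + (1 * T : ℝ) * I)) + I • (∫ t in (-T)..T, F (b + t * I))
      - I • (∫ t in (-T)..T, F (a + t * I)) = 0 := by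
    intro T
    have h := integral_boundary_rect_eq_zero_of_differentiableOn F (a + (-T : ℝ) * I) (b + T * I) (by
      intro s hs
      refine (hd s ?_).differentiableWithinAt
      have := hs.1
      simpa [Set.uIcc_of_le hab] using this)
    simpa using h
  have hlim := ((h2.sub h1).add (hlb.const_smul I)).sub (hla.const_smul I)
  rw [funext hrect] at hlim
  have h0 := tendsto_nhds_unique hlim tendsto_const_nhds
  rw [sub_zero, zero_add, ← smul_sub, smul_eq_zero, sub_eq_zero] at h0
  exact (h0.resolve_left I_ne_zero).symm

theorem div_sq_add_sq_eq {c : ℝ} (hc : 0 < c) (y : ℝ) :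
    c / (c ^ 2 + y ^ 2) = c⁻¹ * (1 + (y / c) ^ 2)⁻¹ := by
  have : c ^ 2 + y ^ 2 ≠ 0 := by positivity
  field_simp

theorem integrable_div_sq_add_sq {c : ℝ} (hc : 0 < c) :
    Integrable fun y : ℝ => c / (c ^ 2 + y ^ 2) := by
  simp_rw [div_sq_add_sq_eq hc]
  exact (integrable_inv_one_add_sq.comp_div hc.ne').const_mul _

theorem integral_div_sq_add_sq {c : ℝ} (hc : 0 < c) :
    ∫ y : ℝ, c / (c ^ 2 + y ^ 2) = Real.pi := by
  simp_rw [div_sq_add_sq_eq hc]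
  rw [integral_const_mul, Measure.integral_comp_div (fun y => (1 + y ^ 2)⁻¹) c,
    integral_univ_inv_one_add_sq, abs_of_pos hc, smul_eq_mul, ← mul_assoc,
    inv_mul_cancel₀ hc.ne', one_mul]

/-- A rational function with residue `1` at `0`, decaying in the strip `|Re w| < A`. -/
noncomputable def polarKernel (A : ℝ) (w : ℂ) : ℂ := A ^ 2 / (A ^ 2 - w ^ 2)

theorem polarKernel_denom_ne_zero {A : ℝ} {w : ℂ} (hw : |w.re| < A) :
    (A : ℂ) - w ≠ 0 ∧ (A : ℂ) + w ≠ 0 := by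
  rw [abs_lt] at hw
  constructor <;> intro h <;> have := congrArg re h <;> simp at this <;> linarith

theorem norm_polarKernel_le {A : ℝ} {w : ℂ} (hw : |w.re| ≤ A - 1) :
    ‖polarKernel A w‖ ≤ 2 * A ^ 2 * (1 + w.im ^ 2)⁻¹ := by
  rw [polarKernel, show (A : ℂ) ^ 2 - w ^ 2 = (A - w) * (A + w) by ring, norm_div, norm_mul,
    norm_pow, norm_real, Real.norm_eq_abs, sq_abs, ← div_eq_mul_inv]
  rw [abs_le] at hw
  have h1 : 1 ≤ ‖(A : ℂ) - w‖ := by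
    refine le_trans ?_ (re_le_norm _); simp; linarith
  have h2 : 1 ≤ ‖(A : ℂ) + w‖ := by
    refine le_trans ?_ (re_le_norm _); simp; linarith
  have h3 : |w.im| ≤ ‖(A : ℂ) - w‖ := by
    refine le_trans ?_ (abs_im_le_norm _); simp
  have h4 : |w.im| ≤ ‖(A : ℂ) + w‖ := by
    refine le_trans ?_ (abs_im_le_norm _); simp
  rw [div_le_div_iff₀ (by positivity) (by positivity)]
  have h5 : 1 + w.im ^ 2 ≤ 2 * (‖(A : ℂ) - w‖ * ‖(A : ℂ) + w‖) := by
    rw [← sq_abs]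
    nlinarith [abs_nonneg w.im, mul_le_mul h1 h2 zero_le_one (by linarith),
      mul_le_mul h3 h4 (abs_nonneg _) (by linarith [abs_nonneg w.im])]
  nlinarith [mul_le_mul_of_nonneg_left h5 (sq_nonneg A)]

theorem differentiableAt_polarKernel {A : ℝ} {w : ℂ} (hw : |w.re| < A) :
    DifferentiableAt ℂ (polarKernel A) w := by
  have := polarKernel_denom_ne_zero hw
  unfold polarKernel
  refine DifferentiableAt.div (by fun_prop) (by fun_prop) ?_
  rw [show (A : ℂ) ^ 2 - w ^ 2 = (A - w) * (A + w) by ring]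
  exact mul_ne_zero this.1 this.2

theorem integrable_polarKernel_div {A x : ℝ} (hx0 : x ≠ 0) (hx : |x| ≤ A - 1) :
    Integrable fun t : ℝ => polarKernel A (x + t * I) / (x + t * I) := by
  have hne : ∀ t : ℝ, (x : ℂ) + t * I ≠ 0 := by
    intro t h
    have := congrArg re h
    simp at this
    exact hx0 this
  refine (integrable_inv_one_add_sq.const_mul (2 * A ^ 2 * |x|⁻¹)).mono' ?_
    (Eventually.of_forall fun t => ?_)
  · have : Continuous fun t : ℝ => polarKernel A (x + t * I) / (x + t * I) := by
      refine Continuous.div ?_ (by fun_prop) hne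
      refine continuous_iff_continuousAt.mpr fun t => ContinuousAt.comp (g := polarKernel A)
        (differentiableAt_polarKernel ?_).continuousAt (by fun_prop)
      simp; linarith
    exact this.aestronglyMeasurable
  · have h1 := norm_polarKernel_le (A := A) (w := x + t * I) (by simpa using hx)
    have h2 : |x| ≤ ‖(x : ℂ) + t * I‖ := by
      refine le_trans ?_ (abs_re_le_norm _); simp
    have h3 : 0 < |x| := abs_pos.mpr hx0
    rw [norm_div, div_eq_mul_inv, mul_right_comm]
    simp only [add_im, ofReal_im, mul_im, ofReal_re, I_im, mul_one, I_re, mul_zero, add_zero,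
      zero_add] at h1
    gcongr

/-- Partial fractions give 1/w + 1/(2(A − w)) − 1/(2(A + w)). Pairing t with −t turns these into
Poisson kernels, each of integral π, and 2π + π − π is twice the answer. -/
theorem integral_polarKernel_div_of_pos {A x : ℝ} (hx0 : 0 < x) (hx : x ≤ A - 1) :
    ∫ t : ℝ, polarKernel A (x + t * I) / (x + t * I) = Real.pi := by
  have hi := integrable_polarKernel_div hx0.ne' (by rwa [abs_of_pos hx0])
  have hsym : ∀ t : ℝ, polarKernel A (x + t * I) / (x + t * I) +
      polarKernel A (x + (-t : ℝ) * I) / (x + (-t : ℝ) * I) =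
      ((2 * (x / (x ^ 2 + t ^ 2)) + (A - x) / ((A - x) ^ 2 + t ^ 2) -
        (A + x) / ((A + x) ^ 2 + t ^ 2) : ℝ) : ℂ) := by
    intro t
    have hpf : ∀ w : ℂ, w ≠ 0 → (A : ℂ) - w ≠ 0 → (A : ℂ) + w ≠ 0 →
        polarKernel A w / w = 1 / w + (1 / 2) * (1 / (A - w)) - 1 / 2 * (1 / (A + w)) := by
      intro w h1 h2 h3
      rw [polarKernel, show (A : ℂ) ^ 2 - w ^ 2 = (A - w) * (A + w) by ring]
      field_simp
      ring
    have hne : ∀ u v : ℝ, 0 < u → (u : ℂ) + v * I ≠ 0 := by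
      intro u v hu h
      have := congrArg re h
      simp at this
      linarith
    have hinv : ∀ u : ℝ, 0 < u → 1 / ((u : ℂ) + t * I) + 1 / ((u : ℂ) + (-t : ℝ) * I) =
        ((2 * (u / (u ^ 2 + t ^ 2)) : ℝ) : ℂ) := by
      intro u hu
      have h1 := hne u t hu
      have h2 := hne u (-t) hu
      have h3 : ((u : ℂ) ^ 2 + t ^ 2) = (u + t * I) * (u + (-t : ℝ) * I) := by
        push_cast
        linear_combination (t : ℂ) ^ 2 * I_sq
      rw [div_add_div _ _ h1 h2]
      push_cast at h3 ⊢
      rw [h3]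
      ring
    have hA1 : ∀ v : ℝ, (A : ℂ) - (x + v * I) = ((A - x : ℝ) : ℂ) + (-v : ℝ) * I := by
      intro v; push_cast; ring
    have hA2 : ∀ v : ℝ, (A : ℂ) + (x + v * I) = ((A + x : ℝ) : ℂ) + v * I := by
      intro v; push_cast; ring
    rw [hpf _ (hne x t hx0) (by rw [hA1]; exact hne _ _ (by linarith))
        (by rw [hA2]; exact hne _ _ (by linarith)),
      hpf _ (hne x (-t) hx0) (by rw [hA1]; exact hne _ _ (by linarith))
        (by rw [hA2]; exact hne _ _ (by linarith)), hA1, hA1, hA2, hA2, neg_neg]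
    have e1 := hinv x hx0
    have e2 := hinv (A - x) (by linarith)
    have e3 := hinv (A + x) (by linarith)
    push_cast at e1 e2 e3 ⊢
    linear_combination e1 + 1 / 2 * e2 - 1 / 2 * e3
  have hneg : ∫ t : ℝ, polarKernel A (x + (-t : ℝ) * I) / (x + (-t : ℝ) * I) =
      ∫ t : ℝ, polarKernel A (x + t * I) / (x + t * I) :=
    integral_neg_eq_self (fun t : ℝ => polarKernel A (x + t * I) / (x + t * I)) volume
  have hadd := integral_add hi hi.comp_neg
  rw [hneg] at hadd
  simp_rw [hsym] at hadd
  rw [integral_complex_ofReal, integral_sub, integral_add, integral_const_mul, integral_div_sq_add_sq hx0,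
    integral_div_sq_add_sq (by linarith), integral_div_sq_add_sq (by linarith)] at hadd
  · push_cast at hadd
    linear_combination -(1 / 2 : ℂ) * hadd
  · exact (integrable_div_sq_add_sq hx0).const_mul 2
  · exact integrable_div_sq_add_sq (by linarith)
  · exact ((integrable_div_sq_add_sq hx0).const_mul 2).add (integrable_div_sq_add_sq (by linarith))
  · exact integrable_div_sq_add_sq (by linarith)

theorem integral_polarKernel_div_of_neg {A x : ℝ} (hx0 : x < 0) (hx : -x ≤ A - 1) :
    ∫ t : ℝ, polarKernel A (x + t * I) / (x + t * I) = -Real.pi := by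
  rw [← integral_polarKernel_div_of_pos (x := -x) (A := A) (by linarith) hx, ← integral_neg,
    ← integral_neg_eq_self (fun t : ℝ => polarKernel A (x + t * I) / (x + t * I)) volume]
  congr 1
  ext t
  have e : (x : ℂ) + (-t : ℝ) * I = -(((-x : ℝ) : ℂ) + t * I) := by push_cast; ring
  rw [e, polarKernel, polarKernel, neg_sq, div_neg]

/-- Cauchy's formula for a strip. -/
theorem integral_vertical_line_div_sub {Φ : ℂ → ℂ} (hΦ : Differentiable ℂ Φ) {a b C : ℝ}
    (hb : ∀ s : ℂ, s.re ∈ Set.Icc a b → ‖Φ s‖ ≤ C * (1 + s.im ^ 2)⁻¹)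
    {ρ : ℂ} (hρa : a < ρ.re) (hρb : ρ.re < b) :
    (∫ t : ℝ, Φ (b + t * I) / (b + t * I - ρ)) - (∫ t : ℝ, Φ (a + t * I) / (a + t * I - ρ)) =
      2 * Real.pi * Φ ρ := by
  -- This width keeps |Re(s − ρ)| ≤ A − 1 throughout the strip, away from the poles ±A of the
  -- kernel.
  set A : ℝ := b - a + 1 with hA
  -- D vanishes at ρ, so D(s)/(s − ρ) is holomorphic in the strip and has equal integrals over the
  -- two lines. The residue is carried by the kernel, whose two line integrals are π and −π.
  set D : ℂ → ℂ := fun s => Φ s - Φ ρ * polarKernel A (s - ρ) with hD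
  have hA0 : (A : ℂ) ≠ 0 := by
    norm_cast
    have : 0 < A := by linarith
    exact this.ne'
  have hDρ : D ρ = 0 := by
    simp only [hD, polarKernel, sub_self]
    field_simp
    simp
  have hstrip : ∀ s : ℂ, s.re ∈ Set.Icc a b → |(s - ρ).re| ≤ A - 1 := by
    intro s hs
    rw [abs_le, sub_re]
    constructor <;> linarith [hs.1, hs.2]
  set U : Set ℂ := {s | |(s - ρ).re| < A} with hU
  have hUo : IsOpen U := isOpen_lt (by fun_prop) continuous_const
  have hDU : DifferentiableOn ℂ D U := by
    intro s hs
    refine ((hΦ s).sub (DifferentiableAt.const_mul ?_ _)).differentiableWithinAt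
    exact DifferentiableAt.comp (g := polarKernel A) s (differentiableAt_polarKernel hs)
      (by fun_prop)
  have hρU : ρ ∈ U := by simp [hU]; linarith
  have hqU : DifferentiableOn ℂ (dslope D ρ) U :=
    (differentiableOn_dslope (hUo.mem_nhds hρU)).mpr hDU
  have hqd : ∀ s : ℂ, s.re ∈ Set.Icc a b → DifferentiableAt ℂ (dslope D ρ) s := fun s hs =>
    hqU.differentiableAt (hUo.mem_nhds (lt_of_le_of_lt (hstrip s hs) (by linarith)))
  have hC : 0 ≤ C := by
    have := (norm_nonneg _).trans (hb (a : ℂ) (by simp; linarith))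
    simpa using this
  have hDb : ∀ s : ℂ, s.re ∈ Set.Icc a b →
      ‖D s‖ ≤ (C + ‖Φ ρ‖ * (2 * A ^ 2 * (2 * (1 + ρ.im ^ 2)))) * (1 + s.im ^ 2)⁻¹ := by
    intro s hs
    have h1 := norm_polarKernel_le (hstrip s hs)
    have h2 : (1 + (s - ρ).im ^ 2)⁻¹ ≤ 2 * (1 + ρ.im ^ 2) * (1 + s.im ^ 2)⁻¹ := by
      rw [inv_eq_one_div, ← div_eq_mul_inv, div_le_div_iff₀ (by positivity) (by positivity), sub_im]
      nlinarith [sq_nonneg (s.im - ρ.im - ρ.im), sq_nonneg ((s.im - ρ.im) * ρ.im),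
        sq_nonneg (s.im - 2 * ρ.im)]
    calc ‖D s‖ ≤ ‖Φ s‖ + ‖Φ ρ * polarKernel A (s - ρ)‖ := norm_sub_le _ _
      _ ≤ C * (1 + s.im ^ 2)⁻¹ +
          ‖Φ ρ‖ * (2 * A ^ 2 * (2 * (1 + ρ.im ^ 2) * (1 + s.im ^ 2)⁻¹)) := by
          rw [norm_mul]
          gcongr
          · exact hb s hs
          · exact h1.trans (by gcongr)
      _ = _ := by ring
  obtain ⟨K, hK⟩ : ∃ K, ∀ s ∈ {s : ℂ | s.re ∈ Set.Icc a b} ∩ closedBall ρ 1,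
      ‖dslope D ρ s‖ ≤ K := by
    have hc : IsCompact ({s : ℂ | s.re ∈ Set.Icc a b} ∩ closedBall ρ 1) :=
      (isCompact_closedBall ρ 1).inter_left (isClosed_Icc.preimage continuous_re)
    exact hc.exists_bound_of_continuousOn
      fun s hs => (hqd s hs.1).continuousAt.continuousWithinAt
  set C' : ℝ := (C + ‖Φ ρ‖ * (2 * A ^ 2 * (2 * (1 + ρ.im ^ 2)))) with hC'
  have hC'0 : 0 ≤ C' := by positivity
  have hqb : ∀ s : ℂ, s.re ∈ Set.Icc a b →
      ‖dslope D ρ s‖ ≤ (C' + |K| * (1 + (|ρ.im| + 1) ^ 2)) * (1 + s.im ^ 2)⁻¹ := by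
    intro s hs
    rw [add_mul]
    -- Near ρ the quotient is bounded by compactness; at distance at least 1 from ρ it is bounded by
    -- D itself.
    rcases le_total ‖s - ρ‖ 1 with h | h
    · have h1 := hK s ⟨hs, by simpa [dist_eq_norm] using h⟩
      have h2 : 1 ≤ (1 + (|ρ.im| + 1) ^ 2) * (1 + s.im ^ 2)⁻¹ := by
        rw [← div_eq_mul_inv, one_le_div (by positivity), ← sq_abs s.im]
        have h3 := (abs_im_le_norm (s - ρ)).trans h
        rw [sub_im] at h3
        have h4 : |s.im| ≤ |ρ.im| + 1 := by
          have := abs_sub_abs_le_abs_sub s.im ρ.im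
          linarith
        gcongr
      have h5 : |K| * 1 ≤ |K| * ((1 + (|ρ.im| + 1) ^ 2) * (1 + s.im ^ 2)⁻¹) := by gcongr
      have h6 : 0 ≤ C' * (1 + s.im ^ 2)⁻¹ := by positivity
      linarith [le_abs_self K]
    · have hne : s ≠ ρ := by rintro rfl; simp at h; linarith
      have h1 : ‖dslope D ρ s‖ ≤ ‖D s‖ := by
        rw [dslope_of_ne _ hne, slope_def_field, hDρ, sub_zero, norm_div]
        exact div_le_self (norm_nonneg _) h
      have h6 : 0 ≤ |K| * (1 + (|ρ.im| + 1) ^ 2) * (1 + s.im ^ 2)⁻¹ := by positivity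
      linarith [hDb s hs]
  have hshift := integral_vertical_line_eq (by linarith) hqd hqb
  have hline : ∀ x : ℝ, x ∈ Set.Icc a b → x ≠ ρ.re →
      ∫ t : ℝ, Φ (x + t * I) / (x + t * I - ρ) = (∫ t : ℝ, dslope D ρ (x + t * I)) +
        Φ ρ * ∫ t : ℝ, polarKernel A ((x - ρ.re : ℝ) + t * I) / ((x - ρ.re : ℝ) + t * I) := by
    intro x hx hne
    have hw : ∀ t : ℝ, ((x - ρ.re : ℝ) : ℂ) + (t - ρ.im : ℝ) * I = x + t * I - ρ := by
      intro t
      apply Complex.ext <;> simp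
    have hker : Integrable fun t : ℝ =>
        polarKernel A ((x - ρ.re : ℝ) + t * I) / ((x - ρ.re : ℝ) + t * I) :=
      integrable_polarKernel_div (sub_ne_zero.mpr hne)
        (by simpa using hstrip (x : ℂ) (by simpa using hx))
    rw [← integral_sub_right_eq_self (fun t : ℝ =>
        polarKernel A ((x - ρ.re : ℝ) + t * I) / ((x - ρ.re : ℝ) + t * I)) ρ.im,
      ← integral_const_mul, ← integral_add
      (integrable_vertical_line hx (fun s hs => (hqd s hs).continuousAt) hqb)
      ((hker.comp_sub_right ρ.im).const_mul _)]
    congr 1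
    ext t
    have hne' : (x : ℂ) + t * I ≠ ρ := by
      intro h
      apply hne
      rw [← h]
      simp
    rw [hw, dslope_of_ne _ hne', slope_def_field, hDρ]
    simp only [hD]
    ring
  rw [hline b (Set.right_mem_Icc.mpr (by linarith)) hρb.ne',
    hline a (Set.left_mem_Icc.mpr (by linarith)) hρa.ne, hshift,
    integral_polarKernel_div_of_pos (by linarith) (by linarith),
    integral_polarKernel_div_of_neg (by linarith) (by linarith)]
  ring

end VerticalLines

/-! ### The entire extension of g and its decay in horizontal strips. -/

section Extension

/-- The two-sided Laplace transform `z ↦ ∫ φ(ξ) e^{2πizξ} dξ`. -/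
noncomputable def laplace (φ : ℝ → ℂ) (z : ℂ) : ℂ :=
  ∫ ξ : ℝ, φ ξ * exp (2 * Real.pi * I * z * ξ)

variable {φ : ℝ → ℂ}

theorem integrable_mul_exp (hφ : Continuous φ) (hs : HasCompactSupport φ) (z : ℂ) :
    Integrable fun ξ : ℝ => φ ξ * exp (2 * Real.pi * I * z * ξ) :=
  (by fun_prop : Continuous fun ξ : ℝ => φ ξ * exp (2 * Real.pi * I * z * ξ)).integrable_of_hasCompactSupport
    hs.mul_right

theorem differentiable_laplace (hφ : Continuous φ) (hs : HasCompactSupport φ) :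
    Differentiable ℂ (laplace φ) := by
  intro z
  have hbound : Integrable fun ξ : ℝ =>
      ‖φ ξ‖ * (Real.exp (2 * Real.pi * (‖z‖ + 1) * |ξ|) * (2 * Real.pi * |ξ|)) :=
    (by fun_prop : Continuous fun ξ : ℝ =>
      ‖φ ξ‖ * (Real.exp (2 * Real.pi * (‖z‖ + 1) * |ξ|) * (2 * Real.pi * |ξ|)))
      |>.integrable_of_hasCompactSupport hs.norm.mul_right
  refine (hasDerivAt_integral_of_dominated_loc_of_deriv_le (ball_mem_nhds z one_pos)
    (F' := fun w ξ => φ ξ * (exp (2 * Real.pi * I * w * ξ) * (2 * Real.pi * I * ξ)))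
    (Eventually.of_forall fun w => (integrable_mul_exp hφ hs w).aestronglyMeasurable)
    (integrable_mul_exp hφ hs z) ?_ (Eventually.of_forall fun ξ w hw => ?_) hbound
    (Eventually.of_forall fun ξ w _ => ?_)).2.differentiableAt
  · exact (by fun_prop : Continuous fun ξ : ℝ =>
      φ ξ * (exp (2 * Real.pi * I * z * ξ) * (2 * Real.pi * I * ξ))).aestronglyMeasurable
  · rw [norm_mul, norm_mul]
    have h1 : ‖(2 * Real.pi * I * ξ : ℂ)‖ = 2 * Real.pi * |ξ| := by
      simp [abs_of_pos Real.pi_pos]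
    have hw' : ‖w‖ ≤ ‖z‖ + 1 := by
      rw [mem_ball, dist_eq_norm] at hw
      have : ‖w‖ ≤ ‖w - z‖ + ‖z‖ := by simpa using norm_add_le (w - z) z
      linarith
    have h2 : ‖exp (2 * Real.pi * I * w * ξ)‖ ≤ Real.exp (2 * Real.pi * (‖z‖ + 1) * |ξ|) := by
      refine (norm_exp_le_exp_norm _).trans (Real.exp_le_exp.mpr ?_)
      have : ‖(2 * Real.pi * I * w * ξ : ℂ)‖ = 2 * Real.pi * ‖w‖ * |ξ| := by
        simp [abs_of_pos Real.pi_pos]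
      rw [this]
      gcongr
    rw [h1]
    gcongr
  · have h1 : HasDerivAt (fun w : ℂ => 2 * Real.pi * I * w * ξ) (2 * Real.pi * I * ξ) w := by
      have := ((hasDerivAt_id w).const_mul (2 * Real.pi * I)).mul_const (ξ : ℂ)
      simpa using this
    exact h1.cexp.const_mul _

theorem norm_laplace_le (hφ : Continuous φ) (hs : HasCompactSupport φ) (Y : ℝ) :
    ∃ C : ℝ, ∀ z : ℂ, |z.im| ≤ Y → ‖laplace φ z‖ ≤ C := by
  refine ⟨∫ ξ : ℝ, ‖φ ξ‖ * Real.exp (2 * Real.pi * Y * |ξ|), fun z hz => ?_⟩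
  have hbound : Integrable fun ξ : ℝ => ‖φ ξ‖ * Real.exp (2 * Real.pi * Y * |ξ|) :=
    (by fun_prop : Continuous fun ξ : ℝ => ‖φ ξ‖ * Real.exp (2 * Real.pi * Y * |ξ|))
      |>.integrable_of_hasCompactSupport hs.norm.mul_right
  refine norm_integral_le_of_norm_le hbound (Eventually.of_forall fun ξ => ?_)
  rw [norm_mul, norm_exp]
  gcongr
  have : (2 * Real.pi * I * z * ξ : ℂ).re = -(2 * Real.pi * (z.im * ξ)) := by simp; ring
  have hle : -(z.im * ξ) ≤ Y * |ξ| :=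
    calc -(z.im * ξ) ≤ |z.im * ξ| := neg_le_abs _
      _ = |z.im| * |ξ| := abs_mul _ _
      _ ≤ Y * |ξ| := by gcongr
  rw [this]
  nlinarith [Real.pi_pos]

theorem laplace_deriv (hφ : ContDiff ℝ 1 φ) (hs : HasCompactSupport φ) (z : ℂ) :
    laplace (deriv φ) z = -(2 * Real.pi * I * z) * laplace φ z := by
  have hd : ∀ ξ : ℝ, HasDerivAt (fun ξ : ℝ => exp (2 * Real.pi * I * z * ξ))
      (exp (2 * Real.pi * I * z * ξ) * (2 * Real.pi * I * z)) ξ := by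
    intro ξ
    have h1 : HasDerivAt (fun ξ : ℝ => 2 * Real.pi * I * z * (ξ : ℂ)) (2 * Real.pi * I * z) ξ := by
      simpa using (Complex.ofRealCLM.hasDerivAt (x := ξ)).const_mul (2 * Real.pi * I * z)
    exact h1.cexp
  have hcd : Continuous (deriv φ) := hφ.continuous_deriv le_rfl
  have h1 := integral_mul_deriv_eq_deriv_mul_of_integrable (u := φ)
    (v := fun ξ : ℝ => exp (2 * Real.pi * I * z * ξ)) (u' := deriv φ)
    (v' := fun ξ : ℝ => exp (2 * Real.pi * I * z * ξ) * (2 * Real.pi * I * z))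
    (fun ξ _ => (hφ.differentiable one_ne_zero ξ).hasDerivAt) (fun ξ _ => hd ξ)
    (by
      refine (((integrable_mul_exp hφ.continuous hs z).mul_const (2 * Real.pi * I * z))).congr
        (Eventually.of_forall fun ξ => ?_)
      simp [mul_assoc])
    (integrable_mul_exp hcd hs.deriv z) (integrable_mul_exp hφ.continuous hs z)
  simp only [laplace]
  rw [← neg_eq_iff_eq_neg] at h1
  rw [← h1, ← integral_const_mul, ← integral_neg]
  congr 1
  ext ξ
  ring

theorem laplace_iterate_deriv (hφ : ContDiff ℝ ((⊤ : ℕ∞) : WithTop ℕ∞) φ)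
    (hs : HasCompactSupport φ) (z : ℂ) (k : ℕ) :
    ContDiff ℝ ((⊤ : ℕ∞) : WithTop ℕ∞) (deriv^[k] φ) ∧ HasCompactSupport (deriv^[k] φ) ∧
      laplace (deriv^[k] φ) z = (-(2 * Real.pi * I * z)) ^ k * laplace φ z := by
  induction k with
  | zero => exact ⟨hφ, hs, by simp⟩
  | succ k ih =>
    obtain ⟨h1, h2, h3⟩ := ih
    rw [Function.iterate_succ_apply']
    refine ⟨(contDiff_infty_iff_deriv.mp h1).2, h2.deriv, ?_⟩
    rw [laplace_deriv (h1.of_le (by exact_mod_cast le_top)) h2, h3, pow_succ]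
    ring

/-- Six integrations by parts bound |z|⁶ times the transform. The resulting decay can absorb a
factor 1 + (Re z)² and still leave an integrable function. -/
theorem exists_norm_laplace_le (hφ : ContDiff ℝ ((⊤ : ℕ∞) : WithTop ℕ∞) φ)
    (hs : HasCompactSupport φ) (Y : ℝ) :
    ∃ C : ℝ, 0 ≤ C ∧ ∀ z : ℂ, |z.im| ≤ Y → ‖laplace φ z‖ ≤ C * ((1 + z.re ^ 2)⁻¹) ^ 3 := by
  obtain ⟨C₀, hC₀⟩ := norm_laplace_le hφ.continuous hs Y
  have h6 := laplace_iterate_deriv hφ hs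
  obtain ⟨C₆, hC₆⟩ := norm_laplace_le (h6 0 6).1.continuous (h6 0 6).2.1 Y
  refine ⟨4 * (|C₀| + |C₆|), by positivity, fun z hz => ?_⟩
  have h1 := (hC₀ z hz).trans (le_abs_self _)
  have h2 := (hC₆ z hz).trans (le_abs_self _)
  rw [(h6 z 6).2.2, norm_mul, norm_pow, norm_neg] at h2
  have h3 : |z.re| ≤ ‖(2 * Real.pi * I * z : ℂ)‖ := by
    have : ‖(2 * Real.pi * I * z : ℂ)‖ = 2 * Real.pi * ‖z‖ := by simp [abs_of_pos Real.pi_pos]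
    rw [this]
    nlinarith [abs_re_le_norm z, norm_nonneg z, Real.pi_gt_three]
  have h4 : |z.re| ^ 6 * ‖laplace φ z‖ ≤ |C₆| := le_trans (by gcongr) h2
  rw [inv_pow, ← div_eq_mul_inv, le_div_iff₀ (by positivity)]
  have h5 : (1 + z.re ^ 2) ^ 3 ≤ 4 * (1 + |z.re| ^ 6) := by
    have : |z.re| ^ 6 = (z.re ^ 2) ^ 3 := by rw [← sq_abs z.re, ← pow_mul]
    rw [this]
    nlinarith [mul_nonneg (by positivity : 0 ≤ 1 + z.re ^ 2) (sq_nonneg (1 - z.re ^ 2))]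
  calc ‖laplace φ z‖ * (1 + z.re ^ 2) ^ 3 ≤ ‖laplace φ z‖ * (4 * (1 + |z.re| ^ 6)) := by gcongr
    _ = 4 * (‖laplace φ z‖ + |z.re| ^ 6 * ‖laplace φ z‖) := by ring
    _ ≤ 4 * (|C₀| + |C₆|) := by gcongr

variable (g : 𝓢(ℝ, ℂ))

theorem contDiff_fourier : ContDiff ℝ ((⊤ : ℕ∞) : WithTop ℕ∞) (𝓕 (g : ℝ → ℂ)) := by
  rw [← SchwartzMap.fourier_coe]
  exact (𝓕 g).smooth _

/-- This is Fourier inversion. -/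
theorem complexExtension_ofReal (x : ℝ) : complexExtension g x = g x := by
  have h : 𝓕⁻ (𝓕 (g : ℝ → ℂ)) = (g : ℝ → ℂ) := by
    rw [← SchwartzMap.fourier_coe, ← SchwartzMap.fourierInv_coe, FourierTransform.fourierInv_fourier_eq]
  rw [← congrFun h x, Real.fourierInv_eq', complexExtension]
  congr 1
  ext ξ
  rw [smul_eq_mul, mul_comm]
  congr 2
  simp
  ring

variable {g}

theorem fourier_even (hg : ∀ x : ℝ, g (-x) = g x) (ξ : ℝ) :
    𝓕 (g : ℝ → ℂ) (-ξ) = 𝓕 (g : ℝ → ℂ) ξ := by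
  rw [Real.fourier_real_eq_integral_exp_smul, Real.fourier_real_eq_integral_exp_smul,
    ← integral_neg_eq_self]
  congr 1
  ext x
  rw [hg]
  congr 2
  push_cast
  ring

theorem complexExtension_neg (hg : ∀ x : ℝ, g (-x) = g x) (z : ℂ) :
    complexExtension g (-z) = complexExtension g z := by
  rw [complexExtension, ← integral_neg_eq_self, complexExtension]
  congr 1
  ext ξ
  rw [fourier_even hg]
  congr 2
  push_cast
  ring

end Extension

/-! ### Bounds for Γ and Γ'/Γ in vertical strips. -/

section GammaFunction

theorem norm_Gamma_le {s : ℂ} (hs : 0 < s.re) : ‖Gamma s‖ ≤ Real.Gamma s.re := by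
  rw [Gamma_eq_integral hs, GammaIntegral, Real.Gamma_eq_integral hs]
  refine (norm_integral_le_integral_norm _).trans (le_of_eq ?_)
  refine setIntegral_congr_fun measurableSet_Ioi fun x hx => ?_
  rw [norm_mul, norm_real, Real.norm_eq_abs, abs_of_pos (Real.exp_pos _),
    norm_cpow_eq_rpow_re_of_pos hx, sub_re, one_re]

theorem ne_neg_natCast_of_re_pos {s : ℂ} (hs : 0 < s.re) (m : ℕ) : s ≠ -m := by
  rintro rfl
  simp at hs
  have : (0 : ℝ) ≤ m := Nat.cast_nonneg m
  linarith

theorem differentiableAt_Gamma_of_re_pos {s : ℂ} (hs : 0 < s.re) : DifferentiableAt ℂ Gamma s :=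
  differentiableAt_Gamma s (ne_neg_natCast_of_re_pos hs)

theorem differentiableAt_digamma_of_re_pos {s : ℂ} (hs : 0 < s.re) :
    DifferentiableAt ℂ digamma s := by
  have hU : IsOpen {s : ℂ | 0 < s.re} := isOpen_lt continuous_const continuous_re
  have hd : DifferentiableOn ℂ Gamma {s : ℂ | 0 < s.re} :=
    fun w hw => (differentiableAt_Gamma_of_re_pos hw).differentiableWithinAt
  exact ((hd.deriv hU).differentiableAt (hU.mem_nhds hs)).div (differentiableAt_Gamma_of_re_pos hs)
    (Gamma_ne_zero_of_re_pos hs)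

/-- The factor ‖v‖ is kept so that it cancels the zero of π(1 − s) at s = 1 in the reflection
formula below. -/
theorem norm_sin_le_mul_exp (v : ℂ) : ‖sin v‖ ≤ ‖v‖ * Real.exp ‖v‖ := by
  have hcos : ∀ u ∈ closedBall (0 : ℂ) ‖v‖, ‖deriv sin u‖ ≤ Real.exp ‖v‖ := by
    intro u hu
    rw [mem_closedBall_zero_iff] at hu
    rw [Complex.deriv_sin, cos, norm_div, Complex.norm_ofNat, div_le_iff₀ two_pos, mul_two]
    refine (norm_add_le _ _).trans (add_le_add ?_ ?_) <;>
    · refine (norm_exp_le_exp_norm _).trans (Real.exp_le_exp.mpr ?_)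
      simpa using hu
  have := (convex_closedBall (0 : ℂ) ‖v‖).norm_image_sub_le_of_norm_deriv_le
    (fun u _ => differentiable_sin u) hcos (x := 0) (y := v) (by simp) (by simp)
  simpa [mul_comm] using this

/-- A uniform bound for `Γ`, above and below, in a vertical strip. -/
theorem exists_Gamma_bounds : ∃ M : ℝ, 1 ≤ M ∧
    (∀ s : ℂ, s.re ∈ Set.Icc (1 / 8 : ℝ) (15 / 8) → ‖Gamma s‖ ≤ M) ∧
    ∀ s : ℂ, s.re ∈ Set.Icc (1 / 8 : ℝ) (15 / 8) →
      1 ≤ ‖Gamma s‖ * M * Real.exp (Real.pi * ‖1 - s‖) := by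
  have hc : ContinuousOn Real.Gamma (Set.Icc (1 / 8 : ℝ) (15 / 8)) :=
    Real.differentiableOn_Gamma_Ioi.continuousOn.mono fun x hx => by
      have := hx.1
      simp only [Set.mem_Ioi]; linarith
  obtain ⟨M, hM⟩ := isCompact_Icc.exists_bound_of_continuousOn hc
  have hM1 : 1 ≤ M := by
    have := hM 1 (by constructor <;> norm_num)
    simpa using this
  have hup : ∀ s : ℂ, s.re ∈ Set.Icc (1 / 8 : ℝ) (15 / 8) → ‖Gamma s‖ ≤ M := by
    intro s hs
    exact (norm_Gamma_le (by linarith [hs.1])).trans ((le_abs_self _).trans (hM _ hs))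
  refine ⟨M, hM1, hup, fun s hs => ?_⟩
  rcases eq_or_ne s 1 with rfl | hne
  · simpa using hM1
  have hw : 1 - s ≠ 0 := sub_ne_zero.mpr hne.symm
  have hs0 : 0 < s.re := by linarith [hs.1]
  have hs2 : 0 < (2 - s).re := by simp; linarith [hs.2]
  have hG : Gamma (2 - s) = (1 - s) * Gamma (1 - s) := by
    rw [← Gamma_add_one _ hw]; congr 1; ring
  have hprod := Gamma_mul_Gamma_one_sub s
  have hne0 : Gamma s * Gamma (1 - s) ≠ 0 := by
    refine mul_ne_zero (Gamma_ne_zero_of_re_pos hs0) fun h => Gamma_ne_zero_of_re_pos hs2 ?_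
    rw [hG, h, mul_zero]
  have hsin : sin (Real.pi * s) ≠ 0 := by
    intro h
    rw [h, div_zero] at hprod
    exact hne0 hprod
  rw [eq_div_iff hsin] at hprod
  have hsin' : sin (Real.pi * s) = sin (Real.pi * (1 - s)) := by
    rw [mul_sub, mul_one, Complex.sin_pi_sub]
  -- Reflection is used with 2 − s instead of 1 − s because the strip is stable under s ↦ 2 − s, so
  -- the upper bound for Γ(2 − s) turns into a lower bound for Γ(s).
  have key : Gamma s * Gamma (2 - s) * sin (Real.pi * (1 - s)) = Real.pi * (1 - s) := by
    rw [hG, ← hsin']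
    linear_combination (1 - s) * hprod
  have hk := congrArg norm key
  have h1 := norm_sin_le_mul_exp (Real.pi * (1 - s))
  have h2 : ‖(Real.pi * (1 - s) : ℂ)‖ = Real.pi * ‖1 - s‖ := by simp [abs_of_pos Real.pi_pos]
  rw [h2] at h1
  rw [norm_mul, norm_mul, h2] at hk
  have h3 := hup (2 - s) (by simp; constructor <;> linarith [hs.1, hs.2])
  have hp : 0 < Real.pi * ‖1 - s‖ := mul_pos Real.pi_pos (norm_pos_iff.mpr hw)
  have h4 : Real.pi * ‖1 - s‖ * 1 ≤
      Real.pi * ‖1 - s‖ * (‖Gamma s‖ * M * Real.exp (Real.pi * ‖1 - s‖)) := by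
    calc Real.pi * ‖1 - s‖ * 1 = ‖Gamma s‖ * ‖Gamma (2 - s)‖ * ‖sin (Real.pi * (1 - s))‖ := by
          rw [hk, mul_one]
      _ ≤ ‖Gamma s‖ * M * (Real.pi * ‖1 - s‖ * Real.exp (Real.pi * ‖1 - s‖)) := by gcongr
      _ = _ := by ring
  exact le_of_mul_le_mul_left h4 hp

/-- The logarithmic derivative bound is applied to Γ on the disc of radius 1/8 about s, which stays
inside the strip of `exists_Gamma_bounds`. Those bounds control the logarithm of Γ(s + w)/Γ(s)
linearly in |Im s|; the summand 1 in A ensures A > 0. -/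
theorem exists_norm_digamma_le : ∃ C : ℝ, 0 ≤ C ∧
    ∀ s : ℂ, s.re ∈ Set.Icc (1 / 4 : ℝ) (3 / 2) → ‖digamma s‖ ≤ C * (1 + |s.im|) := by
  obtain ⟨M, hM1, hup, hlow⟩ := exists_Gamma_bounds
  have hlM : 0 ≤ Real.log M := Real.log_nonneg hM1
  refine ⟨64 * (Real.pi + (2 * Real.log M + 1)), by positivity, fun s hs => ?_⟩
  set A : ℝ := Real.pi * ‖1 - s‖ + (2 * Real.log M + 1) with hA
  have hApos : 0 < A := by positivity
  have hball : ∀ w ∈ ball (0 : ℂ) (1 / 8), (s + w).re ∈ Set.Icc (1 / 8 : ℝ) (15 / 8) := by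
    intro w hw
    have h1 := (abs_re_le_norm w).trans_lt (by simpa using hw)
    rw [abs_lt] at h1
    simp only [add_re]
    constructor <;> linarith [hs.1, hs.2]
  have hpos : ∀ w ∈ ball (0 : ℂ) (1 / 8), 0 < (s + w).re := fun w hw => by
    linarith [(hball w hw).1]
  have hd : DifferentiableOn ℂ (fun w => Gamma (s + w)) (ball 0 (1 / 8)) := fun w hw =>
    (DifferentiableAt.comp (g := Gamma) w (differentiableAt_Gamma_of_re_pos (hpos w hw))
      (by fun_prop)).differentiableWithinAt
  have h := norm_logDeriv_le_of_norm_le (H := fun w => Gamma (s + w)) (R := 1 / 8) (A := A)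
    (by norm_num) hApos hd (fun w hw => Gamma_ne_zero_of_re_pos (hpos w hw)) (by
      intro w hw
      simp only [add_zero]
      refine (hup _ (hball w hw)).trans ?_
      have h1 := hlow s ⟨by linarith [hs.1], by linarith [hs.2]⟩
      rw [hA, Real.exp_add, Real.exp_add, mul_comm 2, Real.exp_mul (Real.log M), Real.exp_log (by linarith),
        Real.rpow_two]
      have h2 : M * 1 ≤ M * (‖Gamma s‖ * M * Real.exp (Real.pi * ‖1 - s‖)) := by gcongr
      have h3 : 1 ≤ Real.exp 1 := Real.one_le_exp zero_le_one
      have h4 : 0 ≤ ‖Gamma s‖ * (Real.exp (Real.pi * ‖1 - s‖) * M ^ 2) := by positivity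
      nlinarith) (z := 0) (by simp; norm_num)
  have e : logDeriv (fun w => Gamma (s + w)) 0 = digamma s := by
    rw [digamma_def, logDeriv_apply, logDeriv_apply, deriv_comp_const_add, add_zero]
  rw [e] at h
  refine h.trans ?_
  have h1 : ‖1 - s‖ ≤ 1 + |s.im| := by
    refine (norm_le_abs_re_add_abs_im _).trans ?_
    simp only [sub_re, one_re, sub_im, one_im, zero_sub, abs_neg]
    gcongr
    rw [abs_le]
    constructor <;> linarith [hs.1, hs.2]
  have h2 : (2 * Real.log M + 1) * 1 ≤ (2 * Real.log M + 1) * (1 + |s.im|) := by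
    gcongr
    linarith [abs_nonneg s.im]
  have h3 : Real.pi * ‖1 - s‖ ≤ Real.pi * (1 + |s.im|) := by gcongr
  rw [hA]
  linarith

end GammaFunction

/-! ### The completed L-function: functional equation, zero-free regions, order of growth. -/

section CompletedLFunction

theorem gammaFactor_chi (d : FundamentalDiscriminant) (s : ℂ) :
    (chi d).gammaFactor s = Gammaℝ (s + parity d) := by
  rcases (chi d).even_or_odd with h | h
  · rw [h.gammaFactor_def, parity_of_even h, Nat.cast_zero, add_zero]
  · rw [h.gammaFactor_def, parity_of_odd h, Nat.cast_one]

theorem parity_le_one (d : FundamentalDiscriminant) : parity d ≤ 1 := by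
  unfold parity; split_ifs <;> norm_num

/-- For Re s > 0 the Gamma factor has neither pole nor zero, so the continuation is the literal
product. -/
theorem completedL_of_re_pos (d : FundamentalDiscriminant) {s : ℂ} (hs : 0 < s.re) :
    completedL d s = (d.1.natAbs : ℂ) ^ ((s + parity d) / 2) *
      ((Real.pi : ℂ) ^ (-(s + parity d) / 2) * Gamma ((s + parity d) / 2)) *
        (chi d).LFunction s := by
  have hs0 : s ≠ 0 := by rintro rfl; simp at hs
  have hre : 0 < (s + parity d).re := by
    simp only [add_re, natCast_re]; positivity
  rw [(chi d).LFunction_eq_completed_div_gammaFactor s (Or.inl hs0), gammaFactor_chi, completedL,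
    ← Gammaℝ_def]
  field_simp [Gammaℝ_ne_zero_of_re_pos hre]

variable {d : FundamentalDiscriminant}

theorem natAbs_cast_ne_zero (d : FundamentalDiscriminant) : (d.1.natAbs : ℂ) ≠ 0 :=
  Nat.cast_ne_zero.mpr (NeZero.ne _)

theorem differentiable_completedL (hd : d.1 ≠ 1) : Differentiable ℂ (completedL d) := by
  refine Differentiable.mul (fun s => ?_)
    (DirichletCharacter.differentiable_completedLFunction (chi_ne_one d hd))
  exact DifferentiableAt.const_cpow (by fun_prop) (Or.inl (natAbs_cast_ne_zero d))

/-- The power of |d| in `completedL` absorbs the factor |d|^{s − 1/2} of the functional equation for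
`completedLFunction`, and χ_d is its own inverse. -/
theorem completedL_one_sub (d : FundamentalDiscriminant) (s : ℂ) :
    completedL d (1 - s) = (chi d).rootNumber * completedL d s := by
  rw [completedL, completedL, (isPrimitive_chi d).completedLFunction_one_sub, chi_inv]
  have h : (d.1.natAbs : ℂ) ^ ((1 - s + parity d) / 2) * (d.1.natAbs : ℂ) ^ (s - 1 / 2) =
      (d.1.natAbs : ℂ) ^ ((s + parity d) / 2) := by
    rw [← cpow_add _ _ (natAbs_cast_ne_zero d)]
    congr 1
    ring
  rw [← h]
  ring

theorem completedL_ne_zero_of_one_le_re (hd : d.1 ≠ 1) {s : ℂ} (hs : 1 ≤ s.re) :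
    completedL d s ≠ 0 := by
  have hs0 : 0 < s.re := by linarith
  have hre : 0 < ((s + parity d) / 2).re := by
    have : ((s + parity d) / 2 : ℂ).re = (s.re + parity d) / 2 := by simp
    rw [this]; positivity
  rw [completedL_of_re_pos d hs0]
  refine mul_ne_zero (mul_ne_zero ?_ (mul_ne_zero ?_ (Gamma_ne_zero_of_re_pos hre)))
    ((chi d).LFunction_ne_zero_of_one_le_re (Or.inl (chi_ne_one d hd)) hs)
  · exact fun h => natAbs_cast_ne_zero d ((cpow_eq_zero_iff _ _).mp h).1
  · simp [cpow_eq_zero_iff, Real.pi_ne_zero]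

/-- A vanishing root number would force Λ(2, χ_d) = 0. -/
theorem rootNumber_chi_ne_zero (hd : d.1 ≠ 1) : (chi d).rootNumber ≠ 0 := by
  intro h
  have h1 := completedL_one_sub d (-1)
  rw [h, zero_mul] at h1
  exact completedL_ne_zero_of_one_le_re hd (by norm_num) h1

theorem completedL_ne_zero_of_re_nonpos (hd : d.1 ≠ 1) {s : ℂ} (hs : s.re ≤ 0) :
    completedL d s ≠ 0 := by
  have h := completedL_one_sub d (1 - s)
  rw [sub_sub_cancel] at h
  rw [h]
  exact mul_ne_zero (rootNumber_chi_ne_zero hd)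
    (completedL_ne_zero_of_one_le_re hd (by simp; linarith))

theorem logDeriv_completedL_one_sub (hd : d.1 ≠ 1) (s : ℂ) :
    logDeriv (completedL d) (1 - s) = -logDeriv (completedL d) s := by
  have h1 : (completedL d ∘ fun s => 1 - s) = fun s => (chi d).rootNumber * completedL d s :=
    funext (completedL_one_sub d)
  have h2 := logDeriv_comp (f := completedL d) (g := fun s => 1 - s) (x := s)
    (differentiable_completedL hd _) (by fun_prop)
  rw [h1, logDeriv_const_mul _ _ (rootNumber_chi_ne_zero hd)] at h2
  rw [h2]
  simp

theorem logDeriv_completedL (hd : d.1 ≠ 1) {s : ℂ} (hs : 1 < s.re) :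
    logDeriv (completedL d) s = ((Real.log (|(d.1 : ℝ)| / Real.pi) : ℝ) : ℂ) / 2 +
      digamma ((s + parity d) / 2) / 2 + logDeriv (chi d).LFunction s := by
  have hs0 : 0 < s.re := by linarith
  have hre : 0 < ((s + parity d) / 2).re := by
    have : ((s + parity d) / 2 : ℂ).re = (s.re + parity d) / 2 := by simp
    rw [this]; positivity
  have hπ : (Real.pi : ℂ) ≠ 0 := by exact_mod_cast Real.pi_ne_zero
  have hev : completedL d =ᶠ[𝓝 s] fun s => (d.1.natAbs : ℂ) ^ ((s + parity d) / 2) *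
      ((Real.pi : ℂ) ^ (-(s + parity d) / 2) * Gamma ((s + parity d) / 2)) *
        (chi d).LFunction s := by
    filter_upwards [(isOpen_lt continuous_const continuous_re).mem_nhds hs0] with w hw
    exact completedL_of_re_pos d hw
  have hlin : HasDerivAt (fun s : ℂ => (s + parity d) / 2) (1 / 2) s :=
    ((hasDerivAt_id s).add_const _).div_const 2
  have hlin' : HasDerivAt (fun s : ℂ => -(s + parity d) / 2) (-1 / 2) s :=
    ((hasDerivAt_id s).add_const _).neg.div_const 2
  have hN := hlin.const_cpow (c := (d.1.natAbs : ℂ)) (Or.inl (natAbs_cast_ne_zero d))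
  have hP := hlin'.const_cpow (c := (Real.pi : ℂ)) (Or.inl hπ)
  have hN0 : (d.1.natAbs : ℂ) ^ ((s + parity d) / 2) ≠ 0 :=
    fun h => natAbs_cast_ne_zero d ((cpow_eq_zero_iff _ _).mp h).1
  have hP0 : (Real.pi : ℂ) ^ (-(s + parity d) / 2) ≠ 0 := by
    simp [cpow_eq_zero_iff, hπ]
  have hG0 := Gamma_ne_zero_of_re_pos hre
  have hGd : DifferentiableAt ℂ (fun s : ℂ => Gamma ((s + parity d) / 2)) s :=
    DifferentiableAt.comp (g := Gamma) s (differentiableAt_Gamma_of_re_pos hre)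
      hlin.differentiableAt
  have hL0 := (chi d).LFunction_ne_zero_of_one_le_re (Or.inl (chi_ne_one d hd)) hs.le
  have hG : logDeriv (fun s : ℂ => Gamma ((s + parity d) / 2)) s =
      digamma ((s + parity d) / 2) / 2 := by
    have := logDeriv_comp (f := Gamma) (g := fun s : ℂ => (s + parity d) / 2) (x := s)
      (differentiableAt_Gamma_of_re_pos hre) hlin.differentiableAt
    rw [hlin.deriv, ← digamma_def] at this
    rw [← mul_one_div, ← this]
    rfl
  have hcongr : logDeriv (completedL d) s = logDeriv (fun s : ℂ =>
      (d.1.natAbs : ℂ) ^ ((s + parity d) / 2) *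
      ((Real.pi : ℂ) ^ (-(s + parity d) / 2) * Gamma ((s + parity d) / 2)) *
        (chi d).LFunction s) s := by
    rw [logDeriv_apply, logDeriv_apply, hev.deriv_eq, hev.eq_of_nhds]
  have hlogd : ((Real.log (|(d.1 : ℝ)| / Real.pi) : ℝ) : ℂ) =
      Complex.log (d.1.natAbs : ℂ) - Complex.log Real.pi := by
    have h1 : |(d.1 : ℝ)| = (d.1.natAbs : ℝ) := by rw [Nat.cast_natAbs, Int.cast_abs]
    rw [h1, Real.log_div (Nat.cast_ne_zero.mpr (NeZero.ne _)) Real.pi_ne_zero, ofReal_sub,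
      ofReal_log (by positivity), ofReal_log Real.pi_pos.le, ofReal_natCast]
  rw [hcongr, logDeriv_mul (f := fun s : ℂ => (d.1.natAbs : ℂ) ^ ((s + parity d) / 2) *
      ((Real.pi : ℂ) ^ (-(s + parity d) / 2) * Gamma ((s + parity d) / 2)))
      (g := (chi d).LFunction) s (mul_ne_zero hN0 (mul_ne_zero hP0 hG0)) hL0
      (hN.differentiableAt.mul (hP.differentiableAt.mul hGd))
      (DirichletCharacter.differentiable_LFunction (chi_ne_one d hd) s),
    logDeriv_mul (f := fun s : ℂ => (d.1.natAbs : ℂ) ^ ((s + parity d) / 2))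
      (g := fun s : ℂ => (Real.pi : ℂ) ^ (-(s + parity d) / 2) * Gamma ((s + parity d) / 2)) s hN0
      (mul_ne_zero hP0 hG0) hN.differentiableAt (hP.differentiableAt.mul hGd),
    logDeriv_mul (f := fun s : ℂ => (Real.pi : ℂ) ^ (-(s + parity d) / 2))
      (g := fun s : ℂ => Gamma ((s + parity d) / 2)) s hP0 hG0 hP.differentiableAt hGd, hG,
    logDeriv_apply, logDeriv_apply, hN.deriv, hP.deriv, hlogd, mul_assoc, mul_assoc,
    mul_div_cancel_left₀ _ hN0, mul_div_cancel_left₀ _ hP0]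
  ring

/-- Λ₀ is a Mellin transform that converges everywhere, and t^{σ−1} ≤ t^{a−1} + t^{b−1} for a ≤ σ ≤
b. -/
theorem exists_norm_Λ₀_le (P : WeakFEPair ℂ) (a b : ℝ) :
    ∃ C : ℝ, ∀ s : ℂ, s.re ∈ Set.Icc a b → ‖P.Λ₀ s‖ ≤ C := by
  have hconv : ∀ s : ℂ, MellinConvergent P.f_modif s := fun s =>
    (P.isStrongFEPair_toStrongFEPair.hasMellin s).1
  refine ⟨∫ t in Set.Ioi (0 : ℝ), (‖(t : ℂ) ^ ((a : ℂ) - 1) • P.f_modif t‖ +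
    ‖(t : ℂ) ^ ((b : ℂ) - 1) • P.f_modif t‖), fun s hs => ?_⟩
  refine norm_integral_le_of_norm_le ((hconv a).norm.add (hconv b).norm)
    ((ae_restrict_iff' measurableSet_Ioi).mpr (Eventually.of_forall fun t ht => ?_))
  have ht0 : (0 : ℝ) < t := ht
  simp only [norm_smul, norm_cpow_eq_rpow_re_of_pos ht0, sub_re, ofReal_re, one_re]
  rw [← add_mul]
  gcongr
  rcases le_total t 1 with h | h
  · have := Real.rpow_le_rpow_of_exponent_ge ht0 h (by linarith [hs.1] : a - 1 ≤ s.re - 1)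
    linarith [Real.rpow_nonneg ht0.le (b - 1)]
  · have := Real.rpow_le_rpow_of_exponent_le h (by linarith [hs.2] : s.re - 1 ≤ b - 1)
    linarith [Real.rpow_nonneg ht0.le (a - 1)]

theorem exists_norm_completedHurwitzZetaEven₀_le (x : UnitAddCircle) (a b : ℝ) :
    ∃ C : ℝ, ∀ s : ℂ, s.re ∈ Set.Icc a b → ‖HurwitzZeta.completedHurwitzZetaEven₀ x s‖ ≤ C := by
  obtain ⟨C, hC⟩ := exists_norm_Λ₀_le (HurwitzZeta.hurwitzEvenFEPair x) (a / 2) (b / 2)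
  refine ⟨C, fun s hs => ?_⟩
  have h := hC (s / 2) (by
    have : (s / 2 : ℂ).re = s.re / 2 := by simp
    rw [this]
    constructor <;> linarith [hs.1, hs.2])
  rw [HurwitzZeta.completedHurwitzZetaEven₀, norm_div, Complex.norm_ofNat]
  linarith [norm_nonneg ((HurwitzZeta.hurwitzEvenFEPair x).Λ₀ (s / 2))]

theorem exists_norm_completedHurwitzZetaOdd_le (x : UnitAddCircle) (a b : ℝ) :
    ∃ C : ℝ, ∀ s : ℂ, s.re ∈ Set.Icc a b → ‖HurwitzZeta.completedHurwitzZetaOdd x s‖ ≤ C := by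
  obtain ⟨C, hC⟩ := exists_norm_Λ₀_le (HurwitzZeta.hurwitzOddFEPair x) ((a + 1) / 2) ((b + 1) / 2)
  refine ⟨C, fun s hs => ?_⟩
  have h := hC ((s + 1) / 2) (by
    have : ((s + 1) / 2 : ℂ).re = (s.re + 1) / 2 := by simp
    rw [this]
    constructor <;> linarith [hs.1, hs.2])
  have hP := HurwitzZeta.isStrong_hurwitzOddFEPair x
  -- The odd pair has no constant terms, so Λ and Λ₀ coincide.
  rw [WeakFEPair.Λ₀_eq, hP.hf₀, hP.hg₀, smul_zero, smul_zero, add_zero, add_zero] at h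
  rw [HurwitzZeta.completedHurwitzZetaOdd, norm_div, Complex.norm_ofNat]
  linarith [norm_nonneg ((HurwitzZeta.hurwitzOddFEPair x).Λ ((s + 1) / 2))]

theorem exists_norm_natCast_cpow_le (N : ℕ) [NeZero N] {h : ℂ → ℂ} {M : ℝ} {S : Set ℂ}
    (hh : ∀ s ∈ S, (h s).re ≤ M) : ∃ C : ℝ, ∀ s ∈ S, ‖(N : ℂ) ^ h s‖ ≤ C := by
  refine ⟨(N : ℝ) ^ M, fun s hs => ?_⟩
  have hN : 0 < N := Nat.pos_of_ne_zero (NeZero.ne N)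
  rw [norm_natCast_cpow_of_pos hN]
  exact Real.rpow_le_rpow_of_exponent_le (by exact_mod_cast hN) (hh s hs)

/-- Since χ_d(0) = 0 and ∑ χ_d(j) = 0, the polar terms cancel, and Λ is a finite combination of
Hurwitz functions bounded in the strip. -/
theorem exists_norm_completedL_le_of_strip (hd : d.1 ≠ 1) (a b : ℝ) :
    ∃ C : ℝ, ∀ s : ℂ, s.re ∈ Set.Icc a b → ‖completedL d s‖ ≤ C := by
  have hχ := chi_ne_one d hd
  have hN1 : d.1.natAbs ≠ 1 := fun h => hχ (DirichletCharacter.level_one' _ h)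
  have heq : ∀ s, (chi d).completedLFunction s = ZMod.completedLFunction₀ (chi d) s := by
    intro s
    rw [DirichletCharacter.completedLFunction, ZMod.completedLFunction_eq,
      (chi d).map_zero' hN1, MulChar.sum_eq_zero_of_ne_one hχ]
    simp
  choose C₁ hC₁ using fun x : UnitAddCircle => exists_norm_completedHurwitzZetaEven₀_le x a b
  choose C₂ hC₂ using fun x : UnitAddCircle => exists_norm_completedHurwitzZetaOdd_le x a b
  obtain ⟨C₃, hC₃⟩ := exists_norm_natCast_cpow_le d.1.natAbs (h := fun s => (s + parity d) / 2)
    (M := (b + parity d) / 2) (S := {s | s.re ∈ Set.Icc a b}) (by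
      intro s hs
      have : ((s + parity d) / 2 : ℂ).re = (s.re + parity d) / 2 := by simp
      rw [this]
      have := hs.2
      gcongr)
  obtain ⟨C₄, hC₄⟩ := exists_norm_natCast_cpow_le d.1.natAbs (h := fun s => -s)
    (M := -a) (S := {s | s.re ∈ Set.Icc a b}) (by
      intro s hs
      simpa using hs.1)
  have hS₁ : ∀ s : ℂ, s.re ∈ Set.Icc a b → ‖∑ j : ZMod d.1.natAbs,
      chi d j * HurwitzZeta.completedHurwitzZetaEven₀ (ZMod.toAddCircle j) s‖ ≤
      ∑ j : ZMod d.1.natAbs, C₁ (ZMod.toAddCircle j) := by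
    intro s hs
    refine norm_sum_le_of_le _ fun j _ => ?_
    rw [norm_mul]
    exact (mul_le_of_le_one_left (norm_nonneg _) ((chi d).norm_le_one j)).trans (hC₁ _ s hs)
  have hS₂ : ∀ s : ℂ, s.re ∈ Set.Icc a b → ‖∑ j : ZMod d.1.natAbs,
      chi d j * HurwitzZeta.completedHurwitzZetaOdd (ZMod.toAddCircle j) s‖ ≤
      ∑ j : ZMod d.1.natAbs, C₂ (ZMod.toAddCircle j) := by
    intro s hs
    refine norm_sum_le_of_le _ fun j _ => ?_
    rw [norm_mul]
    exact (mul_le_of_le_one_left (norm_nonneg _) ((chi d).norm_le_one j)).trans (hC₂ _ s hs)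
  refine ⟨C₃ * (C₄ * (∑ j : ZMod d.1.natAbs, C₁ (ZMod.toAddCircle j)) +
    C₄ * ∑ j : ZMod d.1.natAbs, C₂ (ZMod.toAddCircle j)), fun s hs => ?_⟩
  have hC3 := hC₃ s hs
  have hC4 := hC₄ s hs
  have h30 := (norm_nonneg _).trans hC3
  have h40 := (norm_nonneg _).trans hC4
  rw [completedL, heq, ZMod.completedLFunction₀, norm_mul]
  refine mul_le_mul hC3 ((norm_add_le _ _).trans ?_) (norm_nonneg _) h30
  rw [norm_mul, norm_mul]
  exact add_le_add (mul_le_mul hC4 (hS₁ s hs) (norm_nonneg _) h40)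
    (mul_le_mul hC4 (hS₂ s hs) (norm_nonneg _) h40)

theorem Gamma_le_exp_rpow {x : ℝ} (hx : 1 ≤ x) :
    Real.Gamma x ≤ Real.exp (2 * (2 * x) ^ (3 / 2 : ℝ)) := by
  have hx0 : 0 < x := by linarith
  set n := ⌈x⌉₊ with hn
  have hxn : x ≤ n := Nat.le_ceil x
  have hn1 : (1 : ℝ) ≤ n := hx.trans hxn
  have hn2 : (n : ℝ) ≤ 2 * x := by
    have := Nat.ceil_lt_add_one hx0.le
    linarith
  -- Γ is not monotone on all of [1, ∞); the shift moves the argument to [2, ∞), where it is.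
  have h1 : Real.Gamma x ≤ Real.Gamma (x + 1) := by
    rw [Real.Gamma_add_one hx0.ne']
    exact le_mul_of_one_le_left (Real.Gamma_pos_of_pos hx0).le hx
  have h2 : Real.Gamma (x + 1) ≤ Real.Gamma (n + 1) :=
    Real.Gamma_strictMonoOn_Ici.monotoneOn (by simp; linarith) (by simp; linarith) (by linarith)
  rw [Real.Gamma_nat_eq_factorial] at h2
  have h3 : (n.factorial : ℝ) ≤ (n : ℝ) ^ n := by exact_mod_cast Nat.factorial_le_pow n
  have h4 : (n : ℝ) ^ n = Real.exp (n * Real.log n) := by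
    rw [← Real.rpow_natCast, Real.rpow_def_of_pos (by linarith), mul_comm]
  rw [h4] at h3
  refine (h1.trans (h2.trans h3)).trans (Real.exp_le_exp.mpr ?_)
  have h5 : Real.log n ≤ 2 * (2 * x) ^ (1 / 2 : ℝ) := by
    have h6 : Real.log n ≤ Real.log (2 * x) := Real.log_le_log (by linarith) hn2
    have h7 := Real.log_le_rpow_div (x := 2 * x) (by linarith) (ε := 1 / 2) (by norm_num)
    linarith
  calc (n : ℝ) * Real.log n ≤ (2 * x) * (2 * (2 * x) ^ (1 / 2 : ℝ)) :=
        mul_le_mul hn2 h5 (Real.log_nonneg hn1) (by linarith)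
    _ = 2 * ((2 * x) ^ (1 : ℝ) * (2 * x) ^ (1 / 2 : ℝ)) := by rw [Real.rpow_one]; ring
    _ = 2 * (2 * x) ^ (3 / 2 : ℝ) := by
        rw [← Real.rpow_add (by linarith)]; norm_num

theorem exists_norm_LFunction_le {N : ℕ} [NeZero N] (χ : DirichletCharacter ℂ N) :
    ∃ C : ℝ, 0 ≤ C ∧ ∀ s : ℂ, 2 ≤ s.re → ‖χ.LFunction s‖ ≤ C := by
  have hsum : LSeriesSummable (χ ·) 2 := χ.LSeriesSummable_of_one_lt_re (by norm_num)
  refine ⟨∑' n, ‖LSeries.term (χ ·) 2 n‖, tsum_nonneg fun _ => norm_nonneg _, fun s hs => ?_⟩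
  rw [χ.LFunction_eq_LSeries (by linarith), LSeries]
  exact tsum_of_norm_bounded hsum.norm.hasSum
    fun n => LSeries.norm_term_le_of_re_le_re _ (by simpa using hs) n

theorem exists_norm_completedL_le_of_two_le_re (d : FundamentalDiscriminant) :
    ∃ K B : ℝ, 0 ≤ K ∧ 0 ≤ B ∧ ∀ R : ℝ, 1 ≤ R → ∀ s : ℂ, 2 ≤ s.re → ‖s - 2‖ ≤ R →
      ‖completedL d s‖ ≤ K * Real.exp (B * R ^ (3 / 2 : ℝ)) := by
  obtain ⟨K, hK0, hK⟩ := exists_norm_LFunction_le (chi d)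
  have hN : 0 < d.1.natAbs := Nat.pos_of_ne_zero (NeZero.ne _)
  have hN1 : (1 : ℝ) ≤ d.1.natAbs := by exact_mod_cast hN
  have hlog : 0 ≤ Real.log d.1.natAbs := Real.log_nonneg hN1
  refine ⟨K, 2 * Real.log d.1.natAbs + 16, hK0, by positivity, fun R hR s hs hsR => ?_⟩
  have ha : (parity d : ℝ) ≤ 1 := by exact_mod_cast parity_le_one d
  have ha0 : (0 : ℝ) ≤ parity d := Nat.cast_nonneg _
  have hσ : s.re ≤ 2 + R := by
    have := (re_le_norm (s - 2)).trans hsR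
    simp at this
    linarith
  have hre : ((s + parity d) / 2 : ℂ).re = (s.re + parity d) / 2 := by simp
  have hre' : (-(s + parity d) / 2 : ℂ).re = -((s.re + parity d) / 2) := by simp; ring
  have hR32 : R ≤ R ^ (3 / 2 : ℝ) := by
    simpa using Real.rpow_le_rpow_of_exponent_le hR (by norm_num : (1 : ℝ) ≤ 3 / 2)
  have h1 : ‖(d.1.natAbs : ℂ) ^ ((s + parity d) / 2)‖ ≤
      Real.exp (2 * Real.log d.1.natAbs * R ^ (3 / 2 : ℝ)) := by
    rw [norm_natCast_cpow_of_pos hN, hre, Real.rpow_def_of_pos (by linarith), Real.exp_le_exp]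
    have : (s.re + parity d) / 2 ≤ 2 * R ^ (3 / 2 : ℝ) := by linarith
    nlinarith
  have h2 : ‖(Real.pi : ℂ) ^ (-(s + parity d) / 2)‖ ≤ 1 := by
    rw [norm_cpow_eq_rpow_re_of_pos Real.pi_pos, hre']
    exact Real.rpow_le_one_of_one_le_of_nonpos (by linarith [Real.pi_gt_three]) (by linarith)
  have h3 : ‖Gamma ((s + parity d) / 2)‖ ≤ Real.exp (16 * R ^ (3 / 2 : ℝ)) := by
    refine (norm_Gamma_le (by rw [hre]; linarith)).trans ?_
    rw [hre]
    refine (Gamma_le_exp_rpow (by linarith)).trans (Real.exp_le_exp.mpr ?_)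
    have h4 : (2 * ((s.re + parity d) / 2)) ^ (3 / 2 : ℝ) ≤ (4 * R) ^ (3 / 2 : ℝ) :=
      Real.rpow_le_rpow (by linarith) (by linarith) (by norm_num)
    have h5 : (4 * R) ^ (3 / 2 : ℝ) = 8 * R ^ (3 / 2 : ℝ) := by
      rw [Real.mul_rpow (by norm_num) (by linarith), show (4 : ℝ) = 2 ^ (2 : ℝ) by norm_num,
        ← Real.rpow_mul (by norm_num)]
      norm_num
    linarith
  rw [completedL_of_re_pos d (by linarith), norm_mul, norm_mul, norm_mul]
  calc _ ≤ Real.exp (2 * Real.log d.1.natAbs * R ^ (3 / 2 : ℝ)) *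
        (1 * Real.exp (16 * R ^ (3 / 2 : ℝ))) * K := by
        gcongr
        exact hK s hs
    _ = _ := by rw [add_mul, Real.exp_add]; ring

/-- The completed `L`-function has order at most `3 / 2`. -/
theorem exists_norm_completedL_le (hd : d.1 ≠ 1) :
    ∃ B : ℝ, 0 < B ∧ ∀ R : ℝ, 1 ≤ R → ∀ s : ℂ, ‖s - 2‖ ≤ R →
      ‖completedL d s‖ ≤ Real.exp (B * R ^ (3 / 2 : ℝ)) := by
  obtain ⟨K, B, hK, hB, h⟩ := exists_norm_completedL_le_of_two_le_re d
  obtain ⟨C, hC⟩ := exists_norm_completedL_le_of_strip hd (-1) 2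
  set w := ‖(chi d).rootNumber‖ with hw
  have hw0 : 0 ≤ w := norm_nonneg _
  refine ⟨K + |C| + w * K + 8 * B + 1, by positivity, fun R hR s hs => ?_⟩
  have hR1 : 1 ≤ R ^ (3 / 2 : ℝ) := Real.one_le_rpow hR (by norm_num)
  have hle : ∀ x y : ℝ, 0 ≤ x → 0 ≤ y → x + y ≤ K + |C| + w * K + 8 * B + 1 →
      x * Real.exp (y * R ^ (3 / 2 : ℝ)) ≤
        Real.exp ((K + |C| + w * K + 8 * B + 1) * R ^ (3 / 2 : ℝ)) := by
    intro x y hx hy hxy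
    have h1 : x ≤ Real.exp (x * R ^ (3 / 2 : ℝ)) := by
      have h2 := Real.add_one_le_exp (x * R ^ (3 / 2 : ℝ))
      have h3 : x * 1 ≤ x * R ^ (3 / 2 : ℝ) := by gcongr
      linarith
    calc x * Real.exp (y * R ^ (3 / 2 : ℝ)) ≤
          Real.exp (x * R ^ (3 / 2 : ℝ)) * Real.exp (y * R ^ (3 / 2 : ℝ)) := by gcongr
      _ = Real.exp ((x + y) * R ^ (3 / 2 : ℝ)) := by rw [← Real.exp_add, add_mul]
      _ ≤ _ := by gcongr
  have hwK : 0 ≤ w * K := by positivity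
  rcases le_total 2 s.re with h2 | h2
  · exact (h R hR s h2 hs).trans (hle K B hK hB (by linarith [abs_nonneg C]))
  rcases le_total (-1) s.re with h3 | h3
  · refine (hC s ⟨h3, h2⟩).trans ((le_abs_self C).trans ?_)
    simpa using hle |C| 0 (abs_nonneg C) le_rfl (by linarith)
  · have e := completedL_one_sub d (1 - s)
    rw [sub_sub_cancel] at e
    -- To the left of the strip the functional equation reflects s to 1 − s, which lies within R + 3
    -- ≤ 4R of 2; this explains the factor 4^{3/2} = 8.
    have h4 := h (4 * R) (by linarith) (1 - s) (by simp; linarith) (by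
      have : (1 : ℂ) - s - 2 = -((s - 2) + 3) := by ring
      rw [this, norm_neg]
      refine (norm_add_le _ _).trans ?_
      simp
      linarith)
    have h5 : (4 * R) ^ (3 / 2 : ℝ) = 8 * R ^ (3 / 2 : ℝ) := by
      rw [Real.mul_rpow (by norm_num) (by linarith), show (4 : ℝ) = 2 ^ (2 : ℝ) by norm_num,
        ← Real.rpow_mul (by norm_num)]
      norm_num
    rw [h5] at h4
    rw [e, norm_mul, ← hw]
    calc w * ‖completedL d (1 - s)‖ ≤ w * (K * Real.exp (B * (8 * R ^ (3 / 2 : ℝ)))) := by gcongr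
      _ = w * K * Real.exp (8 * B * R ^ (3 / 2 : ℝ)) := by ring_nf
      _ ≤ _ := hle (w * K) (8 * B) hwK (by positivity) (by linarith [abs_nonneg C])

end CompletedLFunction

/-! ### From Hadamard's expansion to the sum over zeros. -/

section ZeroSum

variable {f : ℂ → ℂ}

theorem countable_zeros (hf : Differentiable ℂ f) {z₀ : ℂ} (hz₀ : f z₀ ≠ 0) :
    Countable {z // f z = 0} := by
  rw [← Set.countable_univ_iff]
  refine Set.Countable.mono (fun ρ _ => ?_)
    (Set.countable_iUnion fun n : ℕ => (finite_zeros_norm_sub_le hf hz₀ n).countable)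
  obtain ⟨n, hn⟩ := exists_nat_ge ‖(ρ : ℂ) - z₀‖
  exact Set.mem_iUnion.mpr ⟨n, hn⟩

theorem one_add_norm_sub_two_le {z ρ : ℂ} (h : 1 ≤ ‖z - ρ‖) :
    1 + ‖ρ - 2‖ ≤ (2 + ‖z - 2‖) * ‖z - ρ‖ := by
  have h1 : ‖ρ - 2‖ ≤ ‖z - ρ‖ + ‖z - 2‖ := by
    rw [norm_sub_rev z ρ]; exact norm_sub_le_norm_sub_add_norm_sub _ _ _
  nlinarith [norm_nonneg (z - 2)]

/-- The zeros lie in 0 < Re ρ < 1, so both lines and the point 2 are at distance at least 1 from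
every ρ. This makes the comparison constants explicit in t, hence integrable against Φ. -/
theorem norm_one_div_sub_one_div_two_le {ρ : ℂ} (hρ0 : 0 < ρ.re) (hρ1 : ρ.re < 1) {x : ℝ}
    (hx : x = 2 ∨ x = -1) (t : ℝ) :
    ‖1 / (x + t * I - ρ) - 1 / (2 - ρ)‖ ≤ 80 * (1 + t ^ 2) / (1 + ‖ρ - 2‖) ^ 2 := by
  have h1 : 1 ≤ ‖(x : ℂ) + t * I - ρ‖ := by
    refine le_trans ?_ (abs_re_le_norm _)
    simp only [sub_re, add_re, ofReal_re, mul_re, I_re, mul_zero, ofReal_im, I_im, mul_one,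
      sub_self, add_zero]
    rcases hx with rfl | rfl
    · exact le_trans (by linarith) (le_abs_self _)
    · exact le_trans (by linarith) (neg_le_abs _)
  have h2 : 1 ≤ ‖(2 : ℂ) - ρ‖ := by
    refine le_trans ?_ (re_le_norm _)
    simp; linarith
  have h3 := norm_one_div_sub_one_div_le (one_add_norm_sub_two_le h1) (one_add_norm_sub_two_le h2)
  refine h3.trans ?_
  have h4 : ‖(x : ℂ) + t * I - 2‖ ≤ 3 + |t| := by
    refine (norm_le_abs_re_add_abs_im _).trans ?_
    simp only [sub_re, add_re, ofReal_re, mul_re, I_re, mul_zero, ofReal_im, I_im, mul_one,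
      sub_self, add_zero, sub_im, add_im, mul_im, zero_add, re_ofNat, im_ofNat, sub_zero]
    gcongr
    rcases hx with rfl | rfl <;> norm_num
  refine div_le_div_of_nonneg_right ?_ (by positivity)
  rw [sub_self, norm_zero, add_zero]
  have h5 : ‖(x : ℂ) + t * I - 2‖ * ((2 + ‖(x : ℂ) + t * I - 2‖) * 2) ≤
      (3 + |t|) * ((2 + (3 + |t|)) * 2) := by gcongr
  refine h5.trans ?_
  rw [← sq_abs t]
  nlinarith [sq_nonneg (|t| - 1), abs_nonneg t]

theorem inv_one_add_sq_le_one (t : ℝ) : (1 + t ^ 2)⁻¹ ≤ 1 :=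
  inv_le_one_of_one_le₀ (by nlinarith)

/-- The sum of a test function over the zeros of an entire function, as a difference of two
integrals along vertical lines. -/
theorem hasSum_order_mul (hf : Differentiable ℂ f) {B : ℝ} (hB : 0 < B)
    (hgrow : ∀ R : ℝ, 1 ≤ R → ∀ z, ‖z - 2‖ ≤ R → ‖f z‖ ≤ Real.exp (B * R ^ (3 / 2 : ℝ)))
    (hzeros : ∀ z, f z = 0 → 0 < z.re ∧ z.re < 1) {Φ : ℂ → ℂ} (hΦ : Differentiable ℂ Φ) {C : ℝ}
    (hC : 0 ≤ C) (hb : ∀ s : ℂ, s.re ∈ Set.Icc (-1 : ℝ) 2 → ‖Φ s‖ ≤ C * ((1 + s.im ^ 2)⁻¹) ^ 3) :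
    HasSum (fun ρ : {z // f z = 0} => 2 * Real.pi * ((analyticOrderNatAt f ρ : ℂ) * Φ ρ))
      ((∫ t : ℝ, Φ ((2 : ℝ) + t * I) * logDeriv f ((2 : ℝ) + t * I)) -
        ∫ t : ℝ, Φ ((-1 : ℝ) + t * I) * logDeriv f ((-1 : ℝ) + t * I)) := by
  have hne : ∀ z : ℂ, z.re ∉ Set.Ioo (0 : ℝ) 1 → f z ≠ 0 := fun z hz h => hz (hzeros z h)
  have hz₀ : f 2 ≠ 0 := hne 2 (by simp)
  have := countable_zeros hf hz₀
  have hsq := summable_order_div_sq hf hz₀ hB hgrow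
  have hb1 : ∀ s : ℂ, s.re ∈ Set.Icc (-1 : ℝ) 2 → ‖Φ s‖ ≤ C * (1 + s.im ^ 2)⁻¹ := by
    intro s hs
    refine (hb s hs).trans (mul_le_mul_of_nonneg_left ?_ hC)
    exact pow_le_of_le_one (by positivity) (inv_one_add_sq_le_one _) (by norm_num)
  have hΦint : ∀ x ∈ Set.Icc (-1 : ℝ) 2, Integrable fun t : ℝ => Φ (x + t * I) := fun x hx =>
    integrable_vertical_line hx (fun s _ => hΦ.continuous.continuousAt) hb1
  -- On each line Hadamard's expansion is integrated against Φ term by term; the norms are dominated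
  -- by a summable factor in ρ times the integrable (1 + t²)^{-1}.
  have key : ∀ x : ℝ, x = 2 ∨ x = -1 →
      Integrable (fun t : ℝ => Φ (x + t * I) * logDeriv f (x + t * I)) ∧
      HasSum (fun ρ : {z // f z = 0} => (analyticOrderNatAt f ρ : ℂ) *
        ((∫ t : ℝ, Φ (x + t * I) / (x + t * I - ρ)) - (∫ t : ℝ, Φ (x + t * I)) / (2 - ρ)))
        ((∫ t : ℝ, Φ (x + t * I) * logDeriv f (x + t * I)) -
          (∫ t : ℝ, Φ (x + t * I)) * logDeriv f 2) := by
    intro x hx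
    have hxI : x ∈ Set.Icc (-1 : ℝ) 2 := by rcases hx with rfl | rfl <;> norm_num
    have hxre : ∀ t : ℝ, ((x : ℂ) + t * I).re ∉ Set.Ioo (0 : ℝ) 1 := by
      intro t
      simp
      rcases hx with rfl | rfl <;> norm_num
    have hfx : ∀ t : ℝ, f (x + t * I) ≠ 0 := fun t => hne _ (hxre t)
    have hρx : ∀ (ρ : {z // f z = 0}) (t : ℝ), (x : ℂ) + t * I - ρ ≠ 0 := fun ρ t h =>
      hfx t (by rw [sub_eq_zero.mp h]; exact ρ.2)
    have hbx : ∀ t : ℝ, ‖Φ (x + t * I)‖ ≤ C * ((1 + t ^ 2)⁻¹) ^ 3 := fun t => by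
      simpa using hb (x + t * I) (by simpa using hxI)
    set F : {z // f z = 0} → ℝ → ℂ := fun ρ t =>
      Φ (x + t * I) * ((analyticOrderNatAt f ρ : ℂ) * (1 / (x + t * I - ρ) - 1 / (2 - ρ))) with hF
    have hFb : ∀ ρ t, ‖F ρ t‖ ≤ (analyticOrderNatAt f ρ : ℝ) / (1 + ‖(ρ : ℂ) - 2‖) ^ 2 *
        (80 * C) * (1 + t ^ 2)⁻¹ := by
      intro ρ t
      have h1 := norm_one_div_sub_one_div_two_le (hzeros ρ ρ.2).1 (hzeros ρ ρ.2).2 hx t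
      have h2 : (1 + t ^ 2)⁻¹ ^ 3 * (1 + t ^ 2) ≤ (1 + t ^ 2)⁻¹ := by
        have h3 : (1 + t ^ 2)⁻¹ ^ 3 * (1 + t ^ 2) = (1 + t ^ 2)⁻¹ * (1 + t ^ 2)⁻¹ := by
          field_simp
        rw [h3]
        exact mul_le_of_le_one_left (by positivity) (inv_one_add_sq_le_one t)
      calc ‖F ρ t‖ = ‖Φ (x + t * I)‖ * ((analyticOrderNatAt f ρ : ℝ) *
            ‖1 / (x + t * I - ρ) - 1 / (2 - (ρ : ℂ))‖) := by
            simp only [hF, norm_mul, Complex.norm_natCast]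
        _ ≤ (C * ((1 + t ^ 2)⁻¹) ^ 3) * ((analyticOrderNatAt f ρ : ℝ) *
            (80 * (1 + t ^ 2) / (1 + ‖(ρ : ℂ) - 2‖) ^ 2)) := by
            gcongr
            exact hbx t
        _ = (analyticOrderNatAt f ρ : ℝ) / (1 + ‖(ρ : ℂ) - 2‖) ^ 2 * (80 * C) *
            ((1 + t ^ 2)⁻¹ ^ 3 * (1 + t ^ 2)) := by ring
        _ ≤ _ := by gcongr
    have hΦc : Continuous fun t : ℝ => Φ (x + t * I) := hΦ.continuous.comp (by fun_prop)
    have hFi : ∀ ρ, Integrable (F ρ) := by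
      intro ρ
      refine (integrable_inv_one_add_sq.const_mul _).mono' ?_ (Eventually.of_forall (hFb ρ))
      have : Continuous (F ρ) := hΦc.mul (continuous_const.mul
        ((Continuous.div continuous_const (by fun_prop) (hρx ρ)).sub continuous_const))
      exact this.aestronglyMeasurable
    have hsum : Summable fun ρ => ∫ t : ℝ, ‖F ρ t‖ := by
      refine Summable.of_nonneg_of_le (fun ρ => integral_nonneg fun _ => norm_nonneg _)
        (fun ρ => ?_) ((hsq.mul_right (80 * C)).mul_right Real.pi)
      rw [← integral_univ_inv_one_add_sq, ← integral_const_mul]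
      exact integral_mono (hFi ρ).norm (integrable_inv_one_add_sq.const_mul _) (hFb ρ)
    have hpt : ∀ t : ℝ, HasSum (fun ρ => F ρ t)
        (Φ (x + t * I) * (logDeriv f (x + t * I) - logDeriv f 2)) := fun t =>
      (hasSum_logDeriv_sub_logDeriv hf hz₀ hB hgrow (hfx t)).mul_left _
    have hmain := hasSum_integral_of_summable_integral_norm hFi hsum
    have htsum : ∀ t : ℝ, ∑' ρ, F ρ t =
        Φ (x + t * I) * (logDeriv f (x + t * I) - logDeriv f 2) := fun t => (hpt t).tsum_eq
    simp_rw [htsum] at hmain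
    have hLc : Continuous fun t : ℝ => logDeriv f (x + t * I) := by
      have h1 : Continuous fun t : ℝ => deriv f (x + t * I) :=
        hf.deriv.continuous.comp (by fun_prop)
      exact h1.div (hf.continuous.comp (by fun_prop)) hfx
    have hdiffi : Integrable fun t : ℝ =>
        Φ (x + t * I) * (logDeriv f (x + t * I) - logDeriv f 2) := by
      refine (integrable_inv_one_add_sq.const_mul (∑' ρ : {z // f z = 0},
        (analyticOrderNatAt f ρ : ℝ) / (1 + ‖(ρ : ℂ) - 2‖) ^ 2 * (80 * C))).mono'
        (hΦc.mul (hLc.sub continuous_const)).aestronglyMeasurable (Eventually.of_forall fun t => ?_)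
      rw [← htsum t]
      exact tsum_of_norm_bounded ((hsq.mul_right (80 * C)).hasSum.mul_right _) (fun ρ => hFb ρ t)
    have hΦi := hΦint x hxI
    have hLi : Integrable fun t : ℝ => Φ (x + t * I) * logDeriv f (x + t * I) := by
      refine (hdiffi.add (hΦi.mul_const (logDeriv f 2))).congr (Eventually.of_forall fun t => ?_)
      simp only [Pi.add_apply]
      ring
    refine ⟨hLi, ?_⟩
    have hR : ∫ t : ℝ, Φ (x + t * I) * (logDeriv f (x + t * I) - logDeriv f 2) =
        (∫ t : ℝ, Φ (x + t * I) * logDeriv f (x + t * I)) -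
          (∫ t : ℝ, Φ (x + t * I)) * logDeriv f 2 := by
      rw [← integral_mul_const, ← integral_sub hLi (hΦi.mul_const _)]
      congr 1
      ext t
      ring
    rw [hR] at hmain
    refine hmain.congr_fun fun ρ => ?_
    have hdivi : Integrable fun t : ℝ => Φ (x + t * I) / (x + t * I - ρ) := by
      refine hΦi.norm.mono' (hΦc.div (by fun_prop) (hρx ρ)).aestronglyMeasurable
        (Eventually.of_forall fun t => ?_)
      rw [norm_div]
      refine div_le_self (norm_nonneg _) ?_
      refine le_trans ?_ (abs_re_le_norm _)
      have := hzeros ρ ρ.2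
      simp only [sub_re, add_re, ofReal_re, mul_re, I_re, mul_zero, ofReal_im, I_im, mul_one,
        sub_self, add_zero]
      rcases hx with rfl | rfl
      · exact le_trans (by linarith) (le_abs_self _)
      · exact le_trans (by linarith) (neg_le_abs _)
    rw [← integral_div, ← integral_sub hdivi (hΦi.div_const _), ← integral_const_mul]
    congr 1
    ext t
    simp only [hF]
    ring
  have h2 := (key 2 (Or.inl rfl)).2
  have h1 := (key (-1) (Or.inr rfl)).2
  -- The integral of Φ is the same on both lines, so the terms with 1/(2 − ρ) and the logarithmic
  -- derivative at 2 cancel in the difference, leaving the residue 2πΦ(ρ).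
  have hshift := integral_vertical_line_eq (a := -1) (b := 2) (by norm_num)
    (fun s _ => hΦ s) hb1
  convert! h2.sub h1 using 1
  · ext ρ
    have hres := integral_vertical_line_div_sub hΦ hb1 (ρ := ρ)
      (by linarith [(hzeros ρ ρ.2).1]) (by linarith [(hzeros ρ ρ.2).2])
    rw [hshift]
    linear_combination -(analyticOrderNatAt f ρ : ℂ) * hres
  · rw [hshift]
    ring

end ZeroSum

/-! ### The test function in the variable s. -/

section TestFunction

/-- The test function in the variable `s = 1/2 + iγ`. -/
noncomputable def testFunction (g : 𝓢(ℝ, ℂ)) (X : ℝ) (s : ℂ) : ℂ :=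
  complexExtension g ((s - 1 / 2) / I * (Real.log X / (2 * Real.pi) : ℝ))

variable {g : 𝓢(ℝ, ℂ)} {X : ℝ}

theorem differentiable_testFunction (hs : HasCompactSupport (𝓕 (g : ℝ → ℂ))) :
    Differentiable ℂ (testFunction g X) := by
  have h : Differentiable ℂ (complexExtension g) :=
    differentiable_laplace (contDiff_fourier g).continuous hs
  exact h.comp (by fun_prop)

theorem testFunction_one_sub (hg : ∀ x : ℝ, g (-x) = g x) (s : ℂ) :
    testFunction g X (1 - s) = testFunction g X s := by
  rw [testFunction, testFunction, ← complexExtension_neg hg]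
  congr 1
  ring

theorem testFunction_half_add (γ : ℂ) :
    testFunction g X (1 / 2 + I * γ) =
      complexExtension g (γ * (Real.log X / (2 * Real.pi) : ℝ)) := by
  rw [testFunction]
  congr 2
  rw [add_sub_cancel_left, mul_div_cancel_left₀ _ I_ne_zero]

theorem testFunction_critical_line (t : ℝ) :
    testFunction g X ((1 / 2 : ℝ) + t * I) = g (t * (Real.log X / (2 * Real.pi))) := by
  have h := testFunction_half_add (g := g) (X := X) t
  rw [mul_comm I, ← ofReal_mul, complexExtension_ofReal] at h
  rw [← h]
  congr 1
  push_cast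
  ring

theorem exists_norm_testFunction_le (hs : HasCompactSupport (𝓕 (g : ℝ → ℂ))) (hX : 1 < X) :
    ∃ C : ℝ, 0 ≤ C ∧ ∀ s : ℂ, s.re ∈ Set.Icc (-1 : ℝ) 2 →
      ‖testFunction g X s‖ ≤ C * ((1 + s.im ^ 2)⁻¹) ^ 3 := by
  set c : ℝ := Real.log X / (2 * Real.pi) with hc
  have hc0 : 0 < c := div_pos (Real.log_pos hX) (by positivity)
  -- The strip −1 ≤ Re s ≤ 2 extends 3/2 to either side of the critical line, and the rotation and
  -- scaling turn this into |Im z| ≤ 3c/2.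
  obtain ⟨C, hC0, hC⟩ := exists_norm_laplace_le (contDiff_fourier g) hs (3 / 2 * c)
  refine ⟨C * (1 + (c ^ 2)⁻¹) ^ 3, by positivity, fun s hs => ?_⟩
  have hdiv : (s - 1 / 2) / I * (c : ℂ) = ((s.im * c : ℝ) : ℂ) + (-((s.re - 1 / 2) * c) : ℝ) * I := by
    rw [div_I]
    apply Complex.ext <;> simp
  have hre : ((s - 1 / 2) / I * (c : ℂ)).re = s.im * c := by rw [hdiv]; simp
  have him : ((s - 1 / 2) / I * (c : ℂ)).im = -((s.re - 1 / 2) * c) := by rw [hdiv]; simp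
  have h := hC ((s - 1 / 2) / I * (c : ℂ)) (by
    rw [him, abs_neg, abs_mul, abs_of_pos hc0]
    gcongr
    rw [abs_le]
    constructor <;> linarith [hs.1, hs.2])
  rw [hre] at h
  refine h.trans ?_
  rw [mul_assoc, ← mul_pow]
  gcongr
  rw [inv_eq_one_div, ← div_eq_mul_inv, div_le_div_iff₀ (by positivity) (by positivity)]
  have : (1 + (c ^ 2)⁻¹) * (1 + (s.im * c) ^ 2) = 1 + s.im ^ 2 + (c ^ 2)⁻¹ + (s.im * c) ^ 2 := by
    field_simp
    ring
  rw [this]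
  have h1 : 0 ≤ (c ^ 2)⁻¹ := by positivity
  have h2 : 0 ≤ (s.im * c) ^ 2 := by positivity
  linarith

end TestFunction

/-! ### The conductor and Gamma contribution. -/

section GammaPart

variable {g : 𝓢(ℝ, ℂ)} {X : ℝ} {d : FundamentalDiscriminant}

/-- The logarithmic derivative of the archimedean factor and the conductor. -/
noncomputable def archimedeanTerm (d : FundamentalDiscriminant) (s : ℂ) : ℂ :=
  ((Real.log (|(d.1 : ℝ)| / Real.pi) : ℝ) : ℂ) / 2 + digamma ((s + parity d) / 2) / 2

theorem re_add_parity_div_two (d : FundamentalDiscriminant) (s : ℂ) :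
    ((s + parity d) / 2 : ℂ).re = (s.re + parity d) / 2 := by simp

theorem differentiableAt_archimedeanTerm {s : ℂ} (hs : 0 < s.re) :
    DifferentiableAt ℂ (archimedeanTerm d) s := by
  have h : DifferentiableAt ℂ (fun s : ℂ => digamma ((s + parity d) / 2)) s :=
    DifferentiableAt.comp (g := digamma) s
      (differentiableAt_digamma_of_re_pos (by rw [re_add_parity_div_two]; positivity))
      (by fun_prop)
  exact (differentiableAt_const _).add (h.div_const 2)

theorem exists_norm_archimedeanTerm_le (d : FundamentalDiscriminant) : ∃ C : ℝ, 0 ≤ C ∧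
    ∀ s : ℂ, s.re ∈ Set.Icc (1 / 2 : ℝ) 2 → ‖archimedeanTerm d s‖ ≤ C * (1 + s.im ^ 2) := by
  obtain ⟨C, hC0, hC⟩ := exists_norm_digamma_le
  refine ⟨‖((Real.log (|(d.1 : ℝ)| / Real.pi) : ℝ) : ℂ) / 2‖ + C, by positivity, fun s hs => ?_⟩
  have ha : (parity d : ℝ) ≤ 1 := by exact_mod_cast parity_le_one d
  have ha0 : (0 : ℝ) ≤ parity d := Nat.cast_nonneg _
  have h := hC ((s + parity d) / 2) (by
    rw [re_add_parity_div_two]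
    constructor <;> linarith [hs.1, hs.2])
  have him : ((s + parity d) / 2 : ℂ).im = s.im / 2 := by simp
  rw [him, abs_div, abs_two] at h
  have h1 : 1 + |s.im| / 2 ≤ 2 * (1 + s.im ^ 2) := by
    rw [← sq_abs s.im]; nlinarith [sq_nonneg (|s.im| - 1), abs_nonneg s.im]
  have h2 : C * (1 + |s.im| / 2) ≤ C * (2 * (1 + s.im ^ 2)) := by gcongr
  have h3 : ‖((Real.log (|(d.1 : ℝ)| / Real.pi) : ℝ) : ℂ) / 2‖ * 1 ≤
      ‖((Real.log (|(d.1 : ℝ)| / Real.pi) : ℝ) : ℂ) / 2‖ * (1 + s.im ^ 2) := by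
    gcongr; nlinarith
  rw [archimedeanTerm]
  refine (norm_add_le _ _).trans ?_
  rw [norm_div (digamma _), Complex.norm_ofNat]
  linarith

theorem norm_mul_le_of_decay {a b C C' t : ℝ} (hC : 0 ≤ C) (hb0 : 0 ≤ b)
    (ha : a ≤ C * ((1 + t ^ 2)⁻¹) ^ 3) (hb : b ≤ C' * (1 + t ^ 2)) :
    a * b ≤ C * C' * (1 + t ^ 2)⁻¹ := by
  have hC' : 0 ≤ C' := by
    have h0 : 0 ≤ C' * (1 + t ^ 2) := hb0.trans hb
    exact nonneg_of_mul_nonneg_left h0 (by positivity)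
  calc a * b ≤ (C * ((1 + t ^ 2)⁻¹) ^ 3) * (C' * (1 + t ^ 2)) := by gcongr
    _ = C * C' * ((1 + t ^ 2)⁻¹ * (1 + t ^ 2)⁻¹) := by field_simp
    _ ≤ C * C' * (1 + t ^ 2)⁻¹ := by
        gcongr
        exact mul_le_of_le_one_left (by positivity) (inv_one_add_sq_le_one t)

theorem exists_norm_testFunction_mul_archimedeanTerm_le
    (hs : HasCompactSupport (𝓕 (g : ℝ → ℂ))) (hX : 1 < X) (d : FundamentalDiscriminant) :
    ∃ C : ℝ, ∀ s : ℂ, s.re ∈ Set.Icc (1 / 2 : ℝ) 2 →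
      ‖testFunction g X s * archimedeanTerm d s‖ ≤ C * (1 + s.im ^ 2)⁻¹ := by
  obtain ⟨C, hC0, hC⟩ := exists_norm_testFunction_le hs hX
  obtain ⟨C', hC0', hC'⟩ := exists_norm_archimedeanTerm_le d
  refine ⟨C * C', fun s hs => ?_⟩
  rw [norm_mul]
  exact norm_mul_le_of_decay hC0 (norm_nonneg _) (hC s ⟨by linarith [hs.1], hs.2⟩) (hC' s hs)

theorem integrable_testFunction_mul_archimedeanTerm
    (hs : HasCompactSupport (𝓕 (g : ℝ → ℂ))) (hX : 1 < X) (d : FundamentalDiscriminant) {x : ℝ}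
    (hx : x ∈ Set.Icc (1 / 2 : ℝ) 2) :
    Integrable fun t : ℝ => testFunction g X (x + t * I) * archimedeanTerm d (x + t * I) := by
  obtain ⟨C, hC⟩ := exists_norm_testFunction_mul_archimedeanTerm_le hs hX d
  exact integrable_vertical_line (F := fun s => testFunction g X s * archimedeanTerm d s) hx
    (fun s hs' => ((differentiable_testFunction hs s).mul
      (differentiableAt_archimedeanTerm (by linarith [hs'.1]))).continuousAt) hC

/-- The digamma term has no pole in Re s > 0, so the line moves to Re s = 1/2 without residues. -/
theorem integral_testFunction_mul_archimedeanTerm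
    (hs : HasCompactSupport (𝓕 (g : ℝ → ℂ))) (hX : 1 < X) (d : FundamentalDiscriminant) :
    ∫ t : ℝ, testFunction g X ((2 : ℝ) + t * I) * archimedeanTerm d ((2 : ℝ) + t * I) =
      ∫ t : ℝ, testFunction g X ((1 / 2 : ℝ) + t * I) *
        archimedeanTerm d ((1 / 2 : ℝ) + t * I) := by
  obtain ⟨C, hC⟩ := exists_norm_testFunction_mul_archimedeanTerm_le hs hX d
  exact (integral_vertical_line_eq (F := fun s => testFunction g X s * archimedeanTerm d s)
    (by norm_num) (fun s hs' => (differentiable_testFunction hs s).mul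
      (differentiableAt_archimedeanTerm (by linarith [hs'.1]))) hC).symm

theorem integral_critical_line_scale {E : ℂ → ℂ} (hX : 1 < X) :
    ∫ t : ℝ, testFunction g X ((1 / 2 : ℝ) + t * I) * E ((1 / 2 : ℝ) + t * I) =
      ((2 * Real.pi / Real.log X : ℝ) : ℂ) *
        ∫ τ : ℝ, g τ * E ((1 / 2 : ℝ) + (τ * (2 * Real.pi / Real.log X) : ℝ) * I) := by
  have hl : 0 < Real.log X := Real.log_pos hX
  have hc : 0 < Real.log X / (2 * Real.pi) := div_pos hl (by positivity)
  have h := Measure.integral_comp_mul_right (fun τ : ℝ =>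
    g τ * E ((1 / 2 : ℝ) + (τ * (2 * Real.pi / Real.log X) : ℝ) * I)) (Real.log X / (2 * Real.pi))
  rw [abs_of_pos (inv_pos.mpr hc), inv_div, real_smul] at h
  rw [← h]
  congr 1
  ext t
  rw [testFunction_critical_line]
  congr 4
  field_simp

theorem archimedeanTerm_critical_line (X : ℝ) (d : FundamentalDiscriminant) (τ : ℝ) :
    archimedeanTerm d ((1 / 2 : ℝ) + (τ * (2 * Real.pi / Real.log X) : ℝ) * I) =
      ((Real.log (|(d.1 : ℝ)| / Real.pi) : ℝ) : ℂ) / 2 + digamma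
        (1 / 4 + parity d / 2 + Complex.I * Real.pi * τ / (Real.log X : ℝ)) / 2 := by
  rw [archimedeanTerm]
  congr 3
  push_cast
  ring

theorem integrable_mul_archimedeanTerm (hs : HasCompactSupport (𝓕 (g : ℝ → ℂ))) (hX : 1 < X)
    (d : FundamentalDiscriminant) :
    Integrable fun τ : ℝ => g τ *
      archimedeanTerm d ((1 / 2 : ℝ) + (τ * (2 * Real.pi / Real.log X) : ℝ) * I) := by
  have hl : 0 < Real.log X := Real.log_pos hX
  have h := (integrable_testFunction_mul_archimedeanTerm hs hX d (x := 1 / 2)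
    (by norm_num)).comp_mul_right' (R := 2 * Real.pi / Real.log X) (by positivity)
  refine h.congr (Eventually.of_forall fun τ => ?_)
  simp only
  rw [testFunction_critical_line]
  congr 2
  field_simp

theorem conductorTerm_eq (X : ℝ) (d : FundamentalDiscriminant) (τ : ℝ) :
    conductorTerm X d τ =
      archimedeanTerm d ((1 / 2 : ℝ) + (τ * (2 * Real.pi / Real.log X) : ℝ) * I) +
      archimedeanTerm d ((1 / 2 : ℝ) + (-τ * (2 * Real.pi / Real.log X) : ℝ) * I) := by
  rw [archimedeanTerm_critical_line, archimedeanTerm_critical_line, conductorTerm]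
  have e : 1 / 4 + (parity d : ℂ) / 2 + I * Real.pi * ((-τ : ℝ) : ℂ) / (Real.log X : ℝ) =
      1 / 4 + (parity d : ℂ) / 2 - I * Real.pi * τ / (Real.log X : ℝ) := by
    push_cast; ring
  rw [e]
  ring

theorem integrable_mul_archimedeanTerm_neg (hg : ∀ x : ℝ, g (-x) = g x)
    (hs : HasCompactSupport (𝓕 (g : ℝ → ℂ))) (hX : 1 < X) (d : FundamentalDiscriminant) :
    Integrable fun τ : ℝ => g τ *
      archimedeanTerm d ((1 / 2 : ℝ) + (-τ * (2 * Real.pi / Real.log X) : ℝ) * I) := by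
  simpa only [hg] using (integrable_mul_archimedeanTerm hs hX d).comp_neg

theorem integrable_mul_conductorTerm (hg : ∀ x : ℝ, g (-x) = g x)
    (hs : HasCompactSupport (𝓕 (g : ℝ → ℂ))) (hX : 1 < X) (d : FundamentalDiscriminant) :
    Integrable fun τ : ℝ => g τ * conductorTerm X d τ := by
  simp_rw [conductorTerm_eq, mul_add]
  exact (integrable_mul_archimedeanTerm hs hX d).add (integrable_mul_archimedeanTerm_neg hg hs hX d)

/-- The two digamma terms of the conductor term are exchanged by τ ↦ −τ, so evenness of g makes them
contribute equally. The factor log X / π is 2 divided by the scaling 2π / log X. -/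
theorem integral_mul_conductorTerm (hg : ∀ x : ℝ, g (-x) = g x)
    (hs : HasCompactSupport (𝓕 (g : ℝ → ℂ))) (hX : 1 < X) (d : FundamentalDiscriminant) :
    ∫ τ : ℝ, g τ * conductorTerm X d τ = (Real.log X : ℝ) / Real.pi *
      ∫ t : ℝ, testFunction g X ((2 : ℝ) + t * I) * archimedeanTerm d ((2 : ℝ) + t * I) := by
  have hl : (Real.log X : ℂ) ≠ 0 := by exact_mod_cast (Real.log_pos hX).ne'
  have hπ : (Real.pi : ℂ) ≠ 0 := by exact_mod_cast Real.pi_ne_zero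
  have hsym : ∫ τ : ℝ, g τ *
      archimedeanTerm d ((1 / 2 : ℝ) + (-τ * (2 * Real.pi / Real.log X) : ℝ) * I) =
      ∫ τ : ℝ, g τ *
        archimedeanTerm d ((1 / 2 : ℝ) + (τ * (2 * Real.pi / Real.log X) : ℝ) * I) := by
    rw [← integral_neg_eq_self (fun τ : ℝ => g τ *
      archimedeanTerm d ((1 / 2 : ℝ) + (τ * (2 * Real.pi / Real.log X) : ℝ) * I))]
    simp_rw [hg]
  simp_rw [conductorTerm_eq, mul_add]
  rw [integral_add (integrable_mul_archimedeanTerm hs hX d)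
    (integrable_mul_archimedeanTerm_neg hg hs hX d), hsym,
    integral_testFunction_mul_archimedeanTerm hs hX d, integral_critical_line_scale hX]
  generalize (∫ τ : ℝ, g τ *
    archimedeanTerm d ((1 / 2 : ℝ) + (τ * (2 * Real.pi / Real.log X) : ℝ) * I)) = J
  push_cast
  field_simp
  ring

end GammaPart

/-! ### The contribution of prime powers. -/

section PrimePart

open ArithmeticFunction

variable {g : 𝓢(ℝ, ℂ)} {X : ℝ} {d : FundamentalDiscriminant}

theorem norm_natCast_cpow_neg_le_one {n : ℕ} (hn : n ≠ 0) {s : ℂ} (hs : 0 ≤ s.re) :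
    ‖(n : ℂ) ^ (-s)‖ ≤ 1 := by
  rw [norm_natCast_cpow_of_pos (Nat.pos_of_ne_zero hn), neg_re]
  exact Real.rpow_le_one_of_one_le_of_nonpos
    (by exact_mod_cast Nat.one_le_iff_ne_zero.mpr hn) (by linarith)

theorem exists_norm_testFunction_mul_cpow_le (hs : HasCompactSupport (𝓕 (g : ℝ → ℂ)))
    (hX : 1 < X) {n : ℕ} (hn : n ≠ 0) :
    ∃ C : ℝ, ∀ s : ℂ, s.re ∈ Set.Icc (1 / 2 : ℝ) 2 →
      ‖testFunction g X s * (n : ℂ) ^ (-s)‖ ≤ C * (1 + s.im ^ 2)⁻¹ := by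
  obtain ⟨C, hC0, hC⟩ := exists_norm_testFunction_le hs hX
  refine ⟨C * 1, fun s hs => ?_⟩
  rw [norm_mul]
  refine norm_mul_le_of_decay hC0 (norm_nonneg _) (hC s ⟨by linarith [hs.1], hs.2⟩) ?_
  refine (norm_natCast_cpow_neg_le_one hn (by linarith [hs.1])).trans ?_
  nlinarith

theorem differentiable_testFunction_mul_cpow (hs : HasCompactSupport (𝓕 (g : ℝ → ℂ)))
    {n : ℕ} (hn : n ≠ 0) : Differentiable ℂ fun s => testFunction g X s * (n : ℂ) ^ (-s) := by
  refine (differentiable_testFunction hs).mul fun s => ?_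
  exact (differentiableAt_id.neg).const_cpow (Or.inl (Nat.cast_ne_zero.mpr hn))

theorem integrable_testFunction_mul_cpow (hs : HasCompactSupport (𝓕 (g : ℝ → ℂ)))
    (hX : 1 < X) {n : ℕ} (hn : n ≠ 0) :
    Integrable fun t : ℝ =>
      testFunction g X ((2 : ℝ) + t * I) * (n : ℂ) ^ (-((2 : ℝ) + t * I) : ℂ) := by
  obtain ⟨C, hC⟩ := exists_norm_testFunction_mul_cpow_le hs hX hn
  exact integrable_vertical_line (F := fun s => testFunction g X s * (n : ℂ) ^ (-s))
    (x := 2) (by norm_num)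
    (fun s _ => (differentiable_testFunction_mul_cpow hs hn s).continuousAt) hC

theorem natCast_cpow_neg_critical_line {n : ℕ} (hn : n ≠ 0) (X τ : ℝ) :
    (n : ℂ) ^ (-((1 / 2 : ℝ) + (τ * (2 * Real.pi / Real.log X) : ℝ) * I) : ℂ) =
      ((n : ℝ) ^ (-(1 / 2) : ℝ) : ℝ) *
        exp ((-2 * Real.pi * τ * (Real.log n / Real.log X) : ℝ) * I) := by
  have hn' : (n : ℂ) ≠ 0 := Nat.cast_ne_zero.mpr hn
  rw [neg_add, cpow_add _ _ hn', ofReal_cpow (Nat.cast_nonneg _)]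
  congr 1
  · push_cast; rfl
  · rw [cpow_def_of_ne_zero hn', ← natCast_log]
    congr 1
    push_cast
    ring

/-- On the critical line n^{-s} is n^{-1/2} times the phase e^{−2πiτ log n / log X}, the Fourier
kernel at frequency log n / log X. -/
theorem integral_testFunction_mul_cpow (hs : HasCompactSupport (𝓕 (g : ℝ → ℂ)))
    (hX : 1 < X) {n : ℕ} (hn : n ≠ 0) :
    ∫ t : ℝ, testFunction g X ((2 : ℝ) + t * I) * (n : ℂ) ^ (-((2 : ℝ) + t * I) : ℂ) =
      ((2 * Real.pi / Real.log X : ℝ) : ℂ) * (((n : ℝ) ^ (-(1 / 2) : ℝ) : ℝ) *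
        𝓕 (g : ℝ → ℂ) (Real.log n / Real.log X)) := by
  obtain ⟨C, hC⟩ := exists_norm_testFunction_mul_cpow_le hs hX hn
  rw [← integral_vertical_line_eq (F := fun s => testFunction g X s * (n : ℂ) ^ (-s))
    (by norm_num) (fun s _ => differentiable_testFunction_mul_cpow hs hn s) hC,
    integral_critical_line_scale (E := fun s => (n : ℂ) ^ (-s)) hX,
    Real.fourier_real_eq_integral_exp_smul]
  congr 1
  rw [← integral_const_mul]
  refine integral_congr_ae (Eventually.of_forall fun τ => ?_)
  simp only
  rw [natCast_cpow_neg_critical_line hn, smul_eq_mul]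
  ring

/-- The coefficients `χ_d(n) Λ(n)`. -/
noncomputable def twistedVonMangoldt (d : FundamentalDiscriminant) : ℕ → ℂ :=
  (fun n : ℕ => chi d (n : ZMod d.1.natAbs)) * fun n => (Λ n : ℂ)

theorem two_add_mul_I_re (t : ℝ) : (((2 : ℝ) : ℂ) + t * I).re = 2 := by simp

theorem norm_term_two_add_mul_I (f : ℕ → ℂ) (t : ℝ) (n : ℕ) :
    ‖LSeries.term f ((2 : ℝ) + t * I) n‖ = ‖LSeries.term f (2 : ℝ) n‖ := by
  rw [LSeries.norm_term_eq, LSeries.norm_term_eq, two_add_mul_I_re, ofReal_re]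

theorem logDeriv_LFunction_eq_neg_LSeries {s : ℂ} (hs : 1 < s.re) :
    logDeriv (chi d).LFunction s = -LSeries (twistedVonMangoldt d) s := by
  rw [twistedVonMangoldt, DirichletCharacter.LSeries_twist_vonMangoldt_eq _ hs, logDeriv_apply,
    DirichletCharacter.deriv_LFunction_eq_deriv_LSeries _ hs,
    DirichletCharacter.LFunction_eq_LSeries _ hs, neg_div, neg_neg]

theorem summable_norm_term_two (d : FundamentalDiscriminant) :
    Summable fun n => ‖LSeries.term (twistedVonMangoldt d) (2 : ℝ) n‖ :=
  ((chi d).LSeriesSummable_twist_vonMangoldt (by rw [ofReal_re]; norm_num)).norm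

theorem integrable_testFunction_mul_term (hs : HasCompactSupport (𝓕 (g : ℝ → ℂ))) (hX : 1 < X)
    (f : ℕ → ℂ) (n : ℕ) : Integrable fun t : ℝ =>
      testFunction g X ((2 : ℝ) + t * I) * LSeries.term f ((2 : ℝ) + t * I) n := by
  rcases eq_or_ne n 0 with rfl | hn
  · simp
  · refine ((integrable_testFunction_mul_cpow hs hX hn).const_mul (f n)).congr
      (Eventually.of_forall fun t => ?_)
    simp only [LSeries.term_of_ne_zero hn, cpow_neg]
    ring

theorem integral_testFunction_mul_term (hs : HasCompactSupport (𝓕 (g : ℝ → ℂ))) (hX : 1 < X)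
    (f : ℕ → ℂ) {n : ℕ} (hn : n ≠ 0) :
    ∫ t : ℝ, testFunction g X ((2 : ℝ) + t * I) * LSeries.term f ((2 : ℝ) + t * I) n =
      f n * (((2 * Real.pi / Real.log X : ℝ) : ℂ) * (((n : ℝ) ^ (-(1 / 2) : ℝ) : ℝ) *
        𝓕 (g : ℝ → ℂ) (Real.log n / Real.log X))) := by
  rw [← integral_testFunction_mul_cpow hs hX hn, ← integral_const_mul]
  congr 1
  ext t
  rw [LSeries.term_of_ne_zero hn, cpow_neg]
  ring

theorem integrable_testFunction_mul_logDeriv_LFunction (hd : d.1 ≠ 1)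
    (hs : HasCompactSupport (𝓕 (g : ℝ → ℂ))) (hX : 1 < X) :
    Integrable fun t : ℝ => testFunction g X ((2 : ℝ) + t * I) *
      logDeriv (chi d).LFunction ((2 : ℝ) + t * I) := by
  obtain ⟨C, hC0, hC⟩ := exists_norm_testFunction_le hs hX
  have hL : Differentiable ℂ (chi d).LFunction :=
    DirichletCharacter.differentiable_LFunction (chi_ne_one d hd)
  -- The strip is degenerate: the bound by the Dirichlet series at 2 is needed only on the line Re s
  -- = 2.
  refine integrable_vertical_line (a := 2) (b := 2) (x := 2)
    (C := C * ∑' n, ‖LSeries.term (twistedVonMangoldt d) (2 : ℝ) n‖)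
    (F := fun s => testFunction g X s * logDeriv (chi d).LFunction s) (by norm_num)
    (fun s hs' => ?_) fun s hs' => ?_
  · have hre : 1 ≤ s.re := by linarith [hs'.1]
    have h0 : (chi d).LFunction s ≠ 0 :=
      DirichletCharacter.LFunction_ne_zero_of_one_le_re _ (Or.inl (chi_ne_one d hd)) hre
    exact (differentiable_testFunction hs s).continuousAt.mul
      ((hL.analyticAt s).deriv.continuousAt.div (hL s).continuousAt h0)
  · have hre : s.re = 2 := le_antisymm hs'.2 hs'.1
    have hst : s = (2 : ℝ) + s.im * I := by rw [← hre, re_add_im]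
    have hb : ‖logDeriv (chi d).LFunction s‖ ≤
        ∑' n, ‖LSeries.term (twistedVonMangoldt d) (2 : ℝ) n‖ := by
      rw [logDeriv_LFunction_eq_neg_LSeries (by rw [hre]; norm_num), norm_neg, hst]
      have h := summable_norm_term_two d
      simp_rw [← norm_term_two_add_mul_I _ s.im] at h ⊢
      exact norm_tsum_le_tsum_norm h
    rw [norm_mul]
    refine norm_mul_le_of_decay hC0 (norm_nonneg _) (hC s ⟨by linarith, by linarith⟩)
      (hb.trans ?_)
    exact le_mul_of_one_le_right (tsum_nonneg fun _ => norm_nonneg _) (by nlinarith)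

/-- On Re s = 2 the norm of each Dirichlet term is independent of t, so absolute convergence at s =
2 permits exchanging sum and integral. -/
theorem hasSum_twistedVonMangoldt (hs : HasCompactSupport (𝓕 (g : ℝ → ℂ))) (hX : 1 < X)
    (d : FundamentalDiscriminant) :
    HasSum (fun n : ℕ => twistedVonMangoldt d n * (((2 * Real.pi / Real.log X : ℝ) : ℂ) *
        (((n : ℝ) ^ (-(1 / 2) : ℝ) : ℝ) * 𝓕 (g : ℝ → ℂ) (Real.log n / Real.log X))))
      (-∫ t : ℝ, testFunction g X ((2 : ℝ) + t * I) *
        logDeriv (chi d).LFunction ((2 : ℝ) + t * I)) := by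
  have h := hasSum_integral_of_summable_integral_norm
    (integrable_testFunction_mul_term hs hX (twistedVonMangoldt d)) (by
      simp_rw [norm_mul, norm_term_two_add_mul_I, integral_mul_const]
      exact (summable_norm_term_two d).mul_left _)
  have hval : ∫ t : ℝ, ∑' n, testFunction g X ((2 : ℝ) + t * I) *
        LSeries.term (twistedVonMangoldt d) ((2 : ℝ) + t * I) n =
      -∫ t : ℝ, testFunction g X ((2 : ℝ) + t * I) *
        logDeriv (chi d).LFunction ((2 : ℝ) + t * I) := by
    rw [← integral_neg]
    refine integral_congr_ae (Eventually.of_forall fun t => ?_)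
    simp only
    rw [tsum_mul_left, logDeriv_LFunction_eq_neg_LSeries (by rw [two_add_mul_I_re]; norm_num),
      mul_neg, neg_neg, LSeries]
  rw [← hval]
  refine h.congr_fun fun n => ?_
  rcases eq_or_ne n 0 with rfl | hn
  · simp [twistedVonMangoldt]
  · rw [integral_testFunction_mul_term hs hX _ hn]

theorem twistedVonMangoldt_prime_pow {p k : ℕ} (hp : p.Prime) (hk : k ≠ 0) :
    twistedVonMangoldt d (p ^ k) * (((2 * Real.pi / Real.log X : ℝ) : ℂ) *
        ((((p ^ k : ℕ) : ℝ) ^ (-(1 / 2) : ℝ) : ℝ) *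
          𝓕 (g : ℝ → ℂ) (Real.log (p ^ k : ℕ) / Real.log X))) =
      2 * Real.pi * primeTerm g X d k p := by
  rw [twistedVonMangoldt, Pi.mul_apply, vonMangoldt_apply_pow hk, vonMangoldt_apply_prime hp,
    primeTerm, Nat.cast_pow, Nat.cast_pow, map_pow, Real.rpow_neg (by positivity),
    ← Real.rpow_natCast_mul (Nat.cast_nonneg _), mul_one_div]
  push_cast
  field_simp

/-- Pairs of a positive exponent and a prime correspond to prime powers. -/
noncomputable def primePowEquiv : ℕ+ × Nat.Primes ≃ {n : ℕ // IsPrimePow n} :=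
  ((Equiv.prodComm _ _).trans (Equiv.prodCongr (Equiv.refl _) Equiv.pnatEquivNat)).trans
    Nat.Primes.prodNatEquiv

theorem coe_primePowEquiv (kp : ℕ+ × Nat.Primes) :
    (primePowEquiv kp : ℕ) = (kp.2 : ℕ) ^ (kp.1 : ℕ) := by
  change ((Nat.Primes.prodNatEquiv (kp.2, PNat.natPred kp.1) : {n : ℕ // IsPrimePow n}) : ℕ) = _
  rw [Nat.Primes.coe_prodNatEquiv_apply, PNat.natPred_add_one]

theorem hasSum_primeTerm (hs : HasCompactSupport (𝓕 (g : ℝ → ℂ))) (hX : 1 < X)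
    (d : FundamentalDiscriminant) :
    HasSum (fun kp : ℕ+ × Nat.Primes => 2 * Real.pi * primeTerm g X d kp.1 kp.2)
      (-∫ t : ℝ, testFunction g X ((2 : ℝ) + t * I) *
        logDeriv (chi d).LFunction ((2 : ℝ) + t * I)) := by
  have h := hasSum_twistedVonMangoldt hs hX d
  set f : ℕ → ℂ := fun n : ℕ => twistedVonMangoldt d n * (((2 * Real.pi / Real.log X : ℝ) : ℂ) *
    (((n : ℝ) ^ (-(1 / 2) : ℝ) : ℝ) * 𝓕 (g : ℝ → ℂ) (Real.log n / Real.log X))) with hf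
  have hsupp : Function.support f ⊆ {n : ℕ | IsPrimePow n} := by
    intro n hn
    by_contra hpp
    have h0 : Λ n = 0 := vonMangoldt_eq_zero_iff.mpr hpp
    exact hn (by simp [hf, twistedVonMangoldt, h0])
  have h' := (primePowEquiv.hasSum_iff (f := fun n : {n : ℕ // IsPrimePow n} => f n)).mpr
    ((hasSum_subtype_iff_of_support_subset hsupp).mpr h)
  refine h'.congr_fun fun kp => ?_
  rw [Function.comp_apply, coe_primePowEquiv, hf]
  exact (twistedVonMangoldt_prime_pow kp.2.2 kp.1.ne_zero).symm

end PrimePart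

/-! ### The explicit formula for one character. -/

section PerCharacter

variable {g : 𝓢(ℝ, ℂ)} {X : ℝ} {d : FundamentalDiscriminant}

theorem integral_left_line (hd : d.1 ≠ 1) (hg : ∀ x : ℝ, g (-x) = g x) :
    ∫ t : ℝ, testFunction g X ((-1 : ℝ) + t * I) * logDeriv (completedL d) ((-1 : ℝ) + t * I) =
      -∫ t : ℝ, testFunction g X ((2 : ℝ) + t * I) *
        logDeriv (completedL d) ((2 : ℝ) + t * I) := by
  rw [← integral_neg_eq_self, ← integral_neg]
  congr 1
  ext t
  have e : ((-1 : ℝ) : ℂ) + ((-t : ℝ) : ℂ) * I = 1 - ((2 : ℝ) + t * I) := by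
    push_cast; ring
  rw [e, testFunction_one_sub hg, logDeriv_completedL_one_sub hd, mul_neg]

theorem integral_right_line (hd : d.1 ≠ 1) (hs : HasCompactSupport (𝓕 (g : ℝ → ℂ)))
    (hX : 1 < X) :
    ∫ t : ℝ, testFunction g X ((2 : ℝ) + t * I) * logDeriv (completedL d) ((2 : ℝ) + t * I) =
      (∫ t : ℝ, testFunction g X ((2 : ℝ) + t * I) * archimedeanTerm d ((2 : ℝ) + t * I)) +
      ∫ t : ℝ, testFunction g X ((2 : ℝ) + t * I) *
        logDeriv (chi d).LFunction ((2 : ℝ) + t * I) := by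
  rw [← integral_add (integrable_testFunction_mul_archimedeanTerm hs hX d (by norm_num))
    (integrable_testFunction_mul_logDeriv_LFunction hd hs hX)]
  congr 1
  ext t
  rw [logDeriv_completedL hd (by rw [two_add_mul_I_re]; norm_num), archimedeanTerm]
  ring

/-- The affine change of variable from ordinates to zeros of the completed `L`-function. -/
noncomputable def zeroOrdinatesEquiv (d : FundamentalDiscriminant) :
    zeroOrdinates d ≃ {z : ℂ // completedL d z = 0} where
  toFun γ := ⟨1 / 2 + I * γ, γ.2⟩
  invFun z := ⟨(z - 1 / 2) / I, by
    rw [zeroOrdinates, Set.mem_ofPred_eq, mul_div_cancel₀ _ I_ne_zero, add_sub_cancel]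
    exact z.2⟩
  left_inv γ := Subtype.ext (by
    simp only [add_sub_cancel_left]
    rw [mul_div_cancel_left₀ _ I_ne_zero])
  right_inv z := Subtype.ext (by
    simp only
    rw [mul_div_cancel₀ _ I_ne_zero, add_sub_cancel])

/-- The left line equals minus the right one, so the difference of integrals doubles and 2/(2π) =
1/π remains. -/
theorem hasSum_zeroTerm (hd : d.1 ≠ 1) (hg : ∀ x : ℝ, g (-x) = g x)
    (hs : HasCompactSupport (𝓕 (g : ℝ → ℂ))) (hX : 1 < X) :
    HasSum (fun γ : zeroOrdinates d => zeroTerm g X d γ) (1 / Real.pi *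
      ∫ t : ℝ, testFunction g X ((2 : ℝ) + t * I) *
        logDeriv (completedL d) ((2 : ℝ) + t * I)) := by
  obtain ⟨B, hB, hgrow⟩ := exists_norm_completedL_le hd
  obtain ⟨C, hC, hb⟩ := exists_norm_testFunction_le hs hX
  have hzeros : ∀ z : ℂ, completedL d z = 0 → 0 < z.re ∧ z.re < 1 := fun z hz =>
    ⟨not_le.mp fun h => completedL_ne_zero_of_re_nonpos hd h hz,
      not_le.mp fun h => completedL_ne_zero_of_one_le_re hd h hz⟩
  have h := hasSum_order_mul (differentiable_completedL hd) hB hgrow hzeros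
    (differentiable_testFunction hs) hC hb
  rw [integral_left_line hd hg, sub_neg_eq_add, ← (zeroOrdinatesEquiv d).hasSum_iff] at h
  have hπ : (Real.pi : ℂ) ≠ 0 := ofReal_ne_zero.mpr Real.pi_ne_zero
  have h' := h.mul_left (1 / (2 * Real.pi : ℂ))
  generalize (∫ t : ℝ, testFunction g X ((2 : ℝ) + t * I) *
    logDeriv (completedL d) ((2 : ℝ) + t * I)) = J at h' ⊢
  have hJ : 1 / (2 * Real.pi : ℂ) * (J + J) = 1 / Real.pi * J := by
    field_simp
    ring
  rw [hJ] at h'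
  refine h'.congr_fun fun γ => ?_
  simp only [Function.comp_apply, zeroOrdinatesEquiv, Equiv.coe_fn_mk, testFunction_half_add,
    zeroTerm, zeroMultiplicity]
  field_simp

theorem summable_primeTerm (hs : HasCompactSupport (𝓕 (g : ℝ → ℂ))) (hX : 1 < X)
    (d : FundamentalDiscriminant) :
    Summable fun kp : ℕ+ × Nat.Primes => primeTerm g X d kp.1 kp.2 := by
  have hπ : (2 * Real.pi : ℂ) ≠ 0 :=
    mul_ne_zero two_ne_zero (ofReal_ne_zero.mpr Real.pi_ne_zero)
  exact (summable_mul_left_iff hπ).mp (hasSum_primeTerm hs hX d).summable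

/-- The explicit formula for a single character. -/
theorem tsum_zeroTerm (hd : d.1 ≠ 1) (hg : ∀ x : ℝ, g (-x) = g x)
    (hs : HasCompactSupport (𝓕 (g : ℝ → ℂ))) (hX : 1 < X) :
    ∑' γ : zeroOrdinates d, zeroTerm g X d γ =
      1 / (Real.log X : ℝ) * (∫ τ : ℝ, g τ * conductorTerm X d τ) -
        2 * ∑' k : ℕ+, ∑' p : Nat.Primes, primeTerm g X d k p := by
  have hl : (Real.log X : ℂ) ≠ 0 := ofReal_ne_zero.mpr (Real.log_pos hX).ne'
  have hπ : (Real.pi : ℂ) ≠ 0 := ofReal_ne_zero.mpr Real.pi_ne_zero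
  have hp := (hasSum_primeTerm hs hX d).tsum_eq
  rw [tsum_mul_left, (summable_primeTerm hs hX d).tsum_prod, ← neg_eq_iff_eq_neg] at hp
  rw [(hasSum_zeroTerm hd hg hs hX).tsum_eq, integral_right_line hd hs hX,
    integral_mul_conductorTerm hg hs hX d, ← hp]
  generalize (∫ t : ℝ, testFunction g X ((2 : ℝ) + t * I) *
    archimedeanTerm d ((2 : ℝ) + t * I)) = J
  field_simp
  ring

/-- Besides 1, no fundamental discriminant has absolute value at most 1, so log X > 0 as soon as the
family is nonempty. -/
theorem one_lt_of_abs_le (hd : d.1 ≠ 1) (h : |(d.1 : ℝ)| ≤ X) : 1 < X := by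
  have h1 : 1 < |d.1| := by
    rcases d.2 with ⟨_, h⟩ | ⟨m, h, _, h'⟩ <;> grind
  have h2 : (1 : ℝ) < |(d.1 : ℝ)| := by exact_mod_cast h1
  linarith

end PerCharacter

end ExplicitFormula

/-! ### Averaging over the family. -/

theorem mainTheorem4 (g : 𝓢(ℝ, ℂ)) (hg_even : ∀ x : ℝ, g (-x) = g x)
    (hg_supp : HasCompactSupport (𝓕 (g : ℝ → ℂ)))
    (X : ℝ) (F : Finset FundamentalDiscriminant) (hF : F.Nonempty)
    (hF_ne_one : ∀ d ∈ F, d.1 ≠ 1) (hF_le : ∀ d ∈ F, |(d.1 : ℝ)| ≤ X) :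
    (∀ d ∈ F, Summable fun γ : zeroOrdinates d => zeroTerm g X d γ) ∧
    MeasureTheory.Integrable (fun τ : ℝ => g τ * ∑ d ∈ F, conductorTerm X d τ) ∧
    (∀ d ∈ F, Summable fun kp : ℕ+ × Nat.Primes => primeTerm g X d kp.1 kp.2) ∧
    1 / (F.card : ℂ) * ∑ d ∈ F, ∑' γ : zeroOrdinates d, zeroTerm g X d γ
      = 1 / ((F.card : ℂ) * (Real.log X : ℝ))
          * (∫ τ : ℝ, g τ * ∑ d ∈ F, conductorTerm X d τ)
        - 2 / (F.card : ℂ)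
          * ∑ d ∈ F, ∑' k : ℕ+, ∑' p : Nat.Primes, primeTerm g X d k p := by
  obtain ⟨d₀, hd₀⟩ := hF
  have hX : 1 < X := one_lt_of_abs_le (hF_ne_one d₀ hd₀) (hF_le d₀ hd₀)
  have hcond : ∀ d ∈ F, MeasureTheory.Integrable fun τ : ℝ => g τ * conductorTerm X d τ :=
    fun d _ => integrable_mul_conductorTerm hg_even hg_supp hX d
  refine ⟨fun d hd => (hasSum_zeroTerm (hF_ne_one d hd) hg_even hg_supp hX).summable, ?_,
    fun d _ => summable_primeTerm hg_supp hX d, ?_⟩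
  · simp_rw [Finset.mul_sum]
    exact MeasureTheory.integrable_finsetSum F hcond
  · rw [Finset.sum_congr rfl fun d hd => tsum_zeroTerm (hF_ne_one d hd) hg_even hg_supp hX,
      Finset.sum_sub_distrib, ← Finset.mul_sum, ← Finset.mul_sum]
    have hsum : ∫ τ : ℝ, g τ * ∑ d ∈ F, conductorTerm X d τ =
        ∑ d ∈ F, ∫ τ : ℝ, g τ * conductorTerm X d τ := by
      simp_rw [Finset.mul_sum]
      exact MeasureTheory.integral_finsetSum F hcond
    rw [hsum]
    ring
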